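/- Let $F$ be a nonarchimedean local field of characteristic $0$ with Weil group $W_F$, and let $|\cdot|$ be the absolute value character of $W_F$ (so $|w|=q^{k}$ if $w$ acts as $x\mapsto x^{q^{k}}$ on the residue field of $\overline F$, where $q$ is the cardinality of the residue field of $F$). Let $(G_n)_{n\ge 0}$ be one of the families of quasi-split classical groups $SO_{2n+1}$, $Sp_{2n}$, split $SO_{2n}$, non-split quasi-split $SO_{2n+2}^{*}$, $U_{2n+1}$, $U_{2n}$ over $F$, the last three being attached to a quadratic extension $E=F(\sqrt{\varepsilon})$. Let ${}^LG_n=\widehat G_n\rtimes W_F$ be its $L$-group, with $\widehat G_n=Sp_{2n}(\mathbb C)$, $SO_{2n+1}(\mathbb C)$, $SO_{2n}(\mathbb C)$, $SO_{2n+2}(\mathbb C)$, $GL_{2n+1}(\mathbb C)$, $GL_{2n}(\mathbb C)$ respectively, and let $\Phi(G_n)$ be the set of local Langlands parameters of $G_n$, i.e. of ${}^LG_n$-conjugacy classes of admissible homomorphisms $W_F\times SL_2(\mathbb C)\to{}^LG_n$ (homomorphisms over $W_F$ that are continuous and semisimple on $W_F$ and algebraic on $SL_2(\mathbb C)$). A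 parameter $\phi$ is tempered, $\phi\in\Phi^{(t)}(G_n)$, if $\phi(W_F)$ is bounded (in its $\widehat G_n$-component). Put $K=E$ for the unitary families and $K=F$ otherwise. Through the standard embedding of ${}^LG_n$ into the $L$-group of $GL_N$, respectively of $\mathrm{Res}_{E/F}GL_N$, a parameter is regarded as an $N$-dimensional representation of $W_K\times SL_2(\mathbb C)$; equalities of parameters below are isomorphisms of such representations. Let $S_m$ be the irreducible algebraic representation of $SL_2(\mathbb C)$ of dimension $m$, and for a representation $\rho$ of $W_K$ let $\check\rho$ be its contragredient, composed with conjugation by an element of $W_F\setminus W_E$ in the case of unitary groups. Let $\phi\in\Phi(G_n)$. Then either $\phi\in\Phi^{(t)}(G_n)$, or $$\phi=\phi^{(t)}\oplus\phi^{(n)},$$ where $\phi^{(t)}\in\Phi^{(t)}(G_{n^{*}})$ for some $0\le n^{*}<n$ (in the same family, with the same $E$), and $$\phi^{(n)}=\bigoplus_{i=1}^{f}\Big(|\cdot|^{-q_i+\frac{w_i}{2}}\phi_i\otimes S_{w_i+1}\ \oplus\ |\cdot|^{q_i-\frac{w_i}{2}}\check\phi_i\otimes S_{w_i+1}\Big)$$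 with $f\in\mathbb Z_{>0}$, $w_1,\dots,w_f\in\mathbb Z_{\ge0}$, $q_1,\dots,q_f\in\mathbb R$, each $\phi_i$ an irreducible bounded (continuous, finite-dimensional, complex) representation of $W_K$, and $$\frac{w_1}{2}-q_1\ \ge\ \frac{w_2}{2}-q_2\ \ge\ \cdots\ \ge\ \frac{w_f}{2}-q_f\ >\ 0 .$$ -/

import Mathlib

open ValuativeRel
open scoped MatrixGroups TensorProduct

noncomputable section

namespace LanglandsParam

section Sqrt

variable {F : Type*} [Field F]

/-- A square root of `ε` in the algebraic closure. -/
def sqrtBar (ε : F) : AlgebraicClosure F :=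
  (IsAlgClosed.exists_pow_nat_eq (algebraMap F (AlgebraicClosure F) ε) two_pos).choose

theorem sqrtBar_sq (ε : F) : sqrtBar ε ^ 2 = algebraMap F (AlgebraicClosure F) ε :=
  (IsAlgClosed.exists_pow_nat_eq (algebraMap F (AlgebraicClosure F) ε) two_pos).choose_spec

theorem gal_sqrtBar (σ : AlgebraicClosure F ≃ₐ[F] AlgebraicClosure F) (ε : F) :
    σ (sqrtBar ε) = sqrtBar ε ∨ σ (sqrtBar ε) = -sqrtBar ε := by
  apply sq_eq_sq_iff_eq_or_eq_neg.1
  rw [← map_pow, sqrtBar_sq, AlgEquiv.commutes]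

end Sqrt

/-! ### The Weil group of a nonarchimedean local field -/

section Weil

variable (F : Type*) [Field F] [ValuativeRel F] [TopologicalSpace F] [IsNonarchimedeanLocalField F]

/-- The ring of integers of the algebraic closure of `F`. -/
abbrev IntBar : Subalgebra 𝒪[F] (AlgebraicClosure F) :=
  integralClosure 𝒪[F] (AlgebraicClosure F)

/-- The maximal ideal of the (local) ring `IntBar F`. All primes of `IntBar F` above the maximal
ideal of `𝒪[F]` are maximal and there is only one of them, so it is the radical of the ideal
generated by `𝓂[F]`. -/
def maxBar : Ideal (IntBar F) := ((𝓂[F]).map (algebraMap 𝒪[F] (IntBar F))).radical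

/-- The cardinality of the residue field of `F`. -/
def resCard : ℕ := Nat.card 𝓀[F]

variable {F} in
/-- The action of a Galois automorphism on the integers of the algebraic closure. -/
def intAct (σ : AlgebraicClosure F ≃ₐ[F] AlgebraicClosure F) (x : IntBar F) : IntBar F :=
  ⟨σ x, IsIntegral.map (σ.restrictScalars 𝒪[F]) x.2⟩

variable {F} in
/-- On the residue field of the algebraic closure, `σ(x)^(q^b) = x^(q^a)`, that is,
`σ` acts as `x ↦ x^(q^(a - b))`. -/
def ActsAs (σ : AlgebraicClosure F ≃ₐ[F] AlgebraicClosure F) (a b : ℕ) : Prop :=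
  ∀ x : IntBar F, intAct σ x ^ resCard F ^ b - x ^ resCard F ^ a ∈ maxBar F

variable {F}

theorem actsAs_mul {σ τ : AlgebraicClosure F ≃ₐ[F] AlgebraicClosure F} {a b c d : ℕ}
    (h₁ : ActsAs σ a b) (h₂ : ActsAs τ c d) : ActsAs (σ * τ) (a + c) (b + d) := by
  intro x
  have e : intAct (σ * τ) x = intAct σ (intAct τ x) := rfl
  have h1 := (Ideal.Quotient.mk_eq_mk_iff_sub_mem _ _).2 (h₁ (intAct τ x))
  have h2 := (Ideal.Quotient.mk_eq_mk_iff_sub_mem _ _).2 (h₂ x)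
  refine (Ideal.Quotient.mk_eq_mk_iff_sub_mem _ _).1 ?_
  simp only [map_pow] at h1 h2 ⊢
  rw [e, pow_add, pow_add, pow_mul, h1, ← pow_mul, mul_comm, pow_mul, h2, ← pow_mul, mul_comm]

theorem actsAs_inv {σ : AlgebraicClosure F ≃ₐ[F] AlgebraicClosure F} {a b : ℕ}
    (h : ActsAs σ a b) : ActsAs σ⁻¹ b a := by
  intro x
  have e : intAct σ (intAct σ⁻¹ x) = x := Subtype.ext (σ.apply_symm_apply _)
  have := h (intAct σ⁻¹ x)
  rw [e] at this
  rw [← neg_sub]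
  exact (maxBar F).neg_mem this

theorem maxBar_ne_top : maxBar F ≠ ⊤ := by
  intro h
  rw [maxBar, Ideal.radical_eq_top] at h
  obtain ⟨Q, hQ, e⟩ := Ideal.exists_ideal_over_maximal_of_isIntegral (S := IntBar F) 𝓂[F]
    (by
      have hinj : Function.Injective (algebraMap 𝒪[F] (IntBar F)) := fun x y hxy =>
        Subtype.ext ((algebraMap F (AlgebraicClosure F)).injective (congrArg Subtype.val hxy))
      rw [(RingHom.injective_iff_ker_eq_bot _).1 hinj]
      exact bot_le)
  apply hQ.ne_top
  rw [eq_top_iff, ← h, Ideal.map_le_iff_le_comap, e]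

theorem one_lt_resCard : 1 < resCard F := Finite.one_lt_card

theorem pow_unique {m n : ℕ} (hmn : m < n)
    (h : ∀ x : IntBar F, x ^ resCard F ^ n - x ^ resCard F ^ m ∈ maxBar F) : False := by
  have hlt : resCard F ^ m < resCard F ^ n := Nat.pow_lt_pow_right one_lt_resCard hmn
  have hdeg : (Polynomial.X ^ resCard F ^ m + 1 : Polynomial 𝒪[F]).degree <
      (resCard F ^ n : ℕ) := by
    refine lt_of_le_of_lt (Polynomial.degree_add_le _ _) (max_lt ?_ ?_)
    · rw [Polynomial.degree_X_pow]
      exact_mod_cast hlt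
    · rw [Polynomial.degree_one]
      exact_mod_cast (Nat.zero_le _).trans_lt hlt
  have hmonic : (Polynomial.X ^ resCard F ^ n - (Polynomial.X ^ resCard F ^ m + 1) :
      Polynomial 𝒪[F]).Monic := Polynomial.monic_X_pow_sub hdeg
  obtain ⟨z, hz⟩ := IsAlgClosed.exists_eval₂_eq_zero_of_injective
    (algebraMap 𝒪[F] (AlgebraicClosure F))
    (fun x y hxy => Subtype.ext ((algebraMap F (AlgebraicClosure F)).injective hxy))
    (Polynomial.X ^ resCard F ^ n - (Polynomial.X ^ resCard F ^ m + 1) : Polynomial 𝒪[F])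
    (by
      rw [Polynomial.degree_sub_eq_left_of_degree_lt (by rwa [Polynomial.degree_X_pow]),
        Polynomial.degree_X_pow]
      exact_mod_cast ((Nat.zero_le _).trans_lt hlt).ne')
  have hx := h ⟨z, _, hmonic, hz⟩
  refine maxBar_ne_top (F := F) ((Ideal.eq_top_iff_one _).2 ?_)
  convert hx
  refine Subtype.ext ?_
  simp only [Polynomial.eval₂_sub, Polynomial.eval₂_add, Polynomial.eval₂_X_pow,
    Polynomial.eval₂_one] at hz
  simp only [OneMemClass.coe_one, AddSubgroupClass.coe_sub, SubmonoidClass.coe_pow]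
  linear_combination -hz

theorem actsAs_unique {σ : AlgebraicClosure F ≃ₐ[F] AlgebraicClosure F} {a b c d : ℕ}
    (h₁ : ActsAs σ a b) (h₂ : ActsAs σ c d) : (a : ℤ) - b = (c : ℤ) - d := by
  have key : ∀ x : IntBar F,
      x ^ resCard F ^ (a + d) - x ^ resCard F ^ (c + b) ∈ maxBar F := by
    intro x
    have h1 := (Ideal.Quotient.mk_eq_mk_iff_sub_mem _ _).2 (h₁ x)
    have h2 := (Ideal.Quotient.mk_eq_mk_iff_sub_mem _ _).2 (h₂ x)
    refine (Ideal.Quotient.mk_eq_mk_iff_sub_mem _ _).1 ?_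
    simp only [map_pow] at h1 h2 ⊢
    rw [pow_add, pow_mul, ← h1, pow_add, pow_mul, ← h2, ← pow_mul, ← pow_mul, mul_comm]
  rcases lt_trichotomy (a + d) (c + b) with h | h | h
  · refine (pow_unique (F := F) h fun x => ?_).elim
    rw [← neg_sub]
    exact (maxBar F).neg_mem (key x)
  · omega
  · exact (pow_unique (F := F) h key).elim

variable (F)

/-- The Weil group as a subgroup of the absolute Galois group: the automorphisms that act on the
residue field of the algebraic closure as an integral power of `x ↦ x^q`. -/
def weilSubgroup : Subgroup (AlgebraicClosure F ≃ₐ[F] AlgebraicClosure F) where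
  carrier := {σ | ∃ a b : ℕ, ActsAs σ a b}
  mul_mem' := by
    rintro σ τ ⟨a, b, h₁⟩ ⟨c, d, h₂⟩
    exact ⟨_, _, actsAs_mul h₁ h₂⟩
  one_mem' := ⟨0, 0, fun x => by
    have e : intAct (1 : AlgebraicClosure F ≃ₐ[F] AlgebraicClosure F) x = x := rfl
    rw [e, sub_self]
    exact (maxBar F).zero_mem⟩
  inv_mem' := by
    rintro σ ⟨a, b, h⟩
    exact ⟨b, a, actsAs_inv h⟩

/-- The Weil group `W_F`. It does not carry the subspace topology of the Galois group. -/
def WeilGroup : Type _ := weilSubgroup F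

instance : Group (WeilGroup F) := inferInstanceAs (Group (weilSubgroup F))

/-- The inclusion of the Weil group into the absolute Galois group. -/
def WeilGroup.toGal : WeilGroup F →* (AlgebraicClosure F ≃ₐ[F] AlgebraicClosure F) :=
  (weilSubgroup F).subtype

variable {F}

theorem WeilGroup.exists_deg (w : WeilGroup F) :
    ∃ k : ℤ, ∃ a b : ℕ, ActsAs (WeilGroup.toGal F w) a b ∧ k = (a : ℤ) - b := by
  obtain ⟨a, b, h⟩ := w.2
  exact ⟨_, a, b, h, rfl⟩

/-- The integer `k` such that `w` acts on the residue field of the algebraic closure as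
`x ↦ x^(q^k)`. -/
def WeilGroup.deg : WeilGroup F →* Multiplicative ℤ :=
  MonoidHom.mk' (fun w => Multiplicative.ofAdd w.exists_deg.choose) (by
    intro v w
    obtain ⟨a, b, h₁, e₁⟩ := v.exists_deg.choose_spec
    obtain ⟨c, d, h₂, e₂⟩ := w.exists_deg.choose_spec
    obtain ⟨i, j, h₃, e₃⟩ := (v * w).exists_deg.choose_spec
    rw [map_mul] at h₃
    have := actsAs_unique h₃ (actsAs_mul h₁ h₂)
    rw [← ofAdd_add, e₁, e₂, e₃, this]
    push_cast
    congr 1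
    ring)

/-- The topology of the Weil group: the inertia group, with its profinite topology, is open. -/
instance : TopologicalSpace (WeilGroup F) :=
  TopologicalSpace.induced (fun w => (WeilGroup.toGal F w, WeilGroup.deg w)) inferInstance

/-- The power `|w|^t` of the absolute value of the Weil group, where `|w| = q^k` if `w` acts as
`x ↦ x^(q^k)` on the residue field of the algebraic closure. -/
def WeilGroup.absPow (t : ℝ) : WeilGroup F →* ℂ where
  toFun w := (((resCard F : ℝ) ^ (t * ((Multiplicative.toAdd w.deg : ℤ) : ℝ)) : ℝ) : ℂ)
  map_one' := by simp
  map_mul' v w := by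
    have hq : (0 : ℝ) < resCard F := by exact_mod_cast (zero_lt_one.trans (one_lt_resCard (F := F)))
    rw [← Complex.ofReal_mul, ← Real.rpow_add hq, map_mul, toAdd_mul]
    push_cast
    rw [mul_add]

open Classical in
/-- The quadratic character of `W_F` attached to `E = F(√ε)`: it is `1` exactly on `W_E`. -/
def quadChar [CharZero F] (ε : F) (hε : ¬ IsSquare ε) : WeilGroup F →* ℤˣ :=
  MonoidHom.mk' (fun w => if WeilGroup.toGal F w (sqrtBar ε) = sqrtBar ε then 1 else -1) (by
    intro v w
    have h0 : sqrtBar ε ≠ 0 := by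
      intro h
      have := sqrtBar_sq ε
      rw [h, zero_pow two_ne_zero, eq_comm, map_eq_zero] at this
      exact hε (this ▸ IsSquare.zero)
    have h1 : -sqrtBar ε ≠ sqrtBar ε := fun h => h0 (self_eq_neg.1 h.symm)
    rw [map_mul, AlgEquiv.mul_apply]
    rcases gal_sqrtBar (WeilGroup.toGal F v) ε with hv | hv <;>
    rcases gal_sqrtBar (WeilGroup.toGal F w) ε with hw | hw <;>
    simp [hv, hw, h1])

end Weil

/-! ### The quasi-split classical groups and their `L`-groups -/

/-- The families `SO_{2n+1}`, `Sp_{2n}`, split `SO_{2n}`, non-split quasi-split `SO_{2n+2}`,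
`U_{2n+1}` and `U_{2n}` over `F`, the last three attached to `E = F(√ε)`. -/
inductive Family (F : Type*) [Field F]
  | oddOrth
  | sympl
  | evenOrth
  | quasiEvenOrth (ε : F) (hε : ¬ IsSquare ε)
  | oddUnit (ε : F) (hε : ¬ IsSquare ε)
  | evenUnit (ε : F) (hε : ¬ IsSquare ε)

/-- The homomorphism from `{1, -1}` that sends `-1` to an involution. -/
def signHom {G : Type*} [Group G] (θ : G) (hθ : θ * θ = 1) : ℤˣ →* G :=
  MonoidHom.mk' (fun u => if u = 1 then 1 else θ) (by
    intro u v
    rcases Int.units_eq_one_or u with rfl | rfl <;> rcases Int.units_eq_one_or v with rfl | rfl <;>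
    simp [hθ])

theorem signHom_neg_one {G : Type*} [Group G] (θ : G) (hθ : θ * θ = 1) :
    signHom θ hθ (-1) = θ := by
  have h : (-1 : ℤˣ) ≠ 1 := by decide
  simp [signHom, h]

/-- The matrix with entries `s 0, s 1, …` on the antidiagonal, from top to bottom. -/
def antidiag (N : ℕ) (s : ℕ → ℂ) : Matrix (Fin N) (Fin N) ℂ :=
  Matrix.of fun i j => if (i : ℕ) + j + 1 = N then s i else 0

theorem antidiag_mul_self (N : ℕ) (s : ℕ → ℂ) (c : ℂ)
    (h : ∀ i < N, s i * s (N - 1 - i) = c) : antidiag N s * antidiag N s = c • 1 := by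
  ext i k
  have hi := i.2
  rw [Matrix.mul_apply, Finset.sum_eq_single (⟨N - 1 - i, by omega⟩ : Fin N)]
  · simp only [antidiag, Matrix.of_apply, Matrix.smul_apply, Matrix.one_apply, smul_eq_mul]
    rw [if_pos (by omega)]
    by_cases e : i = k
    · subst e
      rw [if_pos (by omega), if_pos rfl, h i hi, mul_one]
    · rw [if_neg (by have := Fin.val_ne_of_ne e; omega), if_neg e]
      simp
  · intro j _ hj
    simp only [antidiag, Matrix.of_apply]
    rw [if_neg (fun e => hj (Fin.ext (by simp only; omega))), zero_mul]
  · intro hh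
    exact absurd (Finset.mem_univ _) hh

namespace Family

section Basic

variable {F : Type*} [Field F]

/-- The dimension `N` of the standard representation of the dual group of `G_n`. -/
def dim : Family F → ℕ → ℕ
  | oddOrth, n => 2 * n
  | sympl, n => 2 * n + 1
  | evenOrth, n => 2 * n
  | quasiEvenOrth _ _, n => 2 * n + 2
  | oddUnit _ _, n => 2 * n + 1
  | evenUnit _ _, n => 2 * n

/-- The antidiagonal entries of the matrix of the form. -/
def formEntry : Family F → ℕ → ℕ → ℂ
  | oddOrth, n => fun i => if i < n then -1 else 1
  | sympl, _ => fun _ => 1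
  | evenOrth, _ => fun _ => 1
  | quasiEvenOrth _ _, _ => fun _ => 1
  | oddUnit _ _, _ => fun i => (-1) ^ i
  | evenUnit _ _, n => fun i => if i < n then 1 else -1

/-- The symmetry sign of the matrix of the form. -/
def formSign : Family F → ℂ
  | oddOrth => -1
  | sympl => 1
  | evenOrth => 1
  | quasiEvenOrth _ _ => 1
  | oddUnit _ _ => 1
  | evenUnit _ _ => -1

theorem formSign_mul_self (T : Family F) : T.formSign * T.formSign = 1 := by
  cases T <;> simp [formSign]

theorem formEntry_mul (T : Family F) (n i : ℕ) (hi : i < T.dim n) :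
    T.formEntry n i * T.formEntry n (T.dim n - 1 - i) = T.formSign := by
  have key : ∀ a b : ℂ, i < 2 * n → (if i < n then a else b) *
      (if 2 * n - 1 - i < n then a else b) = a * b := by
    intro a b h2
    by_cases h : i < n
    · rw [if_pos h, if_neg (by omega)]
    · rw [if_neg h, if_pos (by omega), mul_comm]
  cases T with
  | oddOrth => exact (key (-1) 1 hi).trans (by simp [formSign])
  | sympl => simp [formEntry, formSign]
  | evenOrth => simp [formEntry, formSign]
  | quasiEvenOrth ε hε => simp [formEntry, formSign]
  | oddUnit ε hε =>
    have h2 : i < 2 * n + 1 := hi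
    change (-1 : ℂ) ^ i * (-1) ^ (2 * n + 1 - 1 - i) = 1
    rw [← pow_add]
    exact Even.neg_one_pow ⟨n, by omega⟩
  | evenUnit ε hε => exact (key 1 (-1) hi).trans (by simp [formSign])

/-- The matrix of the form: the symmetric matrix with `1` on the antidiagonal for the orthogonal
dual groups, `(0, -J_n; J_n, 0)` for the symplectic ones, and for the unitary families the matrix
with alternating signs on the antidiagonal (`N` odd), respectively `(0, J_n; -J_n, 0)` (`N` even),
that defines the unitary group. -/
def form (T : Family F) (n : ℕ) : GL (Fin (T.dim n)) ℂ where
  val := antidiag (T.dim n) (T.formEntry n)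
  inv := T.formSign • antidiag (T.dim n) (T.formEntry n)
  val_inv := by
    rw [Matrix.mul_smul, antidiag_mul_self _ _ _ (T.formEntry_mul n), smul_smul,
      formSign_mul_self, one_smul]
  inv_val := by
    rw [Matrix.smul_mul, antidiag_mul_self _ _ _ (T.formEntry_mul n), smul_smul,
      formSign_mul_self, one_smul]

/-- The transpose inverse as an automorphism of `GL_N`. -/
def _root_.LanglandsParam.transposeInv (N : ℕ) : MulAut (GL (Fin N) ℂ) where
  toFun g := ⟨(g⁻¹).val.transpose, g.val.transpose,
    by rw [← Matrix.transpose_mul]; simp, by rw [← Matrix.transpose_mul]; simp⟩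
  invFun g := ⟨(g⁻¹).val.transpose, g.val.transpose,
    by rw [← Matrix.transpose_mul]; simp, by rw [← Matrix.transpose_mul]; simp⟩
  left_inv g := by ext; rfl
  right_inv g := by ext; rfl
  map_mul' g h := by
    apply Units.ext
    simp [mul_inv_rev, Matrix.transpose_mul]

/-- An element of the orthogonal group of the form with `h * h = 1`: for the non-split even
orthogonal groups the transposition of the two middle coordinates, which has determinant `-1`;
the identity otherwise. -/
def outerElt : (T : Family F) → (n : ℕ) → GL (Fin (T.dim n)) ℂ
  | quasiEvenOrth _ _, n =>
    let P : Matrix (Fin (2 * n + 2)) (Fin (2 * n + 2)) ℂ :=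
      (Equiv.swap (⟨n, by omega⟩ : Fin (2 * n + 2)) ⟨n + 1, by omega⟩).permMatrix ℂ
    have hP : P * P = 1 := by
      rw [← Matrix.permMatrix_mul, Equiv.swap_mul_self, Matrix.permMatrix_one]
    ⟨P, P, hP, hP⟩
  | oddOrth, _ => 1
  | sympl, _ => 1
  | evenOrth, _ => 1
  | oddUnit _ _, _ => 1
  | evenUnit _ _, _ => 1

theorem outerElt_mul_self (T : Family F) (n : ℕ) : T.outerElt n * T.outerElt n = 1 := by
  cases T with
  | quasiEvenOrth ε hε =>
    apply Units.ext
    change (Equiv.swap (⟨n, by omega⟩ : Fin (2 * n + 2)) ⟨n + 1, by omega⟩).permMatrix ℂ *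
      (Equiv.swap (⟨n, by omega⟩ : Fin (2 * n + 2)) ⟨n + 1, by omega⟩).permMatrix ℂ = 1
    rw [← Matrix.permMatrix_mul, Equiv.swap_mul_self, Matrix.permMatrix_one]
  | _ => exact mul_one 1

/-- The subgroup `{g | gᵀ J g = J}` of `GL_N(ℂ)`. -/
def _root_.LanglandsParam.isometryGroup {N : ℕ} (J : Matrix (Fin N) (Fin N) ℂ) :
    Subgroup (GL (Fin N) ℂ) where
  carrier := {g | g.val.transpose * J * g.val = J}
  mul_mem' := by
    intro g h hg hh
    simp only [Set.mem_ofPred_eq, Units.val_mul, Matrix.transpose_mul] at hg hh ⊢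
    calc _ = h.val.transpose * (g.val.transpose * J * g.val) * h.val := by
          simp only [Matrix.mul_assoc]
      _ = J := by rw [hg, hh]
  one_mem' := by simp
  inv_mem' := by
    intro g hg
    simp only [Set.mem_ofPred_eq] at hg ⊢
    have h1 : (g⁻¹).val.transpose * g.val.transpose = 1 := by
      rw [← Matrix.transpose_mul]; simp
    have h2 : g.val * (g⁻¹).val = 1 := by simp
    calc _ = (g⁻¹).val.transpose * (g.val.transpose * J * g.val) * (g⁻¹).val := by rw [hg]
      _ = ((g⁻¹).val.transpose * g.val.transpose) * J * (g.val * (g⁻¹).val) := by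
          simp only [Matrix.mul_assoc]
      _ = J := by rw [h1, h2, one_mul, mul_one]

/-- The special orthogonal group of the matrix `J`. -/
def _root_.LanglandsParam.specialIsometryGroup {N : ℕ} (J : Matrix (Fin N) (Fin N) ℂ) :
    Subgroup (GL (Fin N) ℂ) :=
  isometryGroup J ⊓ (Matrix.GeneralLinearGroup.det (n := Fin N) (R := ℂ)).ker

/-- The complex dual group of `G_n`: `Sp_{2n}`, `SO_{2n+1}`, `SO_{2n}`, `SO_{2n+2}`, `GL_{2n+1}`
and `GL_{2n}`. -/
def dualGroup (T : Family F) (n : ℕ) : Subgroup (GL (Fin (T.dim n)) ℂ) :=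
  match T with
  | oddOrth => isometryGroup (oddOrth.form n : GL _ ℂ).val
  | sympl => specialIsometryGroup (sympl.form n : GL _ ℂ).val
  | evenOrth => specialIsometryGroup (evenOrth.form n : GL _ ℂ).val
  | quasiEvenOrth ε hε => specialIsometryGroup ((quasiEvenOrth ε hε).form n : GL _ ℂ).val
  | oddUnit _ _ => ⊤
  | evenUnit _ _ => ⊤

/-- The automorphism of `GL_N(ℂ)` through which the nontrivial element of `Gal(E/F)` acts on the
dual group: `g ↦ J⁻¹ ᵗg⁻¹ J` for the unitary families and `g ↦ h⁻¹ g h` otherwise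
(with `h = 1` for the split groups). -/
def galAut : (T : Family F) → (n : ℕ) → MulAut (GL (Fin (T.dim n)) ℂ)
  | oddUnit ε hε, n => MulAut.conj ((oddUnit ε hε).form n)⁻¹ * transposeInv _
  | evenUnit ε hε, n => MulAut.conj ((evenUnit ε hε).form n)⁻¹ * transposeInv _
  | oddOrth, n => MulAut.conj (oddOrth.outerElt n)⁻¹
  | sympl, n => MulAut.conj (sympl.outerElt n)⁻¹
  | evenOrth, n => MulAut.conj (evenOrth.outerElt n)⁻¹
  | quasiEvenOrth ε hε, n => MulAut.conj ((quasiEvenOrth ε hε).outerElt n)⁻¹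

theorem formEntry_sq (T : Family F) (n i : ℕ) : T.formEntry n i * T.formEntry n i = 1 := by
  cases T with
  | oddOrth =>
    change (if i < n then (-1 : ℂ) else 1) * (if i < n then (-1 : ℂ) else 1) = 1
    split_ifs <;> simp
  | evenUnit ε hε =>
    change (if i < n then (1 : ℂ) else -1) * (if i < n then (1 : ℂ) else -1) = 1
    split_ifs <;> simp
  | oddUnit ε hε =>
    change (-1 : ℂ) ^ i * (-1) ^ i = 1
    rw [← pow_add]
    exact Even.neg_one_pow ⟨i, rfl⟩
  | _ => exact mul_one 1

theorem form_transpose (T : Family F) (n : ℕ) :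
    (T.form n).val.transpose = T.formSign • (T.form n).val := by
  ext i j
  have hi := i.2
  have hj := j.2
  simp only [form, antidiag, Matrix.transpose_apply, Matrix.of_apply, Matrix.smul_apply,
    smul_eq_mul]
  by_cases h : (i : ℕ) + j + 1 = T.dim n
  · rw [if_pos h, if_pos (by omega)]
    have h1 := T.formEntry_mul n i hi
    have e : T.dim n - 1 - i = j := by omega
    rw [e] at h1
    linear_combination T.formEntry n i * h1 - T.formEntry n j * T.formEntry_sq n i
  · rw [if_neg h, if_neg (by omega), mul_zero]

theorem galAut_mul_self (T : Family F) (n : ℕ) : T.galAut n * T.galAut n = 1 := by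
  have hO : MulAut.conj (T.outerElt n)⁻¹ * MulAut.conj (T.outerElt n)⁻¹ = 1 := by
    rw [← map_mul, ← mul_inv_rev, outerElt_mul_self, inv_one, map_one]
  have hU : (MulAut.conj (T.form n)⁻¹ * transposeInv _) *
      (MulAut.conj (T.form n)⁻¹ * transposeInv _) = 1 := by
    ext1 g
    apply Units.ext
    have e : ((T.form n)⁻¹).val = T.formSign • (T.form n).val := rfl
    have hJ : (T.form n).val * (T.form n).val = T.formSign • 1 :=
      antidiag_mul_self _ _ _ (T.formEntry_mul n)
    have hc := T.formSign_mul_self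
    have hT : (T.form n).val.transpose = T.formSign • (T.form n).val := T.form_transpose n
    have step : ∀ g : GL (Fin (T.dim n)) ℂ,
        (MulAut.conj (T.form n)⁻¹ * transposeInv (T.dim n) : MulAut _) g =
          (T.form n)⁻¹ * transposeInv _ g * T.form n := by
      intro g
      rw [MulAut.mul_apply, MulAut.conj_apply, inv_inv]
    have tr : ∀ g : GL (Fin (T.dim n)) ℂ,
        (transposeInv _ g).val = (g⁻¹).val.transpose := fun g => rfl
    have tri : (transposeInv _ g)⁻¹.val = g.val.transpose := rfl
    rw [MulAut.mul_apply, step, step, MulAut.one_apply]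
    simp only [Units.val_mul, tr, mul_inv_rev, inv_inv, tri, Matrix.transpose_mul,
      Matrix.transpose_transpose, e, Matrix.transpose_smul, hT]
    calc _ = (T.formSign * T.formSign * (T.formSign * T.formSign)) •
          (((T.form n).val * (T.form n).val) * g.val * ((T.form n).val * (T.form n).val)) := by
          simp only [Matrix.smul_mul, Matrix.mul_smul, smul_smul, mul_assoc]
      _ = g.val := by
          rw [hJ, hc]
          simp [smul_smul, hc]
  cases T with
  | oddUnit ε hε => exact hU
  | evenUnit ε hε => exact hU
  | _ => exact hO

theorem outerElt_mem (T : Family F) (n : ℕ) :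
    T.outerElt n ∈ isometryGroup (T.form n).val := by
  cases T with
  | quasiEvenOrth ε hε =>
    set σ : Equiv.Perm (Fin (2 * n + 2)) := Equiv.swap ⟨n, by omega⟩ ⟨n + 1, by omega⟩ with hσ
    have hs : ∀ i : Fin (2 * n + 2), ((σ i : Fin (2 * n + 2)) : ℕ) =
        if (i : ℕ) = n then n + 1 else if (i : ℕ) = n + 1 then n else i := by
      intro i
      rw [hσ, Equiv.swap_apply_def]
      simp only [Fin.ext_iff]
      split_ifs <;> rfl
    change (σ.permMatrix ℂ).transpose * antidiag (2 * n + 2) (fun _ => 1) * σ.permMatrix ℂ =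
      antidiag (2 * n + 2) (fun _ => 1)
    rw [Matrix.transpose_permMatrix]
    ext i j
    rw [Equiv.Perm.permMatrix, Equiv.Perm.permMatrix, PEquiv.toMatrix_toPEquiv_mul,
      PEquiv.mul_toMatrix_toPEquiv]
    have hinv : σ⁻¹ = σ := Equiv.swap_inv _ _
    have hsymm : σ.symm = σ := hinv
    simp only [Matrix.submatrix_apply, id, hinv, hsymm, antidiag, Matrix.of_apply, hs]
    have := i.2
    have := j.2
    congr 1
    split_ifs <;> (apply propext; omega)
  | _ => exact one_mem _

theorem galAut_mem (T : Family F) (n : ℕ) {g : GL (Fin (T.dim n)) ℂ} (hg : g ∈ T.dualGroup n) :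
    T.galAut n g ∈ T.dualGroup n := by
  have hI : g ∈ isometryGroup (T.form n).val →
      MulAut.conj (T.outerElt n)⁻¹ g ∈ isometryGroup (T.form n).val := by
    intro h
    rw [MulAut.conj_apply]
    exact mul_mem (mul_mem (inv_mem (T.outerElt_mem n)) h) (inv_mem (inv_mem (T.outerElt_mem n)))
  have hS : g ∈ specialIsometryGroup (T.form n).val →
      MulAut.conj (T.outerElt n)⁻¹ g ∈ specialIsometryGroup (T.form n).val := by
    intro h
    refine ⟨hI h.1, ?_⟩
    have h2 : Matrix.GeneralLinearGroup.det g = 1 := h.2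
    change Matrix.GeneralLinearGroup.det _ = 1
    rw [MulAut.conj_apply]
    simp [h2]
  cases T with
  | oddUnit ε hε => exact Subgroup.mem_top _
  | evenUnit ε hε => exact Subgroup.mem_top _
  | oddOrth => exact hI hg
  | _ => exact hS hg

/-- The automorphism of the dual group given by the nontrivial element of `Gal(E/F)`. -/
def dualAut (T : Family F) (n : ℕ) : MulAut (T.dualGroup n) where
  toFun g := ⟨T.galAut n g, T.galAut_mem n g.2⟩
  invFun g := ⟨T.galAut n g, T.galAut_mem n g.2⟩
  left_inv g := Subtype.ext (DFunLike.congr_fun (T.galAut_mul_self n) g.1)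
  right_inv g := Subtype.ext (DFunLike.congr_fun (T.galAut_mul_self n) g.1)
  map_mul' g h := Subtype.ext (map_mul (T.galAut n) g.1 h.1)

theorem dualAut_mul_self (T : Family F) (n : ℕ) : T.dualAut n * T.dualAut n = 1 := by
  ext1 g
  exact Subtype.ext (DFunLike.congr_fun (T.galAut_mul_self n) g.1)

end Basic

section Local

variable {F : Type*} [Field F] [ValuativeRel F] [TopologicalSpace F] [IsNonarchimedeanLocalField F]
  [CharZero F]

/-- The character of `W_F` that cuts out `E`; it is trivial for the split groups. -/
def quad : Family F → (WeilGroup F →* ℤˣ)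
  | oddOrth => 1
  | sympl => 1
  | evenOrth => 1
  | quasiEvenOrth ε hε => quadChar ε hε
  | oddUnit ε hε => quadChar ε hε
  | evenUnit ε hε => quadChar ε hε

/-- The action of `W_F` on the dual group. -/
def act (T : Family F) (n : ℕ) : WeilGroup F →* MulAut (T.dualGroup n) :=
  (signHom (T.dualAut n) (T.dualAut_mul_self n)).comp T.quad

/-- The `L`-group of `G_n`: the semidirect product of the dual group and `W_F`. -/
abbrev LGroup (T : Family F) (n : ℕ) : Type _ := T.dualGroup n ⋊[T.act n] WeilGroup F

/-- The Weil group of the field over which `H_N = GL_N`, respectively `H_N = Res_{E/F} GL_N`, is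
a general linear group: `W_E` for the unitary families and `W_F` otherwise. -/
def baseWeil : Family F → Subgroup (WeilGroup F)
  | oddUnit ε hε => (quadChar ε hε).ker
  | evenUnit ε hε => (quadChar ε hε).ker
  | oddOrth => ⊤
  | sympl => ⊤
  | evenOrth => ⊤
  | quasiEvenOrth _ _ => ⊤

instance (T : Family F) : T.baseWeil.Normal := by
  cases T <;> simp only [baseWeil] <;> infer_instance

/-- The homomorphism `W_F → O_N(ℂ)` used to embed the `L`-group of a non-split even orthogonal
group into `GL_N(ℂ)`; it is trivial for the other families. -/
def twist (T : Family F) (n : ℕ) : WeilGroup F →* GL (Fin (T.dim n)) ℂ :=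
  (signHom (T.outerElt n) (T.outerElt_mul_self n)).comp T.quad

theorem act_eq (T : Family F) (n : ℕ) {w : WeilGroup F} (hw : w ∈ T.baseWeil)
    (g : T.dualGroup n) :
    ((T.act n w g : T.dualGroup n) : GL (Fin (T.dim n)) ℂ) = T.twist n w * g * (T.twist n w)⁻¹ := by
  have h1 : T.quad w = 1 → ((T.act n w g : T.dualGroup n) : GL (Fin (T.dim n)) ℂ) =
      T.twist n w * g * (T.twist n w)⁻¹ := by
    intro h
    have e1 : T.act n w = 1 := by rw [act, MonoidHom.comp_apply, h, map_one]
    have e2 : T.twist n w = 1 := by rw [twist, MonoidHom.comp_apply, h, map_one]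
    rw [e1, e2]
    simp
  cases T with
  | oddUnit ε hε => exact h1 hw
  | evenUnit ε hε => exact h1 hw
  | quasiEvenOrth ε hε =>
    rcases Int.units_eq_one_or ((quasiEvenOrth ε hε).quad w) with h | h
    · exact h1 h
    · have e1 : (quasiEvenOrth ε hε).act n w = (quasiEvenOrth ε hε).dualAut n := by
        rw [act, MonoidHom.comp_apply, h]
        exact signHom_neg_one _ _
      have e2 : (quasiEvenOrth ε hε).twist n w = (quasiEvenOrth ε hε).outerElt n := by
        rw [twist, MonoidHom.comp_apply, h]
        exact signHom_neg_one _ _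
      have e3 : ((quasiEvenOrth ε hε).outerElt n)⁻¹ = (quasiEvenOrth ε hε).outerElt n :=
        inv_eq_of_mul_eq_one_left ((quasiEvenOrth ε hε).outerElt_mul_self n)
      rw [e1, e2]
      change MulAut.conj ((quasiEvenOrth ε hε).outerElt n)⁻¹ g.1 = _
      rw [MulAut.conj_apply, inv_inv, e3]
  | _ => exact h1 rfl

/-- The standard representation of the `L`-group, restricted to the elements over `baseWeil`.
For the orthogonal and symplectic families it is the embedding into `GL_N(ℂ)`, for the unitary
ones it is the first component of the embedding into the `L`-group of `Res_{E/F} GL_N`. -/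
def stdHom (T : Family F) (n : ℕ) :
    T.baseWeil.comap (SemidirectProduct.rightHom : T.LGroup n →* WeilGroup F) →*
      GL (Fin (T.dim n)) ℂ where
  toFun x := (x.1.left : GL (Fin (T.dim n)) ℂ) * T.twist n x.1.right
  map_one' := by simp
  map_mul' x y := by
    have := T.act_eq n (w := x.1.right) x.2 y.1.left
    simp [this, mul_assoc]

end Local

end Family

/-! ### Local Langlands parameters -/

section Parameters

variable {F : Type*} [Field F] [ValuativeRel F] [TopologicalSpace F] [IsNonarchimedeanLocalField F]
  [CharZero F]

/-- A homomorphism from `W_F × SL_2(ℂ)` to the `L`-group over `W_F`. -/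
structure LHom (T : Family F) (n : ℕ) where
  /-- The underlying homomorphism. -/
  toHom : WeilGroup F × SL(2, ℂ) →* T.LGroup n
  right_eq : ∀ x, (toHom x).right = x.1

namespace LHom

variable {T : Family F} {n : ℕ}

/-- The component in the dual group, as a matrix. -/
def mat (ψ : LHom T n) (x : WeilGroup F × SL(2, ℂ)) : Matrix (Fin (T.dim n)) (Fin (T.dim n)) ℂ :=
  ((ψ.toHom x).left : GL (Fin (T.dim n)) ℂ).val

/-- The homomorphism to `GL_N(ℂ)` on `W_F × SL_2(ℂ)` (orthogonal and symplectic families),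
respectively on `W_E × SL_2(ℂ)` (unitary families), attached to an `L`-homomorphism. -/
def std (ψ : LHom T n) : T.baseWeil × SL(2, ℂ) →* GL (Fin (T.dim n)) ℂ :=
  (T.stdHom n).comp
    ((ψ.toHom.comp (T.baseWeil.subtype.prodMap (MonoidHom.id SL(2, ℂ)))).codRestrict _ (by
      intro x
      change (ψ.toHom (x.1.1, x.2)).right ∈ T.baseWeil
      rw [ψ.right_eq]
      exact x.1.2))

/-- The representation on `ℂ^N` given by `std`. -/
def rep (ψ : LHom T n) : Representation ℂ (T.baseWeil × SL(2, ℂ)) (Fin (T.dim n) → ℂ) :=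
  ((Matrix.toLinAlgEquiv' :
      Matrix (Fin (T.dim n)) (Fin (T.dim n)) ℂ ≃ₐ[ℂ] _).toAlgHom.toMonoidHom).comp
    ((Units.coeHom _).comp ψ.std)

/-- Admissibility: continuous on `W_F`, algebraic on `SL_2(ℂ)`, and semisimple on the Weil group.
(For the unitary families, an element of the `L`-group over `w ∉ W_E` is semisimple if and only if
its square is.) -/
structure IsAdmissible (ψ : LHom T n) : Prop where
  continuous : Continuous fun w : WeilGroup F => ψ.mat (w, 1)
  algebraic : ∃ P : Fin (T.dim n) → Fin (T.dim n) → MvPolynomial (Fin 2 × Fin 2) ℂ,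
    ∀ (g : SL(2, ℂ)) (i j : Fin (T.dim n)),
      ψ.mat (1, g) i j = MvPolynomial.eval (fun p => g.val p.1 p.2) (P i j)
  semisimple : ∀ w : T.baseWeil, Module.End.IsSemisimple (ψ.rep (w, 1))

/-- The image of `W_F` is bounded. -/
def IsBounded (ψ : LHom T n) : Prop :=
  ∃ C : ℝ, ∀ (w : WeilGroup F) (i j : Fin (T.dim n)), ‖ψ.mat (w, 1) i j‖ ≤ C

end LHom

/-- Admissible homomorphisms from `W_F × SL_2(ℂ)` to the `L`-group. -/
abbrev AdmissibleHom (T : Family F) (n : ℕ) : Type _ := {ψ : LHom T n // ψ.IsAdmissible}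

/-- Conjugacy under the `L`-group. -/
instance conjSetoid (T : Family F) (n : ℕ) : Setoid (AdmissibleHom T n) where
  r ψ ψ' := ∃ g : T.LGroup n, ∀ x, ψ'.1.toHom x = g * ψ.1.toHom x * g⁻¹
  iseqv :=
    { refl := fun ψ => ⟨1, fun x => by simp⟩
      symm := by
        rintro ψ ψ' ⟨g, hg⟩
        exact ⟨g⁻¹, fun x => by rw [hg]; group⟩
      trans := by
        rintro ψ ψ' ψ'' ⟨g, hg⟩ ⟨h, hh⟩
        exact ⟨h * g, fun x => by rw [hh, hg]; group⟩ }

/-- The set `Φ(G_n)` of local Langlands parameters: conjugacy classes of admissible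
homomorphisms. -/
abbrev LParameter (T : Family F) (n : ℕ) : Type _ := Quotient (conjSetoid T n)

/-- The set `Φ^(t)(G_n)` of tempered parameters. -/
def tempered (T : Family F) (n : ℕ) : Set (LParameter T n) :=
  {φ | ∃ ψ : AdmissibleHom T n, Quotient.mk _ ψ = φ ∧ ψ.1.IsBounded}

end Parameters

/-! ### The non-tempered part -/

/-- The substitution `X_i ↦ ∑_j g_{ji} X_j` in polynomials in two variables, which extends the
standard action of `g` on `ℂ²`. -/
def symAct (g : SL(2, ℂ)) : MvPolynomial (Fin 2) ℂ →ₐ[ℂ] MvPolynomial (Fin 2) ℂ :=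
  MvPolynomial.aeval fun i : Fin 2 => ∑ j, MvPolynomial.C (g.val j i) * MvPolynomial.X j

theorem symAct_one : symAct 1 = AlgHom.id ℂ _ := by
  refine MvPolynomial.algHom_ext fun i => ?_
  simp only [symAct, MvPolynomial.aeval_X, AlgHom.id_apply]
  fin_cases i <;> simp [Fin.sum_univ_two]

theorem symAct_mul (g h : SL(2, ℂ)) : symAct (g * h) = (symAct g).comp (symAct h) := by
  refine MvPolynomial.algHom_ext fun i => ?_
  simp only [symAct, MvPolynomial.aeval_X, AlgHom.comp_apply, Fin.sum_univ_two, map_add, map_mul,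
    MvPolynomial.algHom_C, MvPolynomial.algebraMap_eq, Matrix.SpecialLinearGroup.coe_mul,
    Matrix.mul_apply]
  ring

theorem symAct_mem (g : SL(2, ℂ)) (w : ℕ) (p : MvPolynomial (Fin 2) ℂ)
    (hp : p ∈ MvPolynomial.homogeneousSubmodule (Fin 2) ℂ w) :
    (symAct g).toLinearMap p ∈ MvPolynomial.homogeneousSubmodule (Fin 2) ℂ w := by
  have h := MvPolynomial.IsHomogeneous.aeval (n := 1) hp
    (fun i : Fin 2 => ∑ j, MvPolynomial.C (g.val j i) * MvPolynomial.X j)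
    (fun i => MvPolynomial.IsHomogeneous.sum _ _ _ fun j _ => by
      simpa using (MvPolynomial.isHomogeneous_C (Fin 2) (g.val j i)).mul
        (MvPolynomial.isHomogeneous_X ℂ j))
  rw [one_mul] at h
  exact h

/-- The irreducible algebraic representation `S_{w+1} = Sym^w(ℂ²)` of `SL_2(ℂ)` of dimension
`w + 1`, on the homogeneous polynomials of degree `w` in two variables. -/
def symRep (w : ℕ) :
    Representation ℂ SL(2, ℂ) (MvPolynomial.homogeneousSubmodule (Fin 2) ℂ w) where
  toFun g := (symAct g).toLinearMap.restrict (symAct_mem g w)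
  map_one' := by
    ext1 p
    exact Subtype.ext (DFunLike.congr_fun symAct_one p.1)
  map_mul' g h := by
    ext1 p
    exact Subtype.ext (DFunLike.congr_fun (symAct_mul g h) p.1)

section NonTempered

variable {F : Type*} [Field F] [ValuativeRel F] [TopologicalSpace F] [IsNonarchimedeanLocalField F]

/-- The twist `|·|^t ρ` of a representation of a subgroup of `W_F`. -/
def absTwist {H : Subgroup (WeilGroup F)} {V : Type*} [AddCommGroup V] [Module ℂ V] (t : ℝ)
    (ρ : Representation ℂ H V) : Representation ℂ H V where
  toFun w := WeilGroup.absPow t w.1 • ρ w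
  map_one' := by simp
  map_mul' v w := by
    rw [Subgroup.coe_mul, map_mul, map_mul, smul_mul_smul_comm]

/-- The dual of the conjugate `w ↦ ρ(s w s⁻¹)`. -/
def conjDual {H : Subgroup (WeilGroup F)} [H.Normal] {V : Type*} [AddCommGroup V] [Module ℂ V]
    (s : WeilGroup F) (ρ : Representation ℂ H V) : Representation ℂ H (Module.Dual ℂ V) :=
  Representation.dual (ρ.comp (MulAut.conjNormal s : MulAut H).toMonoidHom)

/-- The representation `ρ ⊗ S_{w+1}`. -/
def tensorSym {H : Subgroup (WeilGroup F)} {V : Type*} [AddCommGroup V] [Module ℂ V]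
    (ρ : Representation ℂ H V) (w : ℕ) :
    Representation ℂ (H × SL(2, ℂ)) (V ⊗[ℂ] MvPolynomial.homogeneousSubmodule (Fin 2) ℂ w) :=
  Representation.tprod (ρ.comp (MonoidHom.fst H SL(2, ℂ))) ((symRep w).comp (MonoidHom.snd H SL(2, ℂ)))

/-- An irreducible continuous representation of a subgroup of `W_F` with bounded image. -/
structure IsIrredBounded {H : Subgroup (WeilGroup F)} {d : ℕ}
    (ρ : Representation ℂ H (Fin d → ℂ)) : Prop where
  irreducible : ρ.IsIrreducible
  continuous : Continuous fun w : H => LinearMap.toMatrix' (ρ w)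
  bounded : ∃ C : ℝ, ∀ (w : H) (i j : Fin d), ‖LinearMap.toMatrix' (ρ w) i j‖ ≤ C

variable [CharZero F]

/-- For the unitary families, `s ∈ W_F` maps to the nontrivial element of `Gal(E/F)`; for the
other families, where no conjugation is involved, `s = 1`. -/
def IsGaloisLift (T : Family F) (s : WeilGroup F) : Prop :=
  match T with
  | .oddUnit ε hε => quadChar ε hε s = -1
  | .evenUnit ε hε => quadChar ε hε s = -1
  | _ => s = 1

/-- The direct sum over `i` of
`|·|^(-q_i + w_i/2) φ_i ⊗ S_{w_i+1} ⊕ |·|^(q_i - w_i/2) φ̌_i ⊗ S_{w_i+1}`, where `φ̌_i` is the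
contragredient of `φ_i`, composed with conjugation by `s`. -/
def nonTemperedPart (T : Family F) (s : WeilGroup F) {f : ℕ} (w : Fin f → ℕ) (q : Fin f → ℝ)
    {d : Fin f → ℕ} (ρ : ∀ i, Representation ℂ T.baseWeil (Fin (d i) → ℂ)) :=
  Representation.directSum fun i =>
    (tensorSym (absTwist (-q i + w i / 2) (ρ i)) (w i)).prod
      (tensorSym (absTwist (q i - w i / 2) (conjDual s (ρ i))) (w i))

end NonTempered

end LanglandsParam

end

open LanglandsParam

/-! A parameter amounts to a representation `ρ` of `W_K × SL_2(ℂ)` on `V = ℂ^N` with extra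
structure: a nondegenerate pairing of `ρ` with its conjugate under `s`, of prescribed symmetry, and
for the special orthogonal dual groups a condition on the determinant (`LHom.exists_isPairing`,
`LHom.hasDet_rep`). Here `s` is the identity for the non-unitary families and an element of `W_F`
outside `W_E` for the unitary ones. Conversely, a representation of the right dimension with this
structure comes from an `L`-homomorphism (`exists_lhom_of_pairing`), because nondegenerate complex
forms of the same symmetry are congruent.

Decomposition: `SL_2(ℂ)` acts algebraically, and the highest weight vectors of weight `k` form a
`W_K`-stable multiplicity space for `S_{k+1}` (`exists_tensor_decomposition`). Since matrix groups
have no small subgroups, a subgroup of finite index in inertia acts trivially; as Weil elements act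
semisimply, averaging a projection splits the multiplicity spaces into irreducibles. On an
irreducible, a power of Frobenius is a scalar `c` by Schur's lemma, and dividing by the character
`|·|^t` whose value there has absolute value `|c|` leaves a bounded representation
(`exists_absTwist_bounded`). So `ρ` is a sum of `|·|^(t_i) φ_i ⊗ S_{k_i+1}` with `φ_i` bounded
irreducible (`exists_decomposition`).

Splitting: invariance of the pairing at the powers `h ^ m` of an element of degree `D ≠ 0` bounds a
fixed number by a constant times `q ^ (m D (t_i + t_j))` for every integer `m`. Hence two
constituents are orthogonal unless `t_i + t_j = 0` (`IsPairing.single_eq_zero`). By the sign of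
`t_i` one gets `V = V_0 ⊕ V_+ ⊕ V_-`; the pairing is nondegenerate on `V_0` and identifies `V_-`
with the conjugate dual of `V_+` (`splitMap_bijective`, `IsPairing.splitMap_apply`). The
determinants on `V_+` and its dual cancel, so `V_0` inherits all the structure and is a bounded
parameter of a smaller group of the same family. The rest is the non-tempered part, with `q_i = k_i
/ 2 - t_i`, sorted by decreasing `t_i`.

An arithmetic input is that some element of the Weil group, not merely of the Galois group, moves
the square root of `ε` (`exists_quadChar_eq_neg_one`). It provides `s`, and it keeps `V_0` from
vanishing for the non-split even orthogonal groups. -/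

noncomputable section

namespace LanglandsParam

/-! ### Regular functions on `SL_2(ℂ)` -/

section Laurent

variable {W : Type*} [AddCommGroup W] [Module ℂ W]

/-- The value at `x` of the Laurent polynomial with coefficients `c`. -/
def laurent (x : ℂ) : (ℤ →₀ W) →ₗ[ℂ] W := Finsupp.lsum ℂ fun k => x ^ k • LinearMap.id

theorem laurent_single (x : ℂ) (k : ℤ) (w : W) : laurent x (Finsupp.single k w) = x ^ k • w := by
  simp [laurent]

theorem laurent_apply (x : ℂ) (c : ℤ →₀ W) : laurent x c = c.sum fun k w => x ^ k • w := by
  simp only [laurent, Finsupp.coe_lsum]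
  rfl

theorem map_laurent {W' : Type*} [AddCommGroup W'] [Module ℂ W'] (f : W →ₗ[ℂ] W') (x : ℂ)
    (c : ℤ →₀ W) : f (laurent x c) = laurent x (Finsupp.mapRange.linearMap f c) := by
  induction c using Finsupp.induction_linear with
  | zero => simp
  | add c d hc hd => simp only [map_add, hc, hd]
  | single k w => simp [laurent_single]

/-- The maps `x ↦ x ^ k` are distinct characters of `ℂˣ`, already separated by `x = 2`, so
Dedekind's independence of characters applies. -/
theorem laurent_eq_zero_complex {c : ℤ →₀ ℂ} (h : ∀ x : ℂ, x ≠ 0 → laurent x c = 0) : c = 0 := by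
  have hli := linearIndependent_monoidHom ℂˣ ℂ
  have hinj : Function.Injective fun k : ℤ => ((Units.coeHom ℂ).comp (zpowGroupHom k)) := by
    intro k l hkl
    have h2 := DFunLike.congr_fun hkl (Units.mk0 (2 : ℂ) two_ne_zero)
    simp only [MonoidHom.comp_apply, zpowGroupHom_apply, Units.coeHom_apply, Units.val_zpow_eq_zpow_val,
      Units.val_mk0] at h2
    have h3 : ((2 : ℝ) ^ k) = 2 ^ l := Complex.ofReal_injective (by push_cast; exact h2)
    exact zpow_right_injective₀ (by norm_num) (by norm_num) h3
  have hli' := hli.comp _ hinj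
  rw [linearIndependent_iff] at hli'
  apply hli'
  funext a
  have h1 := h a a.ne_zero
  rw [laurent_apply] at h1
  rw [Finsupp.linearCombination_apply, Finsupp.sum, Finset.sum_apply]
  rw [Finsupp.sum] at h1
  simpa [mul_comm] using h1

theorem laurent_eq_zero {c : ℤ →₀ W} (h : ∀ x : ℂ, x ≠ 0 → laurent x c = 0) : c = 0 := by
  ext k
  refine (Module.forall_dual_apply_eq_zero_iff ℂ _).1 fun f => ?_
  have h1 : Finsupp.mapRange.linearMap f c = 0 :=
    laurent_eq_zero_complex fun x hx => by rw [← map_laurent, h x hx, map_zero]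
  simpa using DFunLike.congr_fun h1 k

theorem laurent_injective {c d : ℤ →₀ W} (h : ∀ x : ℂ, x ≠ 0 → laurent x c = laurent x d) :
    c = d :=
  sub_eq_zero.1 (laurent_eq_zero fun x hx => by rw [map_sub, h x hx, sub_self])

theorem laurent_mul_pow (x : ℂ) (hx : x ≠ 0) (k : ℤ) (c : ℤ →₀ W) :
    x ^ k • laurent x c = laurent x (Finsupp.domLCongr (R := ℂ) (Equiv.addRight k) c) := by
  induction c using Finsupp.induction_linear with
  | zero => simp
  | add c d hc hd => simp only [map_add, smul_add, hc, hd]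
  | single l w => simp [laurent_single, smul_smul, zpow_add₀ hx, mul_comm]

theorem laurent_inv (x : ℂ) (c : ℤ →₀ W) :
    laurent x⁻¹ c = laurent x (Finsupp.domLCongr (R := ℂ) (Equiv.neg ℤ) c) := by
  induction c using Finsupp.induction_linear with
  | zero => simp
  | add c d hc hd => simp only [map_add, smul_add, hc, hd]
  | single l w => simp [laurent_single]

end Laurent

namespace SLTwo

/-- The upper triangular unipotent matrices. -/
def upper (x : ℂ) : SL(2, ℂ) := ⟨!![1, x; 0, 1], by simp⟩

/-- The lower triangular unipotent matrices. -/
def lower (y : ℂ) : SL(2, ℂ) := ⟨!![1, 0; y, 1], by simp⟩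

/-- The diagonal matrices. -/
def torus (a : ℂˣ) : SL(2, ℂ) := ⟨!![(a : ℂ), 0; 0, (a : ℂ)⁻¹], by simp⟩

/-- The matrices `(x, -1; 1, 0)`. -/
def weyl (x : ℂ) : SL(2, ℂ) := ⟨!![x, -1; 1, 0], by simp⟩

theorem coe_upper (x : ℂ) : (upper x : Matrix (Fin 2) (Fin 2) ℂ) = !![1, x; 0, 1] := rfl

theorem coe_lower (y : ℂ) : (lower y : Matrix (Fin 2) (Fin 2) ℂ) = !![1, 0; y, 1] := rfl

theorem coe_torus (a : ℂˣ) : (torus a : Matrix (Fin 2) (Fin 2) ℂ) = !![(a : ℂ), 0; 0, (a : ℂ)⁻¹] :=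
  rfl

theorem coe_weyl (x : ℂ) : (weyl x : Matrix (Fin 2) (Fin 2) ℂ) = !![x, -1; 1, 0] := rfl

theorem upper_zero : upper 0 = 1 := by
  apply Matrix.SpecialLinearGroup.ext; intro i j; fin_cases i <;> fin_cases j <;>
    simp [Matrix.SpecialLinearGroup.coe_mul, coe_upper]

theorem upper_add (x y : ℂ) : upper (x + y) = upper x * upper y := by
  apply Matrix.SpecialLinearGroup.ext; intro i j; fin_cases i <;> fin_cases j <;>
    simp [Matrix.SpecialLinearGroup.coe_mul, coe_upper, Matrix.mul_apply, Fin.sum_univ_two, add_comm]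

theorem torus_one : torus 1 = 1 := by
  apply Matrix.SpecialLinearGroup.ext; intro i j; fin_cases i <;> fin_cases j <;>
    simp [Matrix.SpecialLinearGroup.coe_mul, coe_torus]

theorem torus_mul (a b : ℂˣ) : torus (a * b) = torus a * torus b := by
  apply Matrix.SpecialLinearGroup.ext; intro i j; fin_cases i <;> fin_cases j <;>
    simp [Matrix.SpecialLinearGroup.coe_mul, coe_torus, Matrix.mul_apply, Fin.sum_univ_two, mul_comm]

theorem torus_mul_upper (a : ℂˣ) (x : ℂ) : torus a * upper x = upper (a ^ 2 * x) * torus a := by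
  apply Matrix.SpecialLinearGroup.ext; intro i j; fin_cases i <;> fin_cases j <;>
    simp [Matrix.SpecialLinearGroup.coe_mul, coe_torus, coe_upper, Matrix.mul_apply, Fin.sum_univ_two]
  field_simp

theorem weyl_eq (a : ℂˣ) : weyl a = lower (a : ℂ)⁻¹ * torus a * upper (-(a : ℂ)⁻¹) := by
  apply Matrix.SpecialLinearGroup.ext; intro i j; fin_cases i <;> fin_cases j <;>
    simp [Matrix.SpecialLinearGroup.coe_mul, coe_torus, coe_upper, coe_lower, coe_weyl, Matrix.mul_apply, Fin.sum_univ_two]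

theorem eq_lower_mul (g : SL(2, ℂ)) (a : ℂˣ) (ha : g.val 0 0 = a) :
    g = lower (g.val 1 0 * (a : ℂ)⁻¹) * torus a * upper (g.val 0 1 * (a : ℂ)⁻¹) := by
  have hd := g.2
  rw [Matrix.det_fin_two, ha] at hd
  have h0 := a.ne_zero
  apply Matrix.SpecialLinearGroup.ext; intro i j; fin_cases i <;> fin_cases j <;>
    simp [Matrix.SpecialLinearGroup.coe_mul, coe_torus, coe_upper, coe_lower, Matrix.mul_apply, Fin.sum_univ_two, ha]
  · field_simp
  · field_simp
    linear_combination hd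

theorem eq_weyl_mul (g : SL(2, ℂ)) (c : ℂˣ) (h : g.val 0 0 = 0) (hc : g.val 1 0 = c) :
    g = weyl 0 * torus c * upper (g.val 1 1 * (c : ℂ)⁻¹) := by
  have hd := g.2
  rw [Matrix.det_fin_two, h, hc] at hd
  have h0 := c.ne_zero
  apply Matrix.SpecialLinearGroup.ext; intro i j; fin_cases i <;> fin_cases j <;>
    simp [Matrix.SpecialLinearGroup.coe_mul, coe_torus, coe_upper, coe_weyl, Matrix.mul_apply, Fin.sum_univ_two, h, hc]
  · field_simp
    linear_combination -hd
  · field_simp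

section Regular

variable {W : Type*} [AddCommGroup W] [Module ℂ W]

/-- A vector-valued function on `SL_2(ℂ)` that is polynomial in the matrix entries. -/
def IsPolyFun (φ : SL(2, ℂ) → W) : Prop :=
  ∀ f : Module.Dual ℂ W, ∃ P : MvPolynomial (Fin 2 × Fin 2) ℂ,
    ∀ g, f (φ g) = MvPolynomial.eval (fun p => g.val p.1 p.2) P

theorem IsPolyFun.map {W' : Type*} [AddCommGroup W'] [Module ℂ W'] {φ : SL(2, ℂ) → W}
    (hφ : IsPolyFun φ) (L : W →ₗ[ℂ] W') : IsPolyFun fun g => L (φ g) :=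
  fun f => hφ (f ∘ₗ L)

theorem IsPolyFun.inv {φ : SL(2, ℂ) → W} (hφ : IsPolyFun φ) : IsPolyFun fun g => φ g⁻¹ := by
  intro f
  obtain ⟨P, hP⟩ := hφ f
  refine ⟨MvPolynomial.bind₁ (fun p => (!![MvPolynomial.X (1, 1), -MvPolynomial.X (0, 1);
    -MvPolynomial.X (1, 0), MvPolynomial.X (0, 0)] : Matrix (Fin 2) (Fin 2)
      (MvPolynomial (Fin 2 × Fin 2) ℂ)) p.1 p.2) P, fun g => ?_⟩
  rw [hP, ← MvPolynomial.coe_aeval_eq_eval, ← MvPolynomial.coe_aeval_eq_eval]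
  change _ = MvPolynomial.aeval _ (MvPolynomial.bind₁ _ P)
  rw [MvPolynomial.aeval_bind₁]
  change _ = MvPolynomial.eval _ P
  refine congrArg (fun v => MvPolynomial.eval v P) (funext fun p => ?_)
  obtain ⟨i, j⟩ := p
  rw [Matrix.SpecialLinearGroup.SL2_inv_expl]
  fin_cases i <;> fin_cases j <;> simp

variable [FiniteDimensional ℂ W]

/-- Polynomials along a curve are recorded as Laurent polynomials without negative exponents, so
that unipotent curves and the torus can be compared in one formalism. -/
theorem IsPolyFun.exists_curve {φ : SL(2, ℂ) → W} (hφ : IsPolyFun φ) (γ : ℂ → SL(2, ℂ))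
    (m : Fin 2 × Fin 2 → Polynomial ℂ)
    (hγ : ∀ x p, (γ x).val p.1 p.2 = (m p).eval x) :
    ∃ c : ℤ →₀ W, (∀ j < 0, c j = 0) ∧ ∀ x, φ (γ x) = laurent x c := by
  let b := Module.finBasis ℂ W
  choose P hP using fun i => hφ (b.coord i)
  let Q : Fin (Module.finrank ℂ W) → Polynomial ℂ := fun i => MvPolynomial.aeval m (P i)
  have hQ : ∀ i x, b.coord i (φ (γ x)) = (Q i).eval x := by
    intro i x
    rw [hP]
    change _ = Polynomial.eval₂RingHom (RingHom.id ℂ) x (MvPolynomial.aeval m (P i))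
    rw [MvPolynomial.aeval_def, ← MvPolynomial.coe_eval₂Hom, ← RingHom.comp_apply,
      MvPolynomial.comp_eval₂Hom]
    simp only [MvPolynomial.coe_eval₂Hom, MvPolynomial.eval_eq', MvPolynomial.eval₂_eq', hγ]
    simp [Polynomial.eval₂_eq_eval_map]
  refine ⟨∑ i, ∑ n ∈ (Q i).support, Finsupp.single (n : ℤ) ((Q i).coeff n • b i), ?_, ?_⟩
  · intro j hj
    simp only [Finsupp.finsetSum_apply]
    refine Finset.sum_eq_zero fun i _ => Finset.sum_eq_zero fun n _ => ?_
    rw [Finsupp.single_apply, if_neg (by omega)]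
  · intro x
    rw [← b.sum_repr (φ (γ x))]
    simp only [map_sum, laurent_single]
    refine Finset.sum_congr rfl fun i _ => ?_
    rw [← Module.Basis.coord_apply, hQ, Polynomial.eval_eq_sum, Polynomial.sum, Finset.sum_smul]
    refine Finset.sum_congr rfl fun n _ => ?_
    rw [smul_smul, mul_comm, zpow_natCast]

theorem exists_torus_eval (P : MvPolynomial (Fin 2 × Fin 2) ℂ) :
    ∃ c : ℤ →₀ ℂ, ∀ a : ℂˣ,
      MvPolynomial.eval (fun p => (torus a).val p.1 p.2) P = laurent (a : ℂ) c := by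
  induction P using MvPolynomial.induction_on with
  | C r => exact ⟨Finsupp.single 0 r, fun a => by simp [laurent_single]⟩
  | add P Q hP hQ =>
    obtain ⟨c, hc⟩ := hP
    obtain ⟨d, hd⟩ := hQ
    exact ⟨c + d, fun a => by rw [map_add, map_add, hc, hd]⟩
  | mul_X P p hP =>
    obtain ⟨c, hc⟩ := hP
    obtain ⟨i, j⟩ := p
    fin_cases i <;> fin_cases j
    · refine ⟨Finsupp.domLCongr (R := ℂ) (Equiv.addRight 1) c, fun a => ?_⟩
      rw [← laurent_mul_pow _ a.ne_zero, map_mul, hc]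
      simp [torus, mul_comm]
    · exact ⟨0, fun a => by simp [torus]⟩
    · exact ⟨0, fun a => by simp [torus]⟩
    · refine ⟨Finsupp.domLCongr (R := ℂ) (Equiv.addRight (-1)) c, fun a => ?_⟩
      rw [← laurent_mul_pow _ a.ne_zero, map_mul, hc]
      simp [torus, mul_comm]

theorem IsPolyFun.exists_torus {φ : SL(2, ℂ) → W} (hφ : IsPolyFun φ) :
    ∃ c : ℤ →₀ W, ∀ a : ℂˣ, φ (torus a) = laurent (a : ℂ) c := by
  let b := Module.finBasis ℂ W
  choose P hP using fun i => hφ (b.coord i)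
  choose c hc using fun i => exists_torus_eval (P i)
  refine ⟨∑ i, Finsupp.mapRange.linearMap (LinearMap.toSpanSingleton ℂ W (b i)) (c i), fun a => ?_⟩
  rw [← b.sum_repr (φ (torus a)), map_sum]
  refine Finset.sum_congr rfl fun i _ => ?_
  rw [← map_laurent, ← hc, ← hP]
  rfl

theorem IsPolyFun.exists_upper {φ : SL(2, ℂ) → W} (hφ : IsPolyFun φ) :
    ∃ c : ℤ →₀ W, (∀ j < 0, c j = 0) ∧ ∀ x, φ (upper x) = laurent x c :=
  hφ.exists_curve upper
    (fun p => (!![1, Polynomial.X; 0, 1] : Matrix (Fin 2) (Fin 2) (Polynomial ℂ)) p.1 p.2)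
    (by rintro x ⟨i, j⟩; fin_cases i <;> fin_cases j <;> simp [upper])

/-- A regular function that is invariant under the upper unipotent matrices and of weight `k`
under the torus is a homogeneous polynomial of degree `k` in the first column. -/
theorem IsPolyFun.exists_homogeneous {φ : SL(2, ℂ) → W} (hφ : IsPolyFun φ) {k : ℤ}
    (hu : ∀ g x, φ (g * upper x) = φ g) (ht : ∀ g a, φ (g * torus a) = (a : ℂ) ^ k • φ g) :
    ∃ c : ℤ →₀ W, (∀ j, j < 0 ∨ k < j → c j = 0) ∧
      ∀ g : SL(2, ℂ), φ g = c.sum fun j w => (g.val 0 0 ^ (k - j) * g.val 1 0 ^ j) • w := by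
  obtain ⟨c, hc0, hc⟩ := hφ.exists_curve lower
    (fun p => (!![1, 0; Polynomial.X, 1] : Matrix (Fin 2) (Fin 2) (Polynomial ℂ)) p.1 p.2)
    (by rintro x ⟨i, j⟩; fin_cases i <;> fin_cases j <;> simp [lower])
  obtain ⟨d, hd0, hd⟩ := hφ.exists_curve weyl
    (fun p => (!![Polynomial.X, -1; 1, 0] : Matrix (Fin 2) (Fin 2) (Polynomial ℂ)) p.1 p.2)
    (by rintro x ⟨i, j⟩; fin_cases i <;> fin_cases j <;> simp [weyl])
  -- By `weyl_eq` and the two invariances, `φ (weyl x) = x ^ k • φ (lower x⁻¹)` for nonzero `x`.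
  -- Both `c` and `d` have no negative exponents, and this relation confines `c` to `0 ≤ j ≤ k`.
  have hcd : d = Finsupp.domLCongr (R := ℂ) (Equiv.addRight k)
      (Finsupp.domLCongr (R := ℂ) (Equiv.neg ℤ) c) := by
    refine laurent_injective fun x hx => ?_
    rw [← hd, ← laurent_mul_pow _ hx, ← laurent_inv, ← hc]
    have := weyl_eq (Units.mk0 x hx)
    rw [Units.val_mk0] at this
    rw [this, hu, ht, Units.val_mk0]
  have hcd' : ∀ j, d (k - j) = c j := by
    intro j
    rw [hcd]
    simp [Finsupp.domLCongr_apply, Finsupp.equivMapDomain_apply]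
  have hz : ∀ j, j < 0 ∨ k < j → c j = 0 := by
    rintro j (hj | hj)
    · exact hc0 j hj
    · rw [← hcd', hd0 _ (by omega)]
  refine ⟨c, hz, fun g => ?_⟩
  -- Where the upper left entry is nonzero (the big cell), `φ` is read off from `lower`; on the
  -- complement `weyl 0` takes over and only the coefficient `c k` survives.
  by_cases ha : g.val 0 0 = 0
  · have hcne : g.val 1 0 ≠ 0 := by
      intro h
      have := g.2
      rw [Matrix.det_fin_two, ha, h] at this
      simp at this
    have h1 : φ g = (g.val 1 0) ^ k • c k := by
      conv_lhs => rw [eq_weyl_mul g (Units.mk0 _ hcne) ha rfl]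
      rw [hu, ht, hd, Units.val_mk0, ← hcd' k, sub_self, laurent_apply]
      congr 1
      rw [Finsupp.sum, Finset.sum_eq_single 0]
      · simp
      · intro b _ hb
        rw [zero_zpow _ hb, zero_smul]
      · intro h
        simpa using h
    rw [h1, Finsupp.sum, Finset.sum_eq_single k]
    · simp
    · intro b _ hb
      rw [ha, zero_zpow _ (by omega), zero_mul, zero_smul]
    · intro h
      simp [Finsupp.notMem_support_iff.1 h]
  · conv_lhs => rw [eq_lower_mul g (Units.mk0 _ ha) rfl]
    rw [hu, ht, hc, laurent_apply, Units.val_mk0, Finsupp.sum, Finsupp.sum, Finset.smul_sum]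
    refine Finset.sum_congr rfl fun j _ => ?_
    rw [smul_smul]
    congr 1
    rw [mul_zpow, zpow_sub₀ ha, inv_zpow]
    field_simp

/-- No exponent satisfies `0 ≤ j ≤ k`. Geometrically, a line bundle of negative degree on the
projective line has no sections. -/
theorem IsPolyFun.eq_zero_of_neg {φ : SL(2, ℂ) → W} (hφ : IsPolyFun φ) {k : ℤ} (hk : k < 0)
    (hu : ∀ g x, φ (g * upper x) = φ g) (ht : ∀ g a, φ (g * torus a) = (a : ℂ) ^ k • φ g)
    (g : SL(2, ℂ)) : φ g = 0 := by
  obtain ⟨c, hc, h⟩ := hφ.exists_homogeneous hu ht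
  have : c = 0 := by
    ext j
    exact hc j (by omega)
  rw [h, this, Finsupp.sum_zero_index]

end Regular

end SLTwo

/-! ### Scaling, evaluation and differentiation of Laurent polynomials. -/

section Laurent

variable {W : Type*} [AddCommGroup W] [Module ℂ W]

/-- The coefficients of `x ↦ p(b x)`. -/
def laurentScale (b : ℂ) (c : ℤ →₀ W) : ℤ →₀ W :=
  Finsupp.onFinset c.support (fun k => b ^ k • c k) fun k h => by
    rw [Finsupp.mem_support_iff]
    rintro h0
    exact h (by rw [h0, smul_zero])

theorem laurentScale_apply (b : ℂ) (c : ℤ →₀ W) (k : ℤ) : laurentScale b c k = b ^ k • c k := rfl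

theorem laurent_laurentScale (b x : ℂ) (c : ℤ →₀ W) :
    laurent x (laurentScale b c) = laurent (b * x) c := by
  rw [laurent_apply, laurent_apply, laurentScale, Finsupp.onFinset_sum _ (fun a => smul_zero _)]
  refine Finset.sum_congr rfl fun k _ => ?_
  change x ^ k • b ^ k • c k = (b * x) ^ k • c k
  rw [smul_smul, mul_zpow, mul_comm]

theorem laurent_zero {c : ℤ →₀ W} : laurent 0 c = c 0 := by
  rw [laurent_apply, Finsupp.sum, Finset.sum_eq_single 0]
  · simp
  · intro b _ hb
    rw [zero_zpow _ hb, zero_smul]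
  · intro h
    simpa using h

theorem laurent_mem {p : Submodule ℂ W} {c : ℤ →₀ W} (h : ∀ k, c k ∈ p) (x : ℂ) :
    laurent x c ∈ p := by
  rw [laurent_apply]
  exact Submodule.sum_mem _ fun k _ => p.smul_mem _ (h k)

theorem hasDerivAt_laurent {d : ℤ →₀ ℂ} (hd : ∀ j < 0, d j = 0) :
    HasDerivAt (fun y => laurent y d) (d 1) 0 := by
  have h1 : (fun y => laurent y d) = fun y => ∑ k ∈ d.support, y ^ k * d k := by
    funext y
    rw [laurent_apply]
    rfl
  have h2 : ∀ k ∈ d.support,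
      HasDerivAt (fun y : ℂ => y ^ k * d k) ((k : ℂ) * 0 ^ (k - 1) * d k) 0 := by
    intro k hk
    refine HasDerivAt.mul_const (hasDerivAt_zpow k 0 (Or.inr ?_)) _
    by_contra h
    exact (Finsupp.mem_support_iff.1 hk) (hd k (by omega))
  rw [h1]
  refine (HasDerivAt.fun_sum h2).congr_deriv ?_
  rw [Finset.sum_eq_single 1]
  · simp
  · intro b _ hb
    rw [zero_zpow _ (by omega)]
    simp
  · intro h
    simpa using h

/-- The first coefficient of the translate at `x` is the derivative of `q` at `x`, and a function on
`ℂ` with zero derivative is constant. -/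
theorem eq_of_laurent_translate {q : ℂ → ℂ}
    (h : ∀ x, ∃ d : ℤ →₀ ℂ, (∀ j < 0, d j = 0) ∧ d 1 = 0 ∧ ∀ y, q (x + y) = laurent y d)
    (x : ℂ) : q x = q 0 := by
  have hder : ∀ x, HasDerivAt q 0 x := by
    intro x
    obtain ⟨d, hd, hd1, hq⟩ := h x
    have h1 := hasDerivAt_laurent hd
    rw [hd1] at h1
    have h2 : HasDerivAt (fun y => q (x + y)) 0 0 := by
      rwa [show (fun y => q (x + y)) = fun y => laurent y d from funext hq]
    have h3 := HasDerivAt.comp_sub_const x x (f := fun y => q (x + y)) (by rwa [sub_self])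
    simpa using h3
  exact is_const_of_deriv_eq_zero (fun x => (hder x).differentiableAt) (fun x => (hder x).deriv) _ _

end Laurent

/-! ### Weights and highest weight vectors of regular representations of `SL_2(ℂ)`. -/

namespace SLTwo

variable {V : Type*} [AddCommGroup V] [Module ℂ V] (τ : Representation ℂ SL(2, ℂ) V)

/-- The weight spaces of the torus. -/
def weightSpace (k : ℤ) : Submodule ℂ V where
  carrier := {v | ∀ a : ℂˣ, τ (torus a) v = (a : ℂ) ^ k • v}
  add_mem' hv hw a := by rw [map_add, hv, hw, smul_add]
  zero_mem' a := by simp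
  smul_mem' r v hv a := by rw [map_smul, hv, smul_comm]

/-- The vectors of weight `k` that are invariant under the upper unipotent matrices. -/
def highest (k : ℤ) : Submodule ℂ V where
  carrier := {v | (∀ x, τ (upper x) v = v) ∧ ∀ a : ℂˣ, τ (torus a) v = (a : ℂ) ^ k • v}
  add_mem' hv hw := ⟨fun x => by rw [map_add, hv.1, hw.1],
    fun a => by rw [map_add, hv.2, hw.2, smul_add]⟩
  zero_mem' := ⟨fun x => map_zero _, fun a => by simp⟩
  smul_mem' r v hv := ⟨fun x => by rw [map_smul, hv.1],
    fun a => by rw [map_smul, hv.2, smul_comm]⟩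

variable {τ}

section Weights

variable {π E : ℤ →₀ (V →ₗ[ℂ] V)} (hπ : ∀ a : ℂˣ, τ (torus a) = laurent (a : ℂ) π)
  (hE : ∀ x, τ (upper x) = laurent x E) (hE0 : ∀ j < 0, E j = 0)

include hπ in
-- Compare coefficients of `x` in `τ (torus b) * τ (torus x) = τ (torus (b * x))`. With `sum_proj`
-- and `proj_of_mem` this identifies the coefficients `π k` as the projections onto the weight
-- spaces.
theorem torus_comp_proj (b : ℂˣ) (k : ℤ) : τ (torus b) ∘ₗ π k = (b : ℂ) ^ k • π k := by
  have h : Finsupp.mapRange.linearMap (LinearMap.llcomp ℂ V V V (τ (torus b))) π =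
      laurentScale (b : ℂ) π := by
    refine laurent_injective fun x hx => ?_
    rw [laurent_laurentScale, ← map_laurent]
    have h1 := hπ (Units.mk0 x hx)
    have h2 := hπ (b * Units.mk0 x hx)
    rw [Units.val_mk0] at h1
    rw [Units.val_mul, Units.val_mk0, torus_mul, map_mul] at h2
    rw [← h1, ← h2]
    rfl
  ext v
  simpa [laurentScale_apply] using LinearMap.congr_fun (DFunLike.congr_fun h k) v

include hπ in
theorem proj_comp_torus (b : ℂˣ) (k : ℤ) : π k ∘ₗ τ (torus b) = (b : ℂ) ^ k • π k := by
  have h : Finsupp.mapRange.linearMap ((LinearMap.llcomp ℂ V V V).flip (τ (torus b))) π =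
      laurentScale (b : ℂ) π := by
    refine laurent_injective fun x hx => ?_
    rw [laurent_laurentScale, ← map_laurent]
    have h1 := hπ (Units.mk0 x hx)
    have h2 := hπ (Units.mk0 x hx * b)
    rw [Units.val_mk0] at h1
    rw [Units.val_mul, Units.val_mk0, torus_mul, map_mul, mul_comm x] at h2
    rw [← h1, ← h2]
    rfl
  ext v
  simpa [laurentScale_apply] using LinearMap.congr_fun (DFunLike.congr_fun h k) v

include hπ in
theorem proj_mem_weightSpace (k : ℤ) (v : V) : π k v ∈ weightSpace τ k := fun a => by
  simpa using LinearMap.congr_fun (torus_comp_proj hπ a k) v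

include hπ in
theorem sum_proj (v : V) : ∑ k ∈ π.support, π k v = v := by
  have h := hπ 1
  rw [torus_one, map_one, Units.val_one, laurent_apply] at h
  have h2 := LinearMap.congr_fun h v
  rw [Finsupp.sum, LinearMap.sum_apply] at h2
  simpa using h2.symm

include hπ in
theorem proj_of_mem {k : ℤ} {v : V} (hv : v ∈ weightSpace τ k) : π k v = v := by
  have h : Finsupp.mapRange.linearMap (LinearMap.applyₗ v) π = Finsupp.single k v := by
    refine laurent_injective fun x hx => ?_
    rw [laurent_single, ← map_laurent]
    have h1 := hπ (Units.mk0 x hx)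
    rw [Units.val_mk0] at h1
    rw [← h1]
    exact hv (Units.mk0 x hx)
  simpa using DFunLike.congr_fun h k

include hE in
-- Coefficientwise form of `torus_mul_upper`; it shows that `E j` raises weights by `2 * j`.
theorem torus_comp_raise (a : ℂˣ) (j : ℤ) :
    τ (torus a) ∘ₗ E j = (a : ℂ) ^ (2 * j) • (E j ∘ₗ τ (torus a)) := by
  have h : Finsupp.mapRange.linearMap (LinearMap.llcomp ℂ V V V (τ (torus a))) E =
      laurentScale ((a : ℂ) ^ 2)
        (Finsupp.mapRange.linearMap ((LinearMap.llcomp ℂ V V V).flip (τ (torus a))) E) := by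
    refine laurent_injective fun x hx => ?_
    rw [laurent_laurentScale, ← map_laurent, ← map_laurent, ← hE, ← hE]
    change τ (torus a) * τ (upper x) = τ (upper _) * τ (torus a)
    rw [← map_mul, ← map_mul, torus_mul_upper]
  have h2 := DFunLike.congr_fun h j
  rw [laurentScale_apply, ← zpow_natCast, ← zpow_mul] at h2
  ext v
  simpa using LinearMap.congr_fun h2 v

include hE in
theorem raise_mem_weightSpace {k j : ℤ} {v : V} (hv : v ∈ weightSpace τ k) :
    E j v ∈ weightSpace τ (k + 2 * j) := by
  intro a
  have h := LinearMap.congr_fun (torus_comp_raise hE a j) v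
  simp only [LinearMap.comp_apply, LinearMap.smul_apply] at h
  rw [h, hv a, map_smul, smul_smul, ← zpow_add₀ a.ne_zero, add_comm]

include hπ hE in
theorem proj_comp_raise (k : ℤ) : π (k + 2) ∘ₗ E 1 = E 1 ∘ₗ π k := by
  have h : Finsupp.mapRange.linearMap ((LinearMap.llcomp ℂ V V V).flip (E 1)) π =
      Finsupp.domLCongr (R := ℂ) (Equiv.addRight 2)
        (Finsupp.mapRange.linearMap (LinearMap.llcomp ℂ V V V (E 1)) π) := by
    refine laurent_injective fun x hx => ?_
    rw [← laurent_mul_pow _ hx, ← map_laurent, ← map_laurent]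
    have h1 := hπ (Units.mk0 x hx)
    rw [Units.val_mk0] at h1
    rw [← h1]
    ext v
    simpa using LinearMap.congr_fun (torus_comp_raise hE (Units.mk0 x hx) 1) v
  have h2 := DFunLike.congr_fun h (k + 2)
  ext v
  simpa [Finsupp.domLCongr_apply, Finsupp.equivMapDomain_apply] using LinearMap.congr_fun h2 v

include hE hE0 in
-- The linear coefficient in `y` of `τ (upper (x + y)) v` is `τ (upper x) (E 1 v)`, so the single
-- condition on `E 1` already makes the orbit map constant.
theorem upper_fixed {v : V} (hv : E 1 v = 0) (x : ℂ) : τ (upper x) v = v := by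
  rw [← sub_eq_zero]
  refine (Module.forall_dual_apply_eq_zero_iff ℂ _).1 fun f => ?_
  rw [map_sub, sub_eq_zero]
  have := eq_of_laurent_translate (q := fun x => f (τ (upper x) v)) (fun x =>
    ⟨Finsupp.mapRange.linearMap (f ∘ₗ τ (upper x) ∘ₗ LinearMap.applyₗ v) E, fun j hj => by
      simp [hE0 j hj], by simp [hv], fun y => by
      rw [← map_laurent, ← hE, upper_add, map_mul]
      rfl⟩) x
  simpa [upper_zero] using this

include hE hE0 in
theorem upper_invariant {f : Module.Dual ℂ V} (hf : f ∘ₗ E 1 = 0) (x : ℂ) (v : V) :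
    f (τ (upper x) v) = f v := by
  have := eq_of_laurent_translate (q := fun x => f (τ (upper x) v)) (fun x =>
    ⟨Finsupp.mapRange.linearMap (f ∘ₗ LinearMap.applyₗ (τ (upper x) v)) E, fun j hj => by
      simp [hE0 j hj], by simpa using LinearMap.congr_fun hf _, fun y => by
      rw [← map_laurent, ← hE, add_comm, upper_add, map_mul]
      rfl⟩) x
  simpa [upper_zero] using this

include hπ hE hE0 in
-- If `y` were not in the image of `E 1`, a functional `f` of weight `m` killing that image with `f
-- y ≠ 0` would be invariant under the upper unipotents. Then `g ↦ f (τ g⁻¹ y)` would be a regular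
-- function of negative weight `-m`, hence zero, although its value at the identity is `f y`.
theorem exists_raise_eq [FiniteDimensional ℂ V] (hτ : IsPolyFun fun g => τ g) {m : ℤ} (hm : 0 < m)
    {y : V} (hy : y ∈ weightSpace τ m) : ∃ v ∈ weightSpace τ (m - 2), E 1 v = y := by
  by_cases hr : y ∈ LinearMap.range (E 1)
  · obtain ⟨w, rfl⟩ := hr
    refine ⟨π (m - 2) w, proj_mem_weightSpace hπ _ _, ?_⟩
    have h := LinearMap.congr_fun (proj_comp_raise hπ hE (m - 2)) w
    rw [sub_add_cancel] at h
    exact h.symm.trans (proj_of_mem hπ hy)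
  · exfalso
    obtain ⟨f₀, hf₀, hker⟩ := Submodule.exists_le_ker_of_notMem hr
    -- Composing with the weight projection makes `f` homogeneous of weight `m`; it still kills the
    -- image of `E 1` because `E 1` shifts the projections by two.
    let f : Module.Dual ℂ V := f₀ ∘ₗ π m
    have hf : f ∘ₗ E 1 = 0 := by
      have h := proj_comp_raise hπ hE (m - 2)
      rw [sub_add_cancel] at h
      rw [LinearMap.comp_assoc, h]
      ext w
      exact hker ⟨_, rfl⟩
    have hu : ∀ x v, f (τ (upper x) v) = f v := upper_invariant hE hE0 hf
    have ht : ∀ (a : ℂˣ) v, f (τ (torus a) v) = (a : ℂ) ^ m • f v := by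
      intro a v
      have h := LinearMap.congr_fun (proj_comp_torus hπ a m) v
      simp only [LinearMap.comp_apply, LinearMap.smul_apply] at h
      rw [LinearMap.comp_apply, h, map_smul]
      rfl
    have hreg : IsPolyFun fun g => f (τ g⁻¹ y) :=
      (IsPolyFun.inv hτ).map (f ∘ₗ LinearMap.applyₗ y)
    have h0 := hreg.eq_zero_of_neg (k := -m) (by omega)
      (fun g x => by
        have hi : (upper x)⁻¹ = upper (-x) := inv_eq_of_mul_eq_one_left (by
          rw [← upper_add, neg_add_cancel, upper_zero])
        rw [mul_inv_rev, map_mul, hi]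
        exact hu _ _)
      (fun g a => by
        have hi : (torus a)⁻¹ = torus a⁻¹ := inv_eq_of_mul_eq_one_left (by
          rw [← torus_mul, inv_mul_cancel, torus_one])
        rw [mul_inv_rev, map_mul, hi]
        have h := ht a⁻¹ (τ g⁻¹ y)
        rw [Units.val_inv_eq_inv_val, inv_zpow, ← zpow_neg] at h
        exact h) 1
    rw [inv_one, map_one] at h0
    exact hf₀ (by simpa [f, proj_of_mem hπ hy] using h0)

end Weights

/-- A regular representation of `SL_2(ℂ)` is generated by its highest weight vectors. -/
theorem eq_top_of_highest_le [FiniteDimensional ℂ V] (hτ : IsPolyFun fun g => τ g)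
    {V' : Submodule ℂ V} (hst : ∀ g, ∀ v ∈ V', τ g v ∈ V')
    (hV' : ∀ k : ℕ, highest τ k ≤ V') : V' = ⊤ := by
  by_contra htop
  obtain ⟨π, hπ⟩ := hτ.exists_torus
  obtain ⟨E, hE0, hE⟩ := hτ.exists_upper
  classical
  -- These are the weights at which some weight vector escapes `V'`; the argument contradicts the
  -- largest one.
  let S := π.support.filter fun k => ∃ v, π k v ∉ V'
  have hS : S.Nonempty := by
    by_contra h
    rw [Finset.not_nonempty_iff_eq_empty] at h
    refine htop (eq_top_iff.2 fun v _ => ?_)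
    rw [← sum_proj hπ v]
    refine Submodule.sum_mem _ fun k hk => ?_
    by_contra hc
    have : k ∈ S := Finset.mem_filter.2 ⟨hk, v, hc⟩
    rw [h] at this
    simp at this
  obtain ⟨k, hkS, hmax⟩ := S.exists_max_image id hS
  obtain ⟨-, v, hv⟩ := Finset.mem_filter.1 hkS
  have hhigh : ∀ j, k < j → weightSpace τ j ≤ V' := by
    intro j hj w hw
    by_contra hc
    have hmem : j ∈ S := by
      refine Finset.mem_filter.2 ⟨?_, w, by rwa [proj_of_mem hπ hw]⟩
      rw [Finsupp.mem_support_iff]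
      rintro h0
      rw [← proj_of_mem hπ hw, h0] at hc
      exact hc (by simp)
    have := hmax j hmem
    simp only [id] at this
    omega
  have hv0 := proj_mem_weightSpace hπ k v
  set v₀ := π k v
  have hE00 : E 0 = LinearMap.id := by
    have := hE 0
    rw [upper_zero, map_one, laurent_zero] at this
    exact this.symm
  -- For `j > 0` the vector `E j v₀` has weight above `k`, hence lies in `V'`, so `v₀` is invariant
  -- under the upper unipotents modulo `V'`.
  have hup : ∀ x, τ (upper x) v₀ - v₀ ∈ V' := by
    intro x
    have h1 : τ (upper x) v₀ - v₀ =
        laurent x (Finsupp.mapRange.linearMap (LinearMap.applyₗ v₀) E - Finsupp.single 0 v₀) := by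
      rw [map_sub, ← map_laurent, ← hE, laurent_single]
      simp
    rw [h1]
    refine laurent_mem (fun j => ?_) x
    rcases lt_trichotomy j 0 with hj | rfl | hj
    · simp [hE0 j hj, hj.ne']
    · simp [hE00]
    · simpa [Finsupp.single_apply, hj.ne] using
        hhigh (k + 2 * j) (by omega) (raise_mem_weightSpace hE hv0)
  -- If `k < 0`, the orbit map of `v₀` into the quotient by `V'` would be a regular function of
  -- negative weight, hence zero, although `v₀` is not in `V'`.
  have hk : 0 ≤ k := by
    by_contra hneg
    have hst' : ∀ g (w w' : V), w - w' ∈ V' → V'.mkQ (τ g w) = V'.mkQ (τ g w') := by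
      intro g w w' h
      rw [← sub_eq_zero, ← map_sub, ← map_sub]
      exact (Submodule.Quotient.mk_eq_zero _).2 (hst g _ h)
    have h0 := (IsPolyFun.map hτ (V'.mkQ ∘ₗ LinearMap.applyₗ v₀)).eq_zero_of_neg (k := k) (by omega)
      (fun g x => by
        rw [map_mul]
        exact hst' g _ _ (hup x))
      (fun g a => by
        rw [map_mul]
        change V'.mkQ (τ g (τ (torus a) v₀)) = _
        rw [hv0 a, map_smul, map_smul]
        rfl) 1
    rw [map_one] at h0
    exact hv (by simpa using h0)
  let τ' : Representation ℂ SL(2, ℂ) V' :=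
    Subrepresentation.toRepresentation ⟨V', fun g v hv => hst g v hv⟩
  have hτ'c : ∀ g (v : V'), (τ' g v : V) = τ g v := fun g v => rfl
  have hτ' : IsPolyFun fun g => τ' g := by
    intro f
    obtain ⟨L, hL⟩ := V'.exists_isCompl
    let R : (V →ₗ[ℂ] V) →ₗ[ℂ] (V' →ₗ[ℂ] V') :=
      (LinearMap.llcomp ℂ V' V V' (V'.projectionOnto L hL)) ∘ₗ
        ((LinearMap.llcomp ℂ V' V V).flip V'.subtype)
    have hR : ∀ g, R (τ g) = τ' g := by
      intro g
      ext v
      change ((V'.projectionOnto L hL (τ g v) : V') : V) = τ g v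
      exact congrArg Subtype.val (Submodule.projectionOnto_apply_left hL (τ' g v))
    obtain ⟨P, hP⟩ := hτ (f ∘ₗ R)
    exact ⟨P, fun g => by rw [← hP, LinearMap.comp_apply, hR]⟩
  obtain ⟨π', hπ'⟩ := hτ'.exists_torus
  obtain ⟨E', hE0', hE'⟩ := hτ'.exists_upper
  have hEE : ∀ w : V', ((E' 1 w : V') : V) = E 1 w := by
    intro w
    have h : Finsupp.mapRange.linearMap (V'.subtype ∘ₗ LinearMap.applyₗ w) E' =
        Finsupp.mapRange.linearMap (LinearMap.applyₗ (w : V)) E := by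
      refine laurent_injective fun x _ => ?_
      rw [← map_laurent, ← map_laurent, ← hE, ← hE']
      rfl
    simpa using DFunLike.congr_fun h 1
  have hEv : E 1 v₀ ∈ weightSpace τ (k + 2) := by
    simpa using raise_mem_weightSpace hE (j := 1) hv0
  -- `E 1 v₀` lies in `V'` and has positive weight `k + 2`, so raising inside `V'` reaches it from
  -- some `w` of weight `k`. Then `E 1` kills `v₀ - w`, which is thus a highest weight vector and
  -- lies in `V'` by hypothesis.
  obtain ⟨w, hw, hwE⟩ := exists_raise_eq hπ' hE' hE0' hτ' (m := k + 2) (by omega)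
    (y := ⟨E 1 v₀, hhigh _ (by omega) hEv⟩) (fun a => Subtype.ext (hEv a))
  rw [add_sub_cancel_right] at hw
  have hwE2 : E 1 (w : V) = E 1 v₀ := by rw [← hEE, hwE]
  have hmem : v₀ - (w : V) ∈ highest τ (k.toNat : ℤ) := by
    refine ⟨upper_fixed hE hE0 (by rw [map_sub, hwE2, sub_self]), fun a => ?_⟩
    rw [Int.toNat_of_nonneg hk, map_sub, hv0 a, smul_sub]
    congr 1
    exact congrArg Subtype.val (hw a)
  have := V'.add_mem (hV' _ hmem) w.2
  rw [sub_add_cancel] at this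
  exact hv this

end SLTwo

/-! ### Equivariant maps tested on highest weight vectors. -/

namespace SLTwo

section General

variable {V : Type*} [AddCommGroup V] [Module ℂ V]

theorem IsPolyFun.add {φ φ' : SL(2, ℂ) → V} (h : IsPolyFun φ) (h' : IsPolyFun φ') :
    IsPolyFun fun g => φ g + φ' g := fun f => by
  obtain ⟨P, hP⟩ := h f
  obtain ⟨Q, hQ⟩ := h' f
  exact ⟨P + Q, fun g => by rw [map_add, map_add, hP, hQ]⟩

theorem IsPolyFun.sum {ι : Type*} (s : Finset ι) {φ : ι → SL(2, ℂ) → V}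
    (h : ∀ i ∈ s, IsPolyFun (φ i)) : IsPolyFun fun g => ∑ i ∈ s, φ i g := by
  classical
  induction s using Finset.induction_on with
  | empty => exact fun f => ⟨0, fun g => by simp⟩
  | insert a s ha ih =>
    simp_rw [Finset.sum_insert ha]
    exact (h a (Finset.mem_insert_self a s)).add (ih fun i hi => h i (Finset.mem_insert_of_mem hi))

variable [FiniteDimensional ℂ V] {τ : Representation ℂ SL(2, ℂ) V}

theorem isPolyFun_of_apply (h : ∀ v, IsPolyFun fun g => τ g v) : IsPolyFun fun g => τ g := by
  let b := Module.finBasis ℂ V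
  have e : (fun g => τ g) = fun g => ∑ i, LinearMap.smulRightₗ (b.coord i) (τ g (b i)) := by
    funext g
    refine b.ext fun j => ?_
    rw [LinearMap.sum_apply, Finset.sum_eq_single j]
    · simp
    · intro i _ hi
      simp [Finsupp.single_apply, hi.symm]
    · simp
  rw [e]
  exact IsPolyFun.sum _ fun i _ => (h (b i)).map _

theorem IsPolyFun.apply (hτ : IsPolyFun fun g => τ g) (v : V) : IsPolyFun fun g => τ g v :=
  hτ.map (LinearMap.applyₗ v)

/-- The restriction of a representation of `SL_2(ℂ)` to a stable subspace. -/
abbrev subRep (τ : Representation ℂ SL(2, ℂ) V) (V' : Submodule ℂ V)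
    (hst : ∀ g, ∀ v ∈ V', τ g v ∈ V') : Representation ℂ SL(2, ℂ) V' :=
  Subrepresentation.toRepresentation ⟨V', fun g v hv => hst g v hv⟩

theorem IsPolyFun.subRep (hτ : IsPolyFun fun g => τ g) {V' : Submodule ℂ V}
    (hst : ∀ g, ∀ v ∈ V', τ g v ∈ V') : IsPolyFun fun g => subRep τ V' hst g := by
  refine isPolyFun_of_apply fun v f => ?_
  obtain ⟨F, hF⟩ := LinearMap.exists_extend f
  obtain ⟨P, hP⟩ := hτ.apply (v : V) F
  exact ⟨P, fun g => by rw [← hP, ← hF]; rfl⟩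

variable {V₂ : Type*} [AddCommGroup V₂] [Module ℂ V₂] {τ₂ : Representation ℂ SL(2, ℂ) V₂}

/-- The kernel is a regular representation whose only highest weight vector is zero, so
`eq_top_of_highest_le` for its zero subspace makes it trivial. -/
theorem injective_of_highest (hτ : IsPolyFun fun g => τ g) {L : V →ₗ[ℂ] V₂}
    (hL : ∀ g v, L (τ g v) = τ₂ g (L v)) (h : ∀ k : ℕ, ∀ v ∈ highest τ k, L v = 0 → v = 0) :
    Function.Injective L := by
  rw [← LinearMap.ker_eq_bot]
  have hst : ∀ g, ∀ v ∈ LinearMap.ker L, τ g v ∈ LinearMap.ker L := by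
    intro g v hv
    rw [LinearMap.mem_ker] at hv ⊢
    rw [hL, hv, map_zero]
  have h1 := eq_top_of_highest_le (IsPolyFun.subRep hτ hst) (V' := ⊥)
    (fun g v hv => by rw [(Submodule.mem_bot _).1 hv, map_zero]; exact Submodule.zero_mem _)
    (fun k v hv => (Submodule.mem_bot _).2 (Subtype.ext (h k v
      ⟨fun x => congrArg Subtype.val (hv.1 x), fun a => congrArg Subtype.val (hv.2 a)⟩ v.2)))
  rw [eq_bot_iff]
  intro v hv
  have h2 : (⟨v, hv⟩ : LinearMap.ker L) ∈ (⊥ : Submodule ℂ (LinearMap.ker L)) := by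
    rw [h1]; trivial
  exact congrArg Subtype.val ((Submodule.mem_bot _).1 h2)

theorem surjective_of_highest (hτ : IsPolyFun fun g => τ g) {L : V₂ →ₗ[ℂ] V}
    (hL : ∀ g v, L (τ₂ g v) = τ g (L v)) (h : ∀ k : ℕ, ∀ v ∈ highest τ k, ∃ w, L w = v) :
    Function.Surjective L := by
  rw [← LinearMap.range_eq_top]
  refine eq_top_of_highest_le hτ ?_ fun k v hv => h k v hv
  rintro g _ ⟨w, rfl⟩
  exact ⟨τ₂ g w, hL g w⟩

/-- Only finitely many weights occur, namely those in the support of `π`. -/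
theorem exists_highest_bound (hτ : IsPolyFun fun g => τ g) :
    ∃ K : ℕ, ∀ k : ℕ, K ≤ k → highest τ k = ⊥ := by
  obtain ⟨π, hπ⟩ := hτ.exists_torus
  obtain ⟨M, hM⟩ := π.support.bddAbove
  refine ⟨(M + 1).toNat, fun k hk => eq_bot_iff.2 fun v hv => ?_⟩
  rw [Submodule.mem_bot, ← proj_of_mem hπ (k := k) (v := v) hv.2]
  by_contra hne
  have : (k : ℤ) ∈ π.support := by
    rw [Finsupp.mem_support_iff]
    rintro h0
    exact hne (by rw [h0]; rfl)
  have := hM this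
  omega

end General

/-! ### The symmetric powers -/

/-- The space of `Sym^k`. -/
abbrev SymSpace (k : ℕ) : Type := MvPolynomial.homogeneousSubmodule (Fin 2) ℂ k

instance (k : ℕ) : FiniteDimensional ℂ (SymSpace k) :=
  Module.Finite.iff_fg.2 (MvPolynomial.homogeneousSubmodule_fg (Fin 2) ℂ k)

/-- The highest weight vector of `Sym^k`. -/
def topVec (k : ℕ) : SymSpace k := ⟨MvPolynomial.X 0 ^ k, by
  simpa using (MvPolynomial.isHomogeneous_X ℂ (0 : Fin 2)).pow k⟩

theorem coe_symRep {k : ℕ} (g : SL(2, ℂ)) (p : SymSpace k) :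
    (symRep k g p : MvPolynomial (Fin 2) ℂ) = symAct g p := rfl

theorem eval_symAct (g : SL(2, ℂ)) (v : Fin 2 → ℂ) (p : MvPolynomial (Fin 2) ℂ) :
    MvPolynomial.eval v (symAct g p) = MvPolynomial.eval (fun i => ∑ j, g.val j i * v j) p := by
  rw [← MvPolynomial.coe_aeval_eq_eval, ← MvPolynomial.coe_aeval_eq_eval]
  change MvPolynomial.aeval _ (MvPolynomial.bind₁ _ p) = _
  rw [MvPolynomial.aeval_bind₁]
  simp

theorem eval_smul_symSpace {k : ℕ} (p : SymSpace k) (a : ℂ) (v : Fin 2 → ℂ) :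
    MvPolynomial.eval (fun i => a * v i) (p : MvPolynomial (Fin 2) ℂ) =
      a ^ k * MvPolynomial.eval v (p : MvPolynomial (Fin 2) ℂ) := by
  have hp : (p : MvPolynomial (Fin 2) ℂ).IsHomogeneous k := p.2
  rw [MvPolynomial.eval_eq', MvPolynomial.eval_eq', Finset.mul_sum]
  refine Finset.sum_congr rfl fun d hd => ?_
  have hdeg : d 0 + d 1 = k := by
    have := hp (MvPolynomial.mem_support_iff.1 hd)
    rw [← this, Finsupp.weight_apply, Finsupp.sum_fintype _ _ (by simp)]
    simp [Fin.sum_univ_two]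
  have ha : a ^ k = a ^ d 0 * a ^ d 1 := by rw [← pow_add, hdeg]
  rw [Fin.prod_univ_two, Fin.prod_univ_two, ha]
  ring

/-- Substitute first with indeterminate matrix entries; this gives a polynomial `P` over the ring of
matrix coordinates that specialises to `symAct g p` at each `g`. -/
theorem isPolyFun_symRep_apply {k : ℕ} (p : SymSpace k) : IsPolyFun fun g => symRep k g p := by
  intro f
  obtain ⟨F, hF⟩ := LinearMap.exists_extend f
  let P : MvPolynomial (Fin 2) (MvPolynomial (Fin 2 × Fin 2) ℂ) :=
    MvPolynomial.aeval (fun i : Fin 2 => ∑ j, MvPolynomial.C (MvPolynomial.X (j, i)) *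
      MvPolynomial.X j) (p : MvPolynomial (Fin 2) ℂ)
  have hP : ∀ g : SL(2, ℂ), symAct g p =
      MvPolynomial.map (MvPolynomial.eval (fun q : Fin 2 × Fin 2 => g.val q.1 q.2)) P := by
    intro g
    change _ = ((MvPolynomial.map _).comp (MvPolynomial.aeval _).toRingHom) _
    change ((symAct g : MvPolynomial (Fin 2) ℂ →ₐ[ℂ] _).toRingHom) _ = _
    refine RingHom.congr_fun (MvPolynomial.ringHom_ext (fun r => ?_) fun i => ?_) _
    · simp [symAct, MvPolynomial.algebraMap_eq]
    · simp [symAct]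
  refine ⟨∑ m ∈ P.support, MvPolynomial.C (F (MvPolynomial.monomial m 1)) * P.coeff m, fun g => ?_⟩
  have h1 : f (symRep k g p) = F (symAct g p) := by rw [← hF]; rfl
  rw [h1, hP]
  conv_lhs => rw [P.as_sum]
  rw [map_sum, map_sum, map_sum]
  refine Finset.sum_congr rfl fun m _ => ?_
  rw [MvPolynomial.map_monomial, map_mul, MvPolynomial.eval_C, mul_comm, ← smul_eq_mul,
    ← map_smul, MvPolynomial.smul_monomial, smul_eq_mul, mul_one]

theorem isPolyFun_symRep (k : ℕ) : IsPolyFun fun g => symRep k g :=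
  isPolyFun_of_apply isPolyFun_symRep_apply

theorem topVec_mem (k : ℕ) : topVec k ∈ highest (symRep k) k := by
  refine ⟨fun x => Subtype.ext ?_, fun a => Subtype.ext ?_⟩
  · rw [coe_symRep]
    simp [topVec, symAct, coe_upper, Fin.sum_univ_two]
  · rw [coe_symRep]
    simp [topVec, symAct, coe_torus, Fin.sum_univ_two, mul_pow, MvPolynomial.smul_eq_C_mul]

/-- Invariance says `p (s, t + x * s) = p (s, t)`; choosing `x = -t / s` gives `p (s, t) = p (s, 0)
= r * s ^ k` for nonzero `s`. -/
theorem eq_smul_topVec {k : ℕ} {p : SymSpace k} (hp : ∀ x, symRep k (upper x) p = p) :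
    p = MvPolynomial.eval ![1, 0] (p : MvPolynomial (Fin 2) ℂ) • topVec k := by
  set r := MvPolynomial.eval ![1, 0] (p : MvPolynomial (Fin 2) ℂ) with hr
  have h1 : ∀ s t x : ℂ, MvPolynomial.eval ![s, t + x * s] (p : MvPolynomial (Fin 2) ℂ) =
      MvPolynomial.eval ![s, t] (p : MvPolynomial (Fin 2) ℂ) := by
    intro s t x
    have h := congrArg (fun q : SymSpace k => MvPolynomial.eval ![s, t] (q : MvPolynomial _ ℂ))
      (hp x)
    simp only [coe_symRep, eval_symAct] at h
    rw [← h]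
    refine congrArg (fun v => MvPolynomial.eval v (p : MvPolynomial (Fin 2) ℂ)) ?_
    ext i
    fin_cases i <;> simp [coe_upper, Fin.sum_univ_two, add_comm]
  have h2 : ∀ s t : ℂ, s ≠ 0 → MvPolynomial.eval ![s, t] (p : MvPolynomial (Fin 2) ℂ) =
      r * s ^ k := by
    intro s t hs
    rw [← h1 s t (-t / s), div_mul_cancel₀ _ hs, add_neg_cancel, hr, mul_comm,
      ← eval_smul_symSpace]
    refine congrArg (fun v => MvPolynomial.eval v (p : MvPolynomial (Fin 2) ℂ)) ?_
    ext i
    fin_cases i <;> simp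
  -- The factor `X 0` turns the identity away from `s = 0` into one at every point, hence into an
  -- identity of polynomials.
  have h3 : MvPolynomial.X 0 * ((p : MvPolynomial (Fin 2) ℂ) -
      MvPolynomial.C r * MvPolynomial.X 0 ^ k) = 0 := by
    refine MvPolynomial.funext fun v => ?_
    by_cases hv : v 0 = 0
    · simp [hv]
    · have h := h2 (v 0) (v 1) hv
      have e : ![v 0, v 1] = v := by ext i; fin_cases i <;> rfl
      rw [e] at h
      simp [h]
  rcases mul_eq_zero.1 h3 with h | h
  · exact absurd h (MvPolynomial.X_ne_zero 0)
  · refine Subtype.ext ?_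
    rw [sub_eq_zero.1 h, MvPolynomial.C_mul']
    rfl

theorem span_topVec (k : ℕ) : Submodule.span ℂ (Set.range fun g => symRep k g (topVec k)) = ⊤ := by
  have htop : topVec k ∈ Submodule.span ℂ (Set.range fun g => symRep k g (topVec k)) :=
    Submodule.subset_span ⟨1, by simp⟩
  refine eq_top_of_highest_le (isPolyFun_symRep k) (fun g v hv => ?_) (fun m v hv => ?_)
  · induction hv using Submodule.span_induction with
    | mem v hv =>
      obtain ⟨h, rfl⟩ := hv
      exact Submodule.subset_span ⟨g * h, by simp⟩
    | zero => simp
    | add v w _ _ h1 h2 => rw [map_add]; exact Submodule.add_mem _ h1 h2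
    | smul r v _ h => rw [map_smul]; exact Submodule.smul_mem _ _ h
  · rw [eq_smul_topVec hv.1]
    exact Submodule.smul_mem _ _ htop

theorem symRep_topVec {k : ℕ} (g : SL(2, ℂ)) :
    (symRep k g (topVec k) : MvPolynomial (Fin 2) ℂ) = ∑ j ∈ Finset.range (k + 1),
      MvPolynomial.monomial (Finsupp.single 0 (k - j) + Finsupp.single 1 j)
        (g.val 0 0 ^ (k - j) * g.val 1 0 ^ j * (k.choose j : ℂ)) := by
  rw [coe_symRep, topVec, map_pow]
  simp only [symAct, MvPolynomial.aeval_X, Fin.sum_univ_two]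
  rw [add_comm, add_pow]
  refine Finset.sum_congr rfl fun j _ => ?_
  rw [mul_pow, mul_pow, ← MvPolynomial.C_pow, ← MvPolynomial.C_pow, ← mul_one
    (g.val 0 0 ^ (k - j) * g.val 1 0 ^ j * (k.choose j : ℂ)), ← MvPolynomial.C_mul_monomial,
    MvPolynomial.monomial_add_single, ← MvPolynomial.X_pow_eq_monomial, map_mul, map_mul,
    map_natCast]
  ring

variable {V : Type*} [AddCommGroup V] [Module ℂ V] [FiniteDimensional ℂ V]
  {τ : Representation ℂ SL(2, ℂ) V}

/-- The orbit map of `v` is homogeneous of degree `k` in the first column of `g`, and the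
coefficients of `symRep k g (topVec k)` are the corresponding monomials times binomial coefficients.
Dividing by these expresses the orbit map linearly through the orbit of `topVec k`. -/
theorem exists_lift (hτ : IsPolyFun fun g => τ g) {k : ℕ} {v : V} (hv : v ∈ highest τ k) :
    ∃ L : SymSpace k →ₗ[ℂ] V, ∀ g, L (symRep k g (topVec k)) = τ g v := by
  obtain ⟨c, hc, hφ⟩ := (hτ.apply v).exists_homogeneous (k := k)
    (fun g x => by rw [map_mul]; exact congrArg _ (hv.1 x))
    (fun g a => by rw [map_mul, Module.End.mul_apply, hv.2 a, map_smul])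
  refine ⟨∑ j ∈ Finset.range (k + 1), (k.choose j : ℂ)⁻¹ • LinearMap.smulRight
    (MvPolynomial.lcoeff ℂ (Finsupp.single 0 (k - j) + Finsupp.single 1 j) ∘ₗ
      Submodule.subtype _) (c j), fun g => ?_⟩
  rw [hφ, LinearMap.sum_apply]
  have hsub : c.support ⊆ (Finset.range (k + 1)).map Nat.castEmbedding := by
    intro j hj
    have h1 : ¬ (j < 0 ∨ (k : ℤ) < j) := fun h => Finsupp.mem_support_iff.1 hj (hc j h)
    rw [Finset.mem_map]
    exact ⟨j.toNat, Finset.mem_range.2 (by omega), by simp; omega⟩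
  rw [Finsupp.sum_of_support_subset _ hsub _ (by simp), Finset.sum_map]
  refine Finset.sum_congr rfl fun j hj => ?_
  have hjk : j ≤ k := by simpa [Nat.lt_succ_iff] using hj
  rw [LinearMap.smul_apply, LinearMap.smulRight_apply, smul_smul, LinearMap.comp_apply,
    Submodule.subtype_apply, symRep_topVec, map_sum, Finset.sum_eq_single j]
  · congr 1
    have hch : (k.choose j : ℂ) ≠ 0 := by exact_mod_cast (Nat.choose_pos hjk).ne'
    simp only [MvPolynomial.lcoeff_apply, MvPolynomial.coeff_monomial, if_pos]
    rw [Nat.castEmbedding_apply, ← Nat.cast_sub hjk, zpow_natCast, zpow_natCast]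
    field_simp
  · intro i _ hij
    simp only [MvPolynomial.lcoeff_apply, MvPolynomial.coeff_monomial]
    rw [if_neg]
    intro h
    have := DFunLike.congr_fun h 1
    simp at this
    exact hij this
  · intro h
    exact absurd hj h

theorem lift_unique {k : ℕ} {W : Type*} [AddCommGroup W] [Module ℂ W] {L L' : SymSpace k →ₗ[ℂ] W}
    (h : ∀ g, L (symRep k g (topVec k)) = L' (symRep k g (topVec k))) : L = L' :=
  LinearMap.ext_on_range (span_topVec k) h

/-- The equivariant map from `Sym^k` that sends the highest weight vector to `v`, as a linear
function of `v`. -/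
theorem exists_liftMap (hτ : IsPolyFun fun g => τ g) (k : ℕ) :
    ∃ L : highest τ k →ₗ[ℂ] SymSpace k →ₗ[ℂ] V,
      (∀ v, L v (topVec k) = v) ∧ (∀ v g p, L v (symRep k g p) = τ g (L v p)) ∧
      ∀ T : V →ₗ[ℂ] V, (∀ g, T ∘ₗ τ g = τ g ∘ₗ T) → ∀ (v v' : highest τ k), T v = v' →
        T ∘ₗ L v = L v' := by
  choose L hL using fun v : highest τ k => exists_lift hτ v.2
  refine ⟨{ toFun := L, map_add' := ?_, map_smul' := ?_ }, ?_, ?_, ?_⟩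
  · intro v w
    exact lift_unique fun g => by simp [hL]
  · intro r v
    exact lift_unique fun g => by simp [hL]
  · intro v
    simpa using hL v 1
  · intro v g p
    have : L v ∘ₗ symRep k g = τ g ∘ₗ L v := lift_unique fun h => by
      rw [LinearMap.comp_apply, LinearMap.comp_apply, hL, ← Module.End.mul_apply, ← map_mul, hL,
        map_mul, Module.End.mul_apply]
    exact LinearMap.congr_fun this p
  · intro T hT v v' hv
    refine lift_unique fun g => ?_
    change T (L v _) = L v' _
    rw [hL, hL, ← hv]
    exact LinearMap.congr_fun (hT g) v

/-- The symmetric powers are self-dual. -/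
theorem exists_symDual (k : ℕ) : ∃ e : SymSpace k ≃ₗ[ℂ] Module.Dual ℂ (SymSpace k),
    ∀ g p, e (symRep k g p) = (symRep k).dual g (e p) := by
  -- Evaluation at `(0, 1)`, that is, the coefficient of `X 1 ^ k`, is a highest weight vector of
  -- the dual.
  let δ : Module.Dual ℂ (SymSpace k) :=
    (MvPolynomial.aeval ![(0 : ℂ), 1]).toLinearMap ∘ₗ Submodule.subtype _
  have hδa : ∀ p, δ p = MvPolynomial.eval ![0, 1] (p : MvPolynomial (Fin 2) ℂ) := by
    intro p
    rw [← MvPolynomial.coe_aeval_eq_eval]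
    rfl
  have hreg : IsPolyFun fun g => (symRep k).dual g := by
    refine isPolyFun_of_apply fun f => ?_
    exact (IsPolyFun.inv (isPolyFun_symRep k)).map (LinearMap.llcomp ℂ (SymSpace k) (SymSpace k) ℂ f)
  have hδ : δ ∈ highest (symRep k).dual k := by
    refine ⟨fun x => LinearMap.ext fun p => ?_, fun a => LinearMap.ext fun p => ?_⟩
    · change δ (symRep k (upper x)⁻¹ p) = δ p
      have hi : (upper x)⁻¹ = upper (-x) := inv_eq_of_mul_eq_one_left (by
          rw [← upper_add, neg_add_cancel, upper_zero])
      rw [hδa, hδa, hi, coe_symRep, eval_symAct]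
      refine congrArg (fun v => MvPolynomial.eval v (p : MvPolynomial (Fin 2) ℂ)) ?_
      ext i
      fin_cases i <;> simp [coe_upper, Fin.sum_univ_two]
    · change δ (symRep k (torus a)⁻¹ p) = (a : ℂ) ^ (k : ℤ) * δ p
      have hi : (torus a)⁻¹ = torus a⁻¹ := inv_eq_of_mul_eq_one_left (by
          rw [← torus_mul, inv_mul_cancel, torus_one])
      rw [hδa, hδa, hi, coe_symRep, eval_symAct, zpow_natCast, ← eval_smul_symSpace]
      refine congrArg (fun v => MvPolynomial.eval v (p : MvPolynomial (Fin 2) ℂ)) ?_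
      ext i
      fin_cases i <;> simp [coe_torus, Fin.sum_univ_two]
  obtain ⟨L, hL1, hL2, -⟩ := exists_liftMap hreg k
  -- A highest weight vector is a multiple of `topVec k`, which maps to `δ`, and `δ` takes the value
  -- one at `X 1 ^ k`.
  have hinj : Function.Injective (L ⟨δ, hδ⟩) := by
    refine injective_of_highest (isPolyFun_symRep k) (hL2 _) fun m v hv h0 => ?_
    rw [eq_smul_topVec hv.1] at h0 ⊢
    rw [map_smul, hL1, smul_eq_zero] at h0
    rcases h0 with h0 | h0
    · rw [h0, zero_smul]
    · exfalso
      have h1 : δ ⟨MvPolynomial.X 1 ^ k, by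
        simpa using (MvPolynomial.isHomogeneous_X ℂ (1 : Fin 2)).pow k⟩ = 0 := by
        change (⟨δ, hδ⟩ : highest (symRep k).dual k).1 _ = 0
        rw [h0]; rfl
      rw [hδa] at h1
      simp at h1
  exact ⟨LinearEquiv.ofInjectiveOfFinrankEq _ hinj (Subspace.dual_finrank_eq).symm,
    fun g p => hL2 _ g p⟩

end SLTwo

/-! ### Equivalences and products of representations. -/

section Reps

variable {G : Type*} [Group G]

theorem nonempty_equiv_of_bijective {V W : Type*} [AddCommGroup V] [Module ℂ V] [AddCommGroup W]
    [Module ℂ W] {ρ : Representation ℂ G V} {σ : Representation ℂ G W} (L : V →ₗ[ℂ] W)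
    (h : ∀ g v, L (ρ g v) = σ g (L v)) (hL : Function.Bijective L) : Nonempty (ρ.Equiv σ) :=
  ⟨Representation.Equiv.mk (LinearEquiv.ofBijective L hL) fun g => LinearMap.ext fun v => h g v⟩

theorem nonempty_equiv_of_linearEquiv {V W : Type*} [AddCommGroup V] [Module ℂ V] [AddCommGroup W]
    [Module ℂ W] {ρ : Representation ℂ G V} {σ : Representation ℂ G W} (L : V ≃ₗ[ℂ] W)
    (h : ∀ g v, L (ρ g v) = σ g (L v)) : Nonempty (ρ.Equiv σ) :=
  ⟨Representation.Equiv.mk L fun g => LinearMap.ext fun v => h g v⟩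

theorem equiv_apply_rep {V W : Type*} [AddCommGroup V] [Module ℂ V] [AddCommGroup W]
    [Module ℂ W] {ρ : Representation ℂ G V} {σ : Representation ℂ G W} (e : ρ.Equiv σ) (g : G)
    (v : V) : e.toLinearEquiv (ρ g v) = σ g (e.toLinearEquiv v) :=
  LinearMap.congr_fun (e.isIntertwining' g) v

/-- The product of a family of representations. -/
def piRep {ι : Type*} {V : ι → Type*} [∀ i, AddCommGroup (V i)] [∀ i, Module ℂ (V i)]
    (ρ : ∀ i, Representation ℂ G (V i)) : Representation ℂ G (∀ i, V i) where
  toFun g := LinearMap.pi fun i => ρ i g ∘ₗ LinearMap.proj i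
  map_one' := by ext1 x; funext i; simp
  map_mul' g h := by ext1 x; funext i; simp

theorem piRep_apply {ι : Type*} {V : ι → Type*} [∀ i, AddCommGroup (V i)] [∀ i, Module ℂ (V i)]
    (ρ : ∀ i, Representation ℂ G (V i)) (g : G) (x : ∀ i, V i) (i : ι) :
    piRep ρ g x i = ρ i g (x i) := rfl

end Reps

/-! ### Decomposition of representations of `H × SL_2(ℂ)` into tensor products. -/

section Tensor

open SLTwo

variable {S : Type*} [AddCommGroup S] [Module ℂ S] [FiniteDimensional ℂ S] {k : ℕ}

/-- In coordinates on `S` every component is a unipotent-invariant vector of `Sym^k`, hence a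
multiple of `topVec k`. -/
theorem exists_tmul_topVec {y : S ⊗[ℂ] SymSpace k}
    (hy : ∀ x, TensorProduct.map LinearMap.id (symRep k (upper x)) y = y) :
    ∃ s : S, y = s ⊗ₜ topVec k := by
  let b := Module.finBasis ℂ S
  let C : ∀ i, S ⊗[ℂ] SymSpace k →ₗ[ℂ] SymSpace k := fun i =>
    (TensorProduct.lid ℂ _).toLinearMap ∘ₗ TensorProduct.map (b.coord i) LinearMap.id
  have hC : ∀ y : S ⊗[ℂ] SymSpace k, y = ∑ i, b i ⊗ₜ[ℂ] C i y := by
    intro y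
    induction y using TensorProduct.induction_on with
    | zero => simp
    | add y z hy hz =>
      conv_lhs => rw [hy, hz]
      rw [← Finset.sum_add_distrib]
      exact Finset.sum_congr rfl fun i _ => by rw [map_add, TensorProduct.tmul_add]
    | tmul s p =>
      conv_lhs => rw [← b.sum_repr s]
      rw [TensorProduct.sum_tmul]
      exact Finset.sum_congr rfl fun i _ => by simp [C, TensorProduct.smul_tmul]
  have hCe : ∀ i (A : SymSpace k →ₗ[ℂ] SymSpace k) (y : S ⊗[ℂ] SymSpace k),
      C i (TensorProduct.map LinearMap.id A y) = A (C i y) := by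
    intro i A y
    induction y using TensorProduct.induction_on with
    | zero => simp
    | add y z hy hz => simp only [map_add, hy, hz]
    | tmul s p => simp [C]
  have hCi : ∀ i, ∃ r : ℂ, C i y = r • topVec k := fun i =>
    ⟨_, eq_smul_topVec fun x => by rw [← hCe, hy]⟩
  choose r hr using hCi
  refine ⟨∑ i, r i • b i, ?_⟩
  conv_lhs => rw [hC y]
  rw [TensorProduct.sum_tmul]
  exact Finset.sum_congr rfl fun i _ => by rw [hr, TensorProduct.tmul_smul, TensorProduct.smul_tmul']

end Tensor

section Decomposition

open SLTwo

variable {F : Type*} [Field F] [ValuativeRel F] [TopologicalSpace F] [IsNonarchimedeanLocalField F]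
  {H : Subgroup (WeilGroup F)}

theorem tensorSym_tmul {S : Type*} [AddCommGroup S] [Module ℂ S] (σ : Representation ℂ H S) (k : ℕ)
    (x : H × SL(2, ℂ)) (s : S) (p : SymSpace k) :
    tensorSym σ k x (s ⊗ₜ p) = σ x.1 s ⊗ₜ symRep k x.2 p := rfl

theorem isPolyFun_tensorSym {S : Type*} [AddCommGroup S] [Module ℂ S] (σ : Representation ℂ H S)
    (k : ℕ) (y : S ⊗[ℂ] SymSpace k) : IsPolyFun fun g => tensorSym σ k (1, g) y := by
  induction y using TensorProduct.induction_on with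
  | zero => exact fun f => ⟨0, fun g => by simp⟩
  | add y z hy hz => simpa only [map_add] using hy.add hz
  | tmul s p =>
    simp only [tensorSym_tmul, map_one, Module.End.one_apply]
    exact (isPolyFun_symRep_apply p).map (TensorProduct.mk ℂ S (SymSpace k) s)

variable {V : Type*} [AddCommGroup V] [Module ℂ V] [FiniteDimensional ℂ V]

/-- The subspace `U` is the direct sum of finitely many representations with property `P`. -/
def DecomposesInto (ρ : Representation ℂ H V)
    (P : ∀ {d : ℕ}, Representation ℂ H (Fin d → ℂ) → Prop) (U : Submodule ℂ V) : Prop :=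
  ∃ (r : ℕ) (d : Fin r → ℕ) (σ : ∀ i, Representation ℂ H (Fin (d i) → ℂ))
    (j : ∀ i, (Fin (d i) → ℂ) →ₗ[ℂ] V), (∀ i, P (σ i)) ∧ (∀ i h x, j i (σ i h x) = ρ h (j i x)) ∧
      (∀ i x, j i x ∈ U) ∧ (∀ s : ∀ i, Fin (d i) → ℂ, ∑ i, j i (s i) = 0 → s = 0) ∧
      ∀ u ∈ U, ∃ s : ∀ i, Fin (d i) → ℂ, ∑ i, j i (s i) = u

/-- `H` commutes with `SL_2(ℂ)`, so it acts on each space of highest weight vectors, which is the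
multiplicity space of `Sym^k`. Splitting these spaces and lifting each highest weight vector to an
equivariant map from `Sym^k` gives a map onto `V` whose bijectivity need only be tested on highest
weight vectors. -/
theorem exists_tensor_decomposition {ρ : Representation ℂ (H × SL(2, ℂ)) V}
    (hreg : IsPolyFun fun g => ρ (1, g))
    {P : ∀ {d : ℕ}, Representation ℂ H (Fin d → ℂ) → Prop}
    (hH : ∀ U : Submodule ℂ V, (∀ h : H, ∀ v ∈ U, ρ (h, 1) v ∈ U) →
      DecomposesInto (ρ.comp (MonoidHom.inl H SL(2, ℂ))) P U) :
    ∃ (ι : Type) (_ : Fintype ι) (k : ι → ℕ) (d : ι → ℕ)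
      (σ : ∀ i, Representation ℂ H (Fin (d i) → ℂ)), (∀ i, P (σ i)) ∧
        Nonempty ((piRep fun i => tensorSym (σ i) (k i)).Equiv ρ) := by
  classical
  let τ : Representation ℂ SL(2, ℂ) V := ρ.comp (MonoidHom.inr H SL(2, ℂ))
  have hτ : IsPolyFun fun g => τ g := hreg
  have hcomm : ∀ h g v, ρ (h, 1) (τ g v) = τ g (ρ (h, 1) v) := by
    intro h g v
    change ρ (h, 1) (ρ (1, g) v) = ρ (1, g) (ρ (h, 1) v)
    rw [← Module.End.mul_apply, ← Module.End.mul_apply, ← map_mul, ← map_mul]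
    simp
  have hmul : ∀ (x : H × SL(2, ℂ)) v, ρ x v = ρ (x.1, 1) (τ x.2 v) := by
    intro x v
    change _ = ρ (x.1, 1) (ρ (1, x.2) v)
    rw [← Module.End.mul_apply, ← map_mul]
    simp
  have hhst : ∀ (k : ℤ) (h : H), ∀ v ∈ highest τ k, ρ (h, 1) v ∈ highest τ k := by
    intro k h v hv
    exact ⟨fun x => by rw [← hcomm, hv.1], fun a => by rw [← hcomm, hv.2, map_smul]⟩
  choose r d σ j hP hj hU hinj hsur using fun k : ℕ => hH (highest τ k) (hhst k)
  choose L hL1 hL2 hL3 using exists_liftMap hτ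
  obtain ⟨K, hK⟩ := exists_highest_bound hτ
  -- Beyond `K` there are no highest weight vectors, which keeps the index set finite.
  let ι := Σ κ : Fin K, Fin (r κ)
  let Φ : ∀ i : ι, (Fin (d i.1 i.2) → ℂ) ⊗[ℂ] SymSpace i.1 →ₗ[ℂ] V := fun i =>
    TensorProduct.lift (L i.1 ∘ₗ LinearMap.codRestrict _ (j i.1 i.2) (hU i.1 i.2))
  have hΦ : ∀ i s p, Φ i (s ⊗ₜ p) = L i.1 ⟨j i.1 i.2 s, hU i.1 i.2 s⟩ p := fun i s p => rfl
  have hΦe : ∀ i x y, Φ i (tensorSym (σ i.1 i.2) i.1 x y) = ρ x (Φ i y) := by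
    intro i x y
    induction y using TensorProduct.induction_on with
    | zero => simp
    | add y z hy hz => simp only [map_add, hy, hz]
    | tmul s p =>
      rw [tensorSym_tmul, hΦ, hΦ, hL2, hmul x, hcomm]
      congr 1
      have := hL3 i.1 (ρ (x.1, 1)) (fun g => LinearMap.ext fun v => hcomm x.1 g v)
        ⟨j i.1 i.2 s, hU i.1 i.2 s⟩ ⟨j i.1 i.2 (σ i.1 i.2 x.1 s), hU i.1 i.2 _⟩
        (hj i.1 i.2 x.1 s).symm
      exact (LinearMap.congr_fun this p).symm
  let Ψ : (∀ i : ι, (Fin (d i.1 i.2) → ℂ) ⊗[ℂ] SymSpace i.1) →ₗ[ℂ] V :=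
    ∑ i, Φ i ∘ₗ LinearMap.proj i
  have hΨ : ∀ y, Ψ y = ∑ i, Φ i (y i) := fun y => by simp [Ψ]
  let R := piRep fun i : ι => tensorSym (σ i.1 i.2) i.1
  have hΨe : ∀ x y, Ψ (R x y) = ρ x (Ψ y) := by
    intro x y
    rw [hΨ, hΨ, map_sum]
    exact Finset.sum_congr rfl fun i _ => hΦe i x (y i)
  let τR : Representation ℂ SL(2, ℂ) (∀ i : ι, (Fin (d i.1 i.2) → ℂ) ⊗[ℂ] SymSpace i.1) :=
    R.comp (MonoidHom.inr H SL(2, ℂ))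
  have hτR : IsPolyFun fun g => τR g := by
    refine isPolyFun_of_apply fun y => ?_
    have e : (fun g => τR g y) = fun g =>
        ∑ i, LinearMap.single ℂ _ i (tensorSym (σ i.1 i.2) i.1 (1, g) (y i)) := by
      funext g
      simp only [LinearMap.coe_single]
      exact (Finset.univ_sum_single (τR g y)).symm
    rw [e]
    exact IsPolyFun.sum _ fun i _ => (isPolyFun_tensorSym _ _ _).map _
  have hinjΨ : Function.Injective Ψ := by
    refine injective_of_highest hτR (τ₂ := τ) (fun g y => hΨe (1, g) y) fun k y hy h0 => ?_
    have hyi : ∀ i, ∃ s, y i = s ⊗ₜ topVec i.1 := by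
      intro i
      refine exists_tmul_topVec fun x => ?_
      have := congrFun (hy.1 x) i
      refine Eq.trans ?_ this
      change _ = TensorProduct.map (σ i.1 i.2 1) (symRep i.1 (upper x)) (y i)
      rw [map_one]
      rfl
    choose s hs using hyi
    -- The torus element at `2` acts on `y i` both by `2 ^ i.1` and by `2 ^ k`.
    have hsk : ∀ i : ι, (i.1 : ℕ) ≠ k → y i = 0 := by
      intro i hik
      have h2 := congrFun (hy.2 (Units.mk0 2 two_ne_zero)) i
      change tensorSym (σ i.1 i.2) i.1 (1, torus _) (y i) = _ at h2
      rw [hs i, tensorSym_tmul, (topVec_mem i.1).2, map_one, Module.End.one_apply,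
        TensorProduct.tmul_smul, Units.val_mk0, zpow_natCast, Pi.smul_apply, hs i,
        zpow_natCast] at h2
      rw [hs i]
      by_contra hne
      have h3 : (2 : ℂ) ^ (i.1 : ℕ) = 2 ^ k := smul_left_injective ℂ hne h2
      have h4 : (2 : ℕ) ^ (i.1 : ℕ) = 2 ^ k := by exact_mod_cast h3
      exact hik (Nat.pow_right_injective le_rfl h4)
    by_cases hk : k < K
    · have h1 : ∑ i : Fin (r k), j k i (s ⟨⟨k, hk⟩, i⟩) = 0 := by
        rw [hΨ, Fintype.sum_sigma, Finset.sum_eq_single (⟨k, hk⟩ : Fin K)] at h0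
        · rw [← h0]
          refine Finset.sum_congr rfl fun i _ => ?_
          rw [hs ⟨⟨k, hk⟩, i⟩, hΦ, hL1]
        · intro κ _ hκ
          refine Finset.sum_eq_zero fun i _ => ?_
          rw [hsk ⟨κ, i⟩ (fun h => hκ (Fin.ext h)), map_zero]
        · intro h
          exact absurd (Finset.mem_univ _) h
      have h2 := hinj k (fun i => s ⟨⟨k, hk⟩, i⟩) h1
      funext i
      by_cases hik : (i.1 : ℕ) = k
      · obtain ⟨⟨κ, hκ⟩, i⟩ := i
        obtain rfl : κ = k := hik
        have h3 : s ⟨⟨κ, hκ⟩, i⟩ = 0 := congrFun h2 i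
        rw [hs, h3, TensorProduct.zero_tmul]
        rfl
      · exact hsk i hik
    · funext i
      exact hsk i (fun h => hk (h ▸ i.1.2))
  have hsurΨ : Function.Surjective Ψ := by
    refine surjective_of_highest hτ (τ₂ := τR) (fun g y => hΨe (1, g) y) fun k v hv => ?_
    by_cases hk : k < K
    · obtain ⟨s, hs⟩ := hsur k v hv
      refine ⟨∑ i : Fin (r k), Pi.single ⟨⟨k, hk⟩, i⟩ (s i ⊗ₜ topVec k), ?_⟩
      rw [map_sum, ← hs]
      refine Finset.sum_congr rfl fun i _ => ?_
      rw [hΨ, Finset.sum_eq_single ⟨⟨k, hk⟩, i⟩, Pi.single_eq_same, hΦ, hL1]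
      · intro i' _ hi'
        rw [Pi.single_eq_of_ne hi', map_zero]
      · intro h
        exact absurd (Finset.mem_univ _) h
    · rw [hK k (not_lt.1 hk), Submodule.mem_bot] at hv
      exact ⟨0, by rw [hv, map_zero]⟩
  exact ⟨ι, inferInstance, fun i => i.1, fun i => d i.1 i.2, fun i => σ i.1 i.2,
    fun i => hP i.1 i.2, nonempty_equiv_of_bijective Ψ hΨe ⟨hinjΨ, hsurΨ⟩⟩

end Decomposition

/-! ### Groups that are extensions of a cyclic group -/

section Extension

variable {Γ : Type*} [Group Γ]

/-- Conjugation by `z` is an automorphism of the finite image of `K` modulo `N`, so its power to the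
order of the automorphism group is trivial. -/
theorem exists_conj_pow_mem {K N : Subgroup Γ} [K.Normal] [N.Normal] (hNK : N.relIndex K ≠ 0)
    (z : Γ) : ∃ n : ℕ, 0 < n ∧ ∀ i ∈ K, (z ^ n * i * (z ^ n)⁻¹) * i⁻¹ ∈ N := by
  let Kb : Subgroup (Γ ⧸ N) := K.map (QuotientGroup.mk' N)
  have hKn : Kb.Normal := Subgroup.Normal.map inferInstance _ (QuotientGroup.mk'_surjective N)
  have hfin : Finite Kb := by
    have h1 : Finite (K ⧸ N.subgroupOf K) := Nat.finite_of_card_ne_zero hNK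
    refine Finite.of_surjective (fun x : K ⧸ N.subgroupOf K => Quotient.liftOn' x
      (fun k : K => (⟨QuotientGroup.mk' N k, Subgroup.mem_map_of_mem _ k.2⟩ : Kb)) ?_) ?_
    · intro a b hab
      rw [QuotientGroup.leftRel_apply] at hab
      exact Subtype.ext (QuotientGroup.eq.2 hab)
    · rintro ⟨_, k, hk, rfl⟩
      exact ⟨Quotient.mk'' ⟨k, hk⟩, rfl⟩
  have : Finite (MulAut Kb) := Finite.of_injective (fun f : MulAut Kb => (f : Kb → Kb))
    DFunLike.coe_injective
  refine ⟨Nat.card (MulAut Kb), Nat.card_pos, fun i hi => ?_⟩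
  have h1 : (MulAut.conjNormal (QuotientGroup.mk' N z) : MulAut Kb) ^ Nat.card (MulAut Kb) = 1 :=
    pow_card_eq_one'
  rw [← map_pow, ← map_pow] at h1
  have h2 := congrArg Subtype.val
    (DFunLike.congr_fun h1 ⟨QuotientGroup.mk' N i, Subgroup.mem_map_of_mem _ hi⟩)
  rw [MulAut.conjNormal_apply, MulAut.one_apply] at h2
  rw [← QuotientGroup.eq_one_iff]
  change QuotientGroup.mk' N _ = 1
  rw [map_mul, map_mul, map_mul, map_inv, map_inv, h2, mul_inv_cancel]

/-- `Γ` is generated by `z` and the kernel of `δ`. Dividing the exponent of `z` by `n` with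
remainder represents every coset of `Z` as `z ^ r * k` with `r < n` and `k` in the kernel, where `k`
matters only modulo `Z`. -/
theorem finite_quotient_of_mem {δ : Γ →* Multiplicative ℤ} {z : Γ}
    (hz : δ.range = Subgroup.zpowers (δ z)) {I Z : Subgroup Γ} (hIZ : I ≤ Z)
    (hI : I.relIndex δ.ker ≠ 0) {n : ℕ} (hn : 0 < n) (hzn : z ^ n ∈ Z) : Finite (Γ ⧸ Z) := by
  have h1 : Finite (δ.ker ⧸ Z.subgroupOf δ.ker) := by
    refine Nat.finite_of_card_ne_zero fun h => hI ?_
    exact Subgroup.relIndex_eq_zero_of_le_left hIZ h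
  refine Finite.of_surjective (fun x : Fin n × (δ.ker ⧸ Z.subgroupOf δ.ker) =>
    Quotient.liftOn' x.2 (fun k : δ.ker => ((z ^ (x.1 : ℕ) * (k : Γ) : Γ) : Γ ⧸ Z)) ?_) ?_
  · intro a b hab
    rw [QuotientGroup.leftRel_apply] at hab
    refine QuotientGroup.eq.2 ?_
    rw [mul_inv_rev, mul_assoc, inv_mul_cancel_left]
    exact hab
  · intro y
    obtain ⟨γ, rfl⟩ := QuotientGroup.mk_surjective y
    have hγ : δ γ ∈ Subgroup.zpowers (δ z) := hz ▸ ⟨γ, rfl⟩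
    obtain ⟨m, hm⟩ := Subgroup.mem_zpowers_iff.1 hγ
    have hn' : (0 : ℤ) < n := by exact_mod_cast hn
    have hb0 := Int.emod_nonneg m hn'.ne'
    have hbn := Int.emod_lt_of_pos m hn'
    have hpow : z ^ m = z ^ (m % n).toNat * (z ^ n) ^ (m / n) := by
      rw [← zpow_natCast, ← zpow_natCast, ← zpow_mul, ← zpow_add, Int.toNat_of_nonneg hb0,
        Int.emod_add_mul_ediv]
    have hk : z ^ (-((m % n).toNat : ℤ)) * γ * ((z ^ n) ^ (m / n))⁻¹ ∈ δ.ker := by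
      rw [MonoidHom.mem_ker, map_mul, map_mul, map_inv, zpow_neg, zpow_natCast, map_inv, ← hm,
        ← map_zpow δ z m, hpow, map_mul, inv_mul_cancel_left, mul_inv_cancel]
    refine ⟨(⟨(m % n).toNat, by omega⟩, Quotient.mk'' ⟨_, hk⟩), QuotientGroup.eq.2 ?_⟩
    have e : (z ^ (m % n).toNat * (z ^ (-((m % n).toNat : ℤ)) * γ * ((z ^ n) ^ (m / n))⁻¹))⁻¹ * γ =
        (z ^ n) ^ (m / n) := by
      rw [zpow_neg, zpow_natCast]
      group
    change (z ^ (m % n).toNat * (z ^ (-((m % n).toNat : ℤ)) * γ * ((z ^ n) ^ (m / n))⁻¹))⁻¹ * γ ∈ Z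
    rw [e]
    exact Z.zpow_mem hzn _

/-- Subgroups of an infinite cyclic group are cyclic. The second clause normalises the generator
when the range is trivial, a case that `exists_absTwist_bounded` treats separately. -/
theorem exists_range_eq_zpowers (δ : Γ →* Multiplicative ℤ) :
    ∃ z, δ.range = Subgroup.zpowers (δ z) ∧ (δ z = 1 → z = 1) := by
  obtain ⟨⟨y, hy⟩, h⟩ := (inferInstance : IsCyclic δ.range).exists_generator
  have hr : δ.range = Subgroup.zpowers y := by
    refine le_antisymm (fun x hx => ?_) (Subgroup.zpowers_le.2 hy)
    obtain ⟨m, hm⟩ := Subgroup.mem_zpowers_iff.1 (h ⟨x, hx⟩)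
    exact Subgroup.mem_zpowers_iff.2 ⟨m, congrArg Subtype.val hm⟩
  by_cases hy1 : y = 1
  · exact ⟨1, by rw [hr, hy1, map_one], fun _ => rfl⟩
  · obtain ⟨z, rfl⟩ := hy
    exact ⟨z, hr, fun h => absurd h hy1⟩

section Rep

variable {V : Type*} [AddCommGroup V] [Module ℂ V] [FiniteDimensional ℂ V]
  {ρ : Representation ℂ Γ V}

/-- The elements that commute with a given endomorphism. -/
def commutantSubgroup (ρ : Representation ℂ Γ V) (p : V →ₗ[ℂ] V) : Subgroup Γ where
  carrier := {g | ρ g * p = p * ρ g}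
  mul_mem' {a b} ha hb := by
    change ρ (a * b) * p = p * ρ (a * b)
    rw [map_mul, mul_assoc, hb, ← mul_assoc, ha, mul_assoc]
  one_mem' := by
    change ρ 1 * p = p * ρ 1
    rw [map_one, one_mul, mul_one]
  inv_mem' {a} ha := by
    change ρ a⁻¹ * p = p * ρ a⁻¹
    have h : ρ a * p = p * ρ a := ha
    have h1 : ρ a⁻¹ * ρ a = 1 := by rw [← map_mul, inv_mul_cancel, map_one]
    have h2 : ρ a * ρ a⁻¹ = 1 := by rw [← map_mul, mul_inv_cancel, map_one]
    calc ρ a⁻¹ * p = ρ a⁻¹ * (p * ρ a) * ρ a⁻¹ := by rw [mul_assoc, mul_assoc, h2, mul_one]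
      _ = p * ρ a⁻¹ := by rw [← h, ← mul_assoc, h1, one_mul]

theorem mem_commutantSubgroup {p : V →ₗ[ℂ] V} {g : Γ} :
    g ∈ commutantSubgroup ρ p ↔ ρ g * p = p * ρ g := Iff.rfl

/-- Semisimplicity of `ρ z` yields a projection `p` onto `W` commuting with `ρ z`. It also commutes
with `I`, so its commutant has finite index, and the conjugates of `p` can be summed over cosets.
The sum is equivariant and is a nonzero multiple of the identity on `W`; its kernel is the
complement. -/
theorem exists_stable_complement {δ : Γ →* Multiplicative ℤ} {I : Subgroup Γ}
    (hI : I.relIndex δ.ker ≠ 0) (hρI : ∀ i ∈ I, ρ i = 1)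
    (hss : ∀ g, Module.End.IsSemisimple (ρ g)) {W : Submodule ℂ V} (hW : ∀ g, ∀ v ∈ W, ρ g v ∈ W) :
    ∃ C : Submodule ℂ V, (∀ g, ∀ v ∈ C, ρ g v ∈ C) ∧ IsCompl W C := by
  obtain ⟨z, hz, -⟩ := exists_range_eq_zpowers δ
  obtain ⟨C₀, hC₀, hc⟩ := Module.End.isSemisimple_iff.1 (hss z) W (fun v hv => hW z v hv)
  let p : V →ₗ[ℂ] V := W.subtype ∘ₗ W.projectionOnto C₀ hc
  have hpW : ∀ v, p v ∈ W := fun v => Subtype.prop _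
  have hpid : ∀ v ∈ W, p v = v := fun v hv =>
    congrArg Subtype.val (Submodule.projectionOnto_apply_left hc ⟨v, hv⟩)
  have hpC : ∀ v ∈ C₀, p v = 0 := fun v hv =>
    congrArg Subtype.val (Submodule.projectionOnto_apply_right hc ⟨v, hv⟩)
  have hzp : ρ z * p = p * ρ z := by
    ext v
    obtain ⟨w, hw, c, hcc, rfl⟩ := Submodule.mem_sup.1
      (show v ∈ W ⊔ C₀ by rw [hc.sup_eq_top]; trivial)
    simp only [Module.End.mul_apply, map_add]
    rw [hpid w hw, hpC c hcc, hpid _ (hW z w hw), hpC _ (hC₀ hcc), map_zero]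
  let Z := commutantSubgroup ρ p
  have hIZ : I ≤ Z := fun i hi => by
    rw [mem_commutantSubgroup, hρI i hi, one_mul, mul_one]
  have hfin : Finite (Γ ⧸ Z) := finite_quotient_of_mem hz hIZ hI one_pos
    (by rw [pow_one]; exact hzp)
  have := Fintype.ofFinite (Γ ⧸ Z)
  have hinv : ∀ g, ρ g * ρ g⁻¹ = 1 := fun g => by rw [← map_mul, mul_inv_cancel, map_one]
  -- Conjugating `p` by `g` depends only on the coset of `g` modulo the commutant.
  let f : Γ ⧸ Z → V →ₗ[ℂ] V := fun x => Quotient.liftOn' x (fun g => ρ g * p * ρ g⁻¹) (by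
    intro a b hab
    rw [QuotientGroup.leftRel_apply, mem_commutantSubgroup] at hab
    have hb : b = a * (a⁻¹ * b) := by group
    have e : ρ b * p * ρ b⁻¹ = ρ a * (ρ (a⁻¹ * b) * p) * ρ b⁻¹ := by
      conv_lhs => rw [hb, map_mul, ← hb]
      simp only [mul_assoc]
    change ρ a * p * ρ a⁻¹ = ρ b * p * ρ b⁻¹
    rw [e, hab, mul_assoc, mul_assoc, mul_assoc, ← map_mul]
    simp)
  have hf : ∀ g : Γ, f g = ρ g * p * ρ g⁻¹ := fun g => rfl
  have hconj : ∀ g (x : Γ ⧸ Z), ρ g * f x = f (g • x) * ρ g := by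
    intro g x
    obtain ⟨a, rfl⟩ := QuotientGroup.mk_surjective x
    rw [hf]
    change _ = f ((g * a : Γ) : Γ ⧸ Z) * ρ g
    rw [hf, map_mul, mul_inv_rev, map_mul]
    simp only [mul_assoc]
    rw [← map_mul ρ g⁻¹ g, inv_mul_cancel, map_one, mul_one]
  let Q : V →ₗ[ℂ] V := ∑ x, f x
  have hQ : ∀ g, ρ g * Q = Q * ρ g := by
    intro g
    rw [Finset.mul_sum, Finset.sum_mul]
    exact Fintype.sum_equiv (MulAction.toPerm g) _ _ fun x => hconj g x
  have hfW : ∀ x v, f x v ∈ W := by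
    intro x v
    obtain ⟨a, rfl⟩ := QuotientGroup.mk_surjective x
    exact hW a _ (hpW _)
  have hfid : ∀ x, ∀ v ∈ W, f x v = v := by
    intro x v hv
    obtain ⟨a, rfl⟩ := QuotientGroup.mk_surjective x
    rw [hf, Module.End.mul_apply, Module.End.mul_apply, hpid _ (hW _ _ hv),
      ← Module.End.mul_apply, hinv, Module.End.one_apply]
  have hQW : ∀ v, Q v ∈ W := fun v => by
    rw [LinearMap.sum_apply]
    exact Submodule.sum_mem _ fun x _ => hfW x v
  have hQid : ∀ v ∈ W, Q v = (Fintype.card (Γ ⧸ Z) : ℂ) • v := fun v hv => by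
    rw [LinearMap.sum_apply, Finset.sum_congr rfl fun x _ => hfid x v hv]
    simp [Nat.cast_smul_eq_nsmul]
  have hcard : (Fintype.card (Γ ⧸ Z) : ℂ) ≠ 0 := by
    have : 0 < Fintype.card (Γ ⧸ Z) := Fintype.card_pos
    exact_mod_cast this.ne'
  refine ⟨LinearMap.ker Q, fun g v hv => ?_, ?_, ?_⟩
  · rw [LinearMap.mem_ker] at hv ⊢
    have := LinearMap.congr_fun (hQ g) v
    rw [Module.End.mul_apply, Module.End.mul_apply, hv, map_zero] at this
    exact this.symm
  · rw [Submodule.disjoint_def]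
    intro v hv hv'
    rw [LinearMap.mem_ker, hQid v hv, smul_eq_zero] at hv'
    exact hv'.resolve_left hcard
  · rw [codisjoint_iff, eq_top_iff]
    intro v _
    refine Submodule.mem_sup.2 ⟨(Fintype.card (Γ ⧸ Z) : ℂ)⁻¹ • Q v, W.smul_mem _ (hQW v),
      v - (Fintype.card (Γ ⧸ Z) : ℂ)⁻¹ • Q v, ?_, by abel⟩
    rw [LinearMap.mem_ker, map_sub, map_smul, hQid _ (hQW v), smul_smul, inv_mul_cancel₀ hcard,
      one_smul, sub_self]

/-- Take a nonzero stable subspace of least dimension and transport it to coordinates, since the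
constituents are to act on spaces `Fin d → ℂ`. -/
theorem exists_irreducible_le {W : Submodule ℂ V} (hW : ∀ g, ∀ v ∈ W, ρ g v ∈ W) (h0 : W ≠ ⊥) :
    ∃ (U : Submodule ℂ V) (d : ℕ) (σ : Representation ℂ Γ (Fin d → ℂ)) (j : (Fin d → ℂ) →ₗ[ℂ] V),
      U ≤ W ∧ U ≠ ⊥ ∧ (∀ g, ∀ v ∈ U, ρ g v ∈ U) ∧ σ.IsIrreducible ∧
      (∀ g x, j (σ g x) = ρ g (j x)) ∧ Function.Injective j ∧ LinearMap.range j = U := by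
  have hwf : ∃ n, ∃ U : Submodule ℂ V, U ≤ W ∧ U ≠ ⊥ ∧ (∀ g, ∀ v ∈ U, ρ g v ∈ U) ∧
      Module.finrank ℂ U = n := ⟨_, W, le_rfl, h0, hW, rfl⟩
  classical
  obtain ⟨U, hUW, hU0, hU, hn⟩ := Nat.find_spec hwf
  have hmin : ∀ U' : Submodule ℂ V, U' ≤ U → U' ≠ ⊥ → (∀ g, ∀ v ∈ U', ρ g v ∈ U') → U' = U := by
    intro U' h1 h2 h3
    refine Submodule.eq_of_le_of_finrank_le h1 ?_
    rw [hn]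
    exact Nat.find_min' hwf ⟨U', h1.trans hUW, h2, h3, rfl⟩
  let e : (Fin (Module.finrank ℂ U) → ℂ) ≃ₗ[ℂ] U := (Module.finBasis ℂ U).equivFun.symm
  let ρU : Representation ℂ Γ U := Subrepresentation.toRepresentation ⟨U, fun g v hv => hU g v hv⟩
  let σ : Representation ℂ Γ (Fin (Module.finrank ℂ U) → ℂ) :=
    { toFun := fun g => e.symm.toLinearMap ∘ₗ ρU g ∘ₗ e.toLinearMap
      map_one' := LinearMap.ext fun x => by simp
      map_mul' := fun g h => LinearMap.ext fun x => by simp }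
  let j : (Fin (Module.finrank ℂ U) → ℂ) →ₗ[ℂ] V := U.subtype ∘ₗ e.toLinearMap
  have hj : ∀ g x, j (σ g x) = ρ g (j x) := by
    intro g x
    change ((e (e.symm (ρU g (e x))) : U) : V) = _
    rw [e.apply_symm_apply]
    rfl
  have hjinj : Function.Injective j := Subtype.val_injective.comp e.injective
  have hrange : LinearMap.range j = U := by
    rw [LinearMap.range_comp_of_range_eq_top _ (LinearEquiv.range e), Submodule.range_subtype]
  refine ⟨U, _, σ, j, hUW, hU0, hU, ?_, hj, hjinj, hrange⟩
  have hnt : Nontrivial (Subrepresentation σ) := by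
    refine ⟨⊥, ⊤, fun h => hU0 ?_⟩
    have h1 : (⊥ : Submodule ℂ (Fin (Module.finrank ℂ U) → ℂ)) = ⊤ :=
      congrArg Subrepresentation.toSubmodule h
    rw [← hrange, ← Submodule.map_top, ← h1, Submodule.map_bot]
  refine ⟨fun N => ?_⟩
  by_cases hN : N.toSubmodule = ⊥
  · exact Or.inl (Subrepresentation.toSubmodule_injective hN)
  · right
    refine Subrepresentation.toSubmodule_injective ?_
    have h1 : N.toSubmodule.map j = U := by
      refine hmin _ (LinearMap.map_le_range.trans_eq hrange) ?_ ?_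
      · exact fun h => hN (Submodule.map_injective_of_injective hjinj
          (h.trans (Submodule.map_bot j).symm))
      · rintro g _ ⟨x, hx, rfl⟩
        exact ⟨σ g x, N.apply_mem_toSubmodule g hx, hj g x⟩
    exact Submodule.map_injective_of_injective hjinj
      (h1.trans (hrange.symm.trans (Submodule.map_top j).symm))

/-- Schur's lemma: an eigenspace of `f` is stable and nonzero. -/
theorem exists_scalar_of_commutes {σ : Representation ℂ Γ V} (hσ : σ.IsIrreducible)
    {f : V →ₗ[ℂ] V} (hf : ∀ g, σ g * f = f * σ g) : ∃ c : ℂ, f = c • 1 := by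
  have hnt : Nontrivial V := by
    have h1 : Nontrivial (Subrepresentation σ) := hσ.toNontrivial
    by_contra h
    rw [not_nontrivial_iff_subsingleton] at h
    obtain ⟨a, b, hab⟩ := h1
    exact hab (Subrepresentation.toSubmodule_injective (Subsingleton.elim _ _))
  obtain ⟨c, hc⟩ := Module.End.exists_eigenvalue f
  let N : Subrepresentation σ := ⟨Module.End.eigenspace f c, fun g v hv => by
    rw [Module.End.mem_eigenspace_iff] at hv ⊢
    have := LinearMap.congr_fun (hf g) v
    rw [Module.End.mul_apply, Module.End.mul_apply, hv, map_smul] at this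
    exact this.symm⟩
  rcases hσ.eq_bot_or_eq_top N with h | h
  · exact absurd (congrArg Subrepresentation.toSubmodule h) hc
  · refine ⟨c, LinearMap.ext fun v => ?_⟩
    have h1 : Module.End.eigenspace f c = ⊤ := congrArg Subrepresentation.toSubmodule h
    have : v ∈ Module.End.eigenspace f c := by rw [h1]; trivial
    simpa using Module.End.mem_eigenspace_iff.1 this

end Rep

end Extension

theorem nontrivial_of_isIrreducible {G V : Type*} [Group G] [AddCommGroup V] [Module ℂ V]
    {ρ : Representation ℂ G V} (hρ : ρ.IsIrreducible) : Nontrivial V := by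
  have h1 : Nontrivial (Subrepresentation ρ) := hρ.toNontrivial
  by_contra h
  rw [not_nontrivial_iff_subsingleton] at h
  obtain ⟨a, b, hab⟩ := h1
  exact hab (Subrepresentation.toSubmodule_injective (Subsingleton.elim _ _))

/-! ### Irreducible representations of the Weil group as twists of bounded ones. -/

section WeilRep

variable {F : Type*} [Field F] [ValuativeRel F] [TopologicalSpace F] [IsNonarchimedeanLocalField F]
  {H : Subgroup (WeilGroup F)}

/-- The degree map on a subgroup of the Weil group. -/
abbrev degOn (H : Subgroup (WeilGroup F)) : H →* Multiplicative ℤ := WeilGroup.deg.comp H.subtype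

/-- Induction on the dimension: split off an irreducible `W` inside `U` and continue with the
intersection of `U` and a stable complement of `W`. -/
theorem decomposesInto_irreducible {V : Type*} [AddCommGroup V] [Module ℂ V] [FiniteDimensional ℂ V]
    {ρ : Representation ℂ H V} {I : Subgroup H}
    (hI : I.relIndex (degOn H).ker ≠ 0) (hρI : ∀ i ∈ I, ρ i = 1)
    (hss : ∀ g, Module.End.IsSemisimple (ρ g))
    {P : ∀ {d : ℕ}, Representation ℂ H (Fin d → ℂ) → Prop}
    (hP : ∀ {d : ℕ} (σ : Representation ℂ H (Fin d → ℂ)), σ.IsIrreducible → (∀ i ∈ I, σ i = 1) → P σ)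
    (U : Submodule ℂ V) (hU : ∀ g, ∀ v ∈ U, ρ g v ∈ U) : DecomposesInto ρ P U := by
  -- Bundling dimension, representation and embedding into one family allows a constituent to be
  -- prepended with `Fin.cons`.
  suffices h : ∃ (r : ℕ) (X : Fin r → Σ d : ℕ, Representation ℂ H (Fin d → ℂ) ×
      ((Fin d → ℂ) →ₗ[ℂ] V)), (∀ i, P (X i).2.1) ∧
      (∀ i h x, (X i).2.2 ((X i).2.1 h x) = ρ h ((X i).2.2 x)) ∧ (∀ i x, (X i).2.2 x ∈ U) ∧
      (∀ s : ∀ i, Fin (X i).1 → ℂ, ∑ i, (X i).2.2 (s i) = 0 → s = 0) ∧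
      ∀ u ∈ U, ∃ s : ∀ i, Fin (X i).1 → ℂ, ∑ i, (X i).2.2 (s i) = u by
    obtain ⟨r, X, h1, h2, h3, h4, h5⟩ := h
    exact ⟨r, fun i => (X i).1, fun i => (X i).2.1, fun i => (X i).2.2, h1, h2, h3, h4, h5⟩
  induction hn : Module.finrank ℂ U using Nat.strong_induction_on generalizing U with
  | h n ih =>
    by_cases h0 : U = ⊥
    · refine ⟨0, Fin.elim0, fun i => i.elim0, fun i => i.elim0, fun i => i.elim0,
        fun s _ => funext fun i => i.elim0, fun u hu => ⟨fun i => i.elim0, ?_⟩⟩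
      rw [h0, Submodule.mem_bot] at hu
      simp [hu]
    · obtain ⟨W, d, σ, j, hWU, hW0, hW, hσ, hj, hjinj, hjr⟩ := exists_irreducible_le hU h0
      obtain ⟨C, hC, hc⟩ := exists_stable_complement hI hρI hss hW
      have hlt : Module.finrank ℂ (U ⊓ C : Submodule ℂ V) < n := by
        rw [← hn]
        refine Submodule.finrank_lt_finrank_of_lt (lt_of_le_of_ne inf_le_left fun h => hW0 ?_)
        rw [inf_eq_left] at h
        exact disjoint_self.1 (hc.disjoint.mono_right (hWU.trans h))
      obtain ⟨r, X, h1, h2, h3, h4, h5⟩ := ih _ hlt (U ⊓ C)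
        (fun g v hv => ⟨hU g v hv.1, hC g v hv.2⟩) rfl
      refine ⟨r + 1, Fin.cons ⟨d, σ, j⟩ X, ?_, ?_, ?_, ?_, ?_⟩
      · refine Fin.cases ?_ ?_
        · refine hP σ hσ fun i hi => LinearMap.ext fun x => hjinj ?_
          have := hj i x
          rw [hρI i hi] at this
          exact this
        · exact h1
      · exact Fin.cases hj h2
      · refine Fin.cases (fun x => hWU ?_) fun i x => (h3 i x).1
        rw [← hjr]
        exact ⟨x, rfl⟩
      · intro s hs
        rw [Fin.sum_univ_succ] at hs
        have hs1 : j (s 0) ∈ W := hjr ▸ ⟨s 0, rfl⟩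
        have hs2 : ∑ i, (X i).2.2 (s i.succ) ∈ C :=
          Submodule.sum_mem _ fun i _ => (h3 i _).2
        have hs0 : j (s 0) = 0 := by
          refine Submodule.disjoint_def.1 hc.disjoint _ hs1 ?_
          have e : j (s 0) = -∑ i, (X i).2.2 (s i.succ) := eq_neg_of_add_eq_zero_left hs
          rw [e]
          exact C.neg_mem hs2
        have hs3 := h4 (fun i => s i.succ) (by
          have e : j (s 0) + ∑ i, (X i).2.2 (s i.succ) = 0 := hs
          rwa [hs0, zero_add] at e)
        funext i
        refine Fin.cases ?_ (fun i => congrFun hs3 i) i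
        exact hjinj (hs0.trans (map_zero j).symm)
      · intro u hu
        obtain ⟨w, hw, c, hcc, rfl⟩ := Submodule.mem_sup.1
          (show u ∈ W ⊔ C by rw [hc.sup_eq_top]; trivial)
        obtain ⟨s, hs⟩ := h5 c ⟨(Submodule.add_mem_iff_right _ (hWU hw)).1 hu, hcc⟩
        rw [← hjr] at hw
        obtain ⟨x, rfl⟩ := hw
        refine ⟨Fin.cons x s, ?_⟩
        rw [Fin.sum_univ_succ, ← hs]
        rfl

theorem absPow_apply (t : ℝ) (w : WeilGroup F) : WeilGroup.absPow t w =
    (((resCard F : ℝ) ^ (t * ((Multiplicative.toAdd w.deg : ℤ) : ℝ)) : ℝ) : ℂ) := rfl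

theorem resCard_pos : (0 : ℝ) < resCard F := by
  exact_mod_cast zero_lt_one.trans (one_lt_resCard (F := F))

theorem norm_absPow (t : ℝ) (w : WeilGroup F) : ‖WeilGroup.absPow t w‖ =
    (resCard F : ℝ) ^ (t * ((Multiplicative.toAdd w.deg : ℤ) : ℝ)) := by
  rw [absPow_apply, Complex.norm_real, Real.norm_of_nonneg (Real.rpow_nonneg resCard_pos.le _)]

theorem absPow_add (s t : ℝ) (w : WeilGroup F) :
    WeilGroup.absPow (s + t) w = WeilGroup.absPow s w * WeilGroup.absPow t w := by
  rw [absPow_apply, absPow_apply, absPow_apply, ← Complex.ofReal_mul, ← Real.rpow_add resCard_pos,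
    add_mul]

theorem absPow_zero (w : WeilGroup F) : WeilGroup.absPow 0 w = 1 := by
  simp [absPow_apply]

theorem absPow_of_deg_eq_one (t : ℝ) {w : WeilGroup F} (hw : w.deg = 1) :
    WeilGroup.absPow t w = 1 := by
  simp [absPow_apply, hw]

theorem absTwist_apply {V : Type*} [AddCommGroup V] [Module ℂ V] (t : ℝ)
    (ρ : Representation ℂ H V) (h : H) : absTwist t ρ h = WeilGroup.absPow t h.1 • ρ h := rfl

theorem absTwist_absTwist {V : Type*} [AddCommGroup V] [Module ℂ V] (s t : ℝ)
    (ρ : Representation ℂ H V) : absTwist s (absTwist t ρ) = absTwist (s + t) ρ := by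
  ext1 h
  rw [absTwist_apply, absTwist_apply, absTwist_apply, smul_smul, absPow_add]

theorem absTwist_zero {V : Type*} [AddCommGroup V] [Module ℂ V]
    (ρ : Representation ℂ H V) : absTwist 0 ρ = ρ := by
  ext1 h
  rw [absTwist_apply, absPow_zero, one_smul]

instance : IsTopologicalGroup (WeilGroup F) :=
  topologicalGroup_induced ((WeilGroup.toGal F).prod WeilGroup.deg)

/-- A representation that is trivial on an open subgroup is continuous. -/
theorem continuous_of_trivial_on_open {d : ℕ} {σ : Representation ℂ H (Fin d → ℂ)} {I : Subgroup H}
    (hIo : IsOpen (I : Set H)) (hσI : ∀ i ∈ I, σ i = 1) :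
    Continuous fun w : H => LinearMap.toMatrix' (σ w) := by
  refine continuous_iff_continuousAt.2 fun w => ?_
  refine ContinuousAt.congr (f := fun _ => LinearMap.toMatrix' (σ w)) continuousAt_const ?_
  have hmem : (fun x => w⁻¹ * x) ⁻¹' (I : Set H) ∈ nhds w :=
    (hIo.preimage (continuous_const_mul w⁻¹)).mem_nhds (by simp [I.one_mem])
  filter_upwards [hmem] with x hx
  have : x = w * (w⁻¹ * x) := by group
  rw [this, map_mul, hσI _ hx, mul_one]

/-- The elements that act by a scalar of absolute value one. -/
def unitScalars {Γ : Type*} [Group Γ] {V : Type*} [AddCommGroup V] [Module ℂ V]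
    (φ : Representation ℂ Γ V) : Subgroup Γ where
  carrier := {g | ∃ u : ℂ, ‖u‖ = 1 ∧ φ g = u • 1}
  mul_mem' := by
    rintro a b ⟨u, hu, ha⟩ ⟨v, hv, hb⟩
    exact ⟨u * v, by rw [norm_mul, hu, hv, one_mul], by
      rw [map_mul, ha, hb, smul_mul_smul_comm, one_mul]⟩
  one_mem' := ⟨1, norm_one, by rw [map_one, one_smul]⟩
  inv_mem' := by
    rintro a ⟨u, hu, ha⟩
    have hu0 : u ≠ 0 := by rintro rfl; simp at hu
    refine ⟨u⁻¹, by rw [norm_inv, hu, inv_one], ?_⟩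
    have h1 : φ a⁻¹ * φ a = 1 := by rw [← map_mul, inv_mul_cancel, map_one]
    rw [ha, mul_smul_comm, mul_one] at h1
    rw [← h1, smul_smul, inv_mul_cancel₀ hu0, one_smul]

/-- Up to a scalar of absolute value one, only the finitely many matrices of coset representatives
occur. -/
theorem bounded_of_finite_quotient {Γ : Type*} [Group Γ] {d : ℕ}
    (φ : Representation ℂ Γ (Fin d → ℂ)) (hfin : Finite (Γ ⧸ unitScalars φ)) :
    ∃ C : ℝ, ∀ (w : Γ) (i j : Fin d), ‖LinearMap.toMatrix' (φ w) i j‖ ≤ C := by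
  have := Fintype.ofFinite (Γ ⧸ unitScalars φ)
  refine ⟨∑ y : Γ ⧸ unitScalars φ, ∑ i, ∑ j, ‖LinearMap.toMatrix' (φ y.out) i j‖,
    fun w i j => ?_⟩
  obtain ⟨u, hu, hw⟩ : (w : Γ ⧸ unitScalars φ).out⁻¹ * w ∈ unitScalars φ :=
    QuotientGroup.eq.1 (QuotientGroup.out_eq' (w : Γ ⧸ unitScalars φ))
  have e : φ w = u • φ (w : Γ ⧸ unitScalars φ).out := by
    have e1 : φ w = φ (w : Γ ⧸ unitScalars φ).out *
        φ ((w : Γ ⧸ unitScalars φ).out⁻¹ * w) := by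
      rw [← map_mul, mul_inv_cancel_left]
    rw [e1, hw, mul_smul_comm, mul_one]
  have h1 : ‖LinearMap.toMatrix' (φ w) i j‖ =
      ‖LinearMap.toMatrix' (φ (w : Γ ⧸ unitScalars φ).out) i j‖ := by
    rw [e, map_smul, Matrix.smul_apply, smul_eq_mul, norm_mul, hu, one_mul]
  rw [h1]
  refine le_trans ?_ (Finset.single_le_sum (f := fun y : Γ ⧸ unitScalars φ =>
    ∑ i, ∑ j, ‖LinearMap.toMatrix' (φ y.out) i j‖) (fun y _ => by positivity)
    (Finset.mem_univ (w : Γ ⧸ unitScalars φ)))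
  refine le_trans ?_ (Finset.single_le_sum (f := fun i =>
    ∑ j, ‖LinearMap.toMatrix' (φ (w : Γ ⧸ unitScalars φ).out) i j‖) (fun y _ => by positivity)
    (Finset.mem_univ i))
  exact Finset.single_le_sum
    (f := fun j => ‖LinearMap.toMatrix' (φ (w : Γ ⧸ unitScalars φ).out) i j‖)
    (fun y _ => by positivity) (Finset.mem_univ j)

/-- A power `z ^ n` of a Frobenius-like element acts as a scalar `c`. Twisting away the absolute
value of `c` makes `z ^ n` act by a unit scalar; as `I` acts trivially, the unit scalars then have
finite index and the twist is bounded. -/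
theorem exists_absTwist_bounded {d : ℕ} {σ : Representation ℂ H (Fin d → ℂ)} {I : Subgroup H}
    (hIo : IsOpen (I : Set H)) (hId : I ≤ (degOn H).ker) (hI : I.relIndex (degOn H).ker ≠ 0)
    (hσ : σ.IsIrreducible) (hσI : ∀ i ∈ I, σ i = 1) :
    ∃ (t : ℝ) (φ : Representation ℂ H (Fin d → ℂ)), IsIrredBounded φ ∧ σ = absTwist t φ := by
  obtain ⟨z, hz, hz1⟩ := exists_range_eq_zpowers (degOn H)
  let N : Subgroup H := MonoidHom.ker σ ⊓ (degOn H).ker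
  have hIN : I ≤ N := fun i hi => ⟨hσI i hi, hId hi⟩
  have hN : N.relIndex (degOn H).ker ≠ 0 := fun h => hI (Subgroup.relIndex_eq_zero_of_le_left hIN h)
  have hNn : N.Normal := by
    change (MonoidHom.ker σ ⊓ (degOn H).ker).Normal
    infer_instance
  obtain ⟨n, hn, hconj⟩ := exists_conj_pow_mem hN z
  -- Modulo the kernel of `σ`, `z ^ n` commutes with the elements of degree zero by choice of `n`,
  -- and every `g` is a power of `z` times such an element.
  have hcomm : ∀ g, σ g * σ (z ^ n) = σ (z ^ n) * σ g := by
    intro g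
    have hg : degOn H g ∈ Subgroup.zpowers (degOn H z) := hz ▸ ⟨g, rfl⟩
    obtain ⟨m, hm⟩ := Subgroup.mem_zpowers_iff.1 hg
    have hk : z ^ (-m) * g ∈ (degOn H).ker := by
      rw [MonoidHom.mem_ker, map_mul, ← hm, map_zpow, zpow_neg, inv_mul_cancel]
    have h1 : σ ((z ^ n) * (z ^ (-m) * g) * (z ^ n)⁻¹ * (z ^ (-m) * g)⁻¹) = 1 :=
      (hconj _ hk).1
    have h2 : z ^ n * g = z ^ m * ((z ^ n) * (z ^ (-m) * g) * (z ^ n)⁻¹ * (z ^ (-m) * g)⁻¹) *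
        z ^ (-m) * (g * z ^ n) := by group
    have h3 : z ^ m * z ^ (-m) = 1 := by group
    calc σ g * σ (z ^ n) = σ (z ^ m * z ^ (-m) * (g * z ^ n)) := by rw [h3, one_mul, map_mul]
      _ = σ (z ^ m) * 1 * σ (z ^ (-m)) * σ (g * z ^ n) := by rw [map_mul, map_mul, mul_one]
      _ = σ (z ^ n * g) := by
        rw [← h1, ← map_mul σ (z ^ m), ← map_mul σ _ (z ^ (-m)), ← map_mul σ _ (g * z ^ n), ← h2]
      _ = σ (z ^ n) * σ g := map_mul _ _ _
  obtain ⟨c, hc⟩ := exists_scalar_of_commutes hσ hcomm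
  have hnt := nontrivial_of_isIrreducible hσ
  have hc0 : c ≠ 0 := by
    rintro rfl
    have h1 : σ (z ^ n) * σ (z ^ n)⁻¹ = 1 := by rw [← map_mul, mul_inv_cancel, map_one]
    rw [hc, zero_smul, zero_mul] at h1
    exact zero_ne_one h1
  obtain ⟨t, ht⟩ : ∃ t : ℝ, ‖WeilGroup.absPow t (z ^ n : H).1‖ = ‖c‖ := by
    -- If the degree is trivial on `H`, then `z = 1`, so `c = 1` and `t = 0` works. Otherwise `t`
    -- solves `q ^ (t * D) = ‖c‖`, where `D ≠ 0` is the degree of `z ^ n`.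
    by_cases hd : degOn H z = 1
    · refine ⟨0, ?_⟩
      rw [absPow_zero, norm_one]
      rw [hz1 hd, one_pow, map_one] at hc
      have h1 := congrArg (fun f : Module.End ℂ (Fin d → ℂ) => f) hc
      obtain ⟨v, hv⟩ := exists_ne (0 : Fin d → ℂ)
      have h2 := LinearMap.congr_fun hc v
      simp only [Module.End.one_apply, LinearMap.smul_apply] at h2
      have h3 : (1 : ℂ) • v = c • v := by rw [one_smul]; exact h2
      rw [← smul_left_injective ℂ hv h3, norm_one]
    · have hD : Multiplicative.toAdd ((z ^ n : H).1.deg) ≠ 0 := by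
        rw [Subgroup.coe_pow, map_pow, toAdd_pow]
        exact smul_ne_zero hn.ne' fun h => hd h
      set D : ℤ := Multiplicative.toAdd ((z ^ n : H).1.deg)
      have hlog : 0 < Real.log (resCard F) :=
        Real.log_pos (by exact_mod_cast one_lt_resCard (F := F))
      have hD' : (D : ℝ) ≠ 0 := by exact_mod_cast hD
      refine ⟨Real.log ‖c‖ / (D * Real.log (resCard F)), ?_⟩
      rw [norm_absPow, Real.rpow_def_of_pos resCard_pos]
      have e : Real.log (resCard F) * (Real.log ‖c‖ / (D * Real.log (resCard F)) * D) =
          Real.log ‖c‖ := by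
        field_simp
      rw [e, Real.exp_log (norm_pos_iff.2 hc0)]
  have ht0 : ‖WeilGroup.absPow (-t) (z ^ n : H).1‖ * ‖c‖ = 1 := by
    rw [← ht, ← norm_mul, ← absPow_add, neg_add_cancel, absPow_zero, norm_one]
  have htriv : ∀ i ∈ I, absTwist (-t) σ i = 1 := fun i hi => by
    have h1 : WeilGroup.absPow (-t) (i : H).1 = 1 := absPow_of_deg_eq_one _ (hId hi)
    rw [absTwist_apply, hσI i hi, h1, one_smul]
  refine ⟨t, absTwist (-t) σ, ⟨?_, ?_, ?_⟩, ?_⟩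
  · have hmem : ∀ (N : Submodule ℂ (Fin d → ℂ)),
        (∀ g, ∀ v ∈ N, absTwist (-t) σ g v ∈ N) → ∀ g, ∀ v ∈ N, σ g v ∈ N := by
      intro N hN g v hv
      have h1 := N.smul_mem (WeilGroup.absPow t g.1) (hN g v hv)
      rwa [absTwist_apply, LinearMap.smul_apply, smul_smul, ← absPow_add, add_neg_cancel,
        absPow_zero, one_smul] at h1
    have : Nontrivial (Subrepresentation (absTwist (-t) σ)) := by
      refine ⟨⊥, ⊤, fun h => ?_⟩
      have h1 : (⊥ : Submodule ℂ (Fin d → ℂ)) = ⊤ := congrArg Subrepresentation.toSubmodule h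
      exact bot_ne_top h1
    refine ⟨fun M => ?_⟩
    let M' : Subrepresentation σ :=
      ⟨M.toSubmodule, fun g v hv => hmem _ (fun g v hv => M.apply_mem_toSubmodule g hv) g v hv⟩
    rcases hσ.eq_bot_or_eq_top M' with h | h
    · exact Or.inl (Subrepresentation.toSubmodule_injective
        (congrArg Subrepresentation.toSubmodule h :))
    · exact Or.inr (Subrepresentation.toSubmodule_injective
        (congrArg Subrepresentation.toSubmodule h :))
  · refine continuous_of_trivial_on_open hIo fun i hi => ?_
    exact htriv i hi
  · have hIZ : I ≤ unitScalars (absTwist (-t) σ) := fun i hi => ⟨1, norm_one, by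
      rw [htriv i hi, one_smul]⟩
    have hzZ : z ^ n ∈ unitScalars (absTwist (-t) σ) :=
      ⟨WeilGroup.absPow (-t) (z ^ n : H).1 * c, by rw [norm_mul, ht0], by
        rw [absTwist_apply, hc, smul_smul]⟩
    exact bounded_of_finite_quotient _ (finite_quotient_of_mem hz hIZ hI hn hzZ)
  · rw [absTwist_absTwist, add_neg_cancel, absTwist_zero]

end WeilRep

/-! ### The maximal ideal of the integers of the algebraic closure. -/

section Galois

variable {F : Type*} [Field F] [ValuativeRel F] [TopologicalSpace F] [IsNonarchimedeanLocalField F]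

/-- The absolute value of a local field extends to a multiplicative nonarchimedean absolute value on
the algebraic closure, whose unit ball consists of the integral elements. -/
theorem exists_absoluteValue_algebraicClosure : ∃ v : AlgebraicClosure F → ℝ,
    (∀ x y, v (x * y) = v x * v y) ∧ (∀ x y, v (x + y) ≤ max (v x) (v y)) ∧
    (∀ x, v x ≤ 1 ↔ IsIntegral 𝒪[F] x) ∧ (∀ x, 0 ≤ v x) ∧ v 1 = 1 ∧ v 0 = 0 ∧
    (∃ p ∈ 𝓂[F], 0 < v (algebraMap 𝒪[F] (AlgebraicClosure F) p)) ∧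
    ∀ p ∈ 𝓂[F], v (algebraMap 𝒪[F] (AlgebraicClosure F) p) < 1 := by
  -- The rank one valuation becomes an absolute value for which `F` is complete; `v` will be the
  -- spectral norm, which is multiplicative by completeness.
  let := IsTopologicalAddGroup.rightUniformSpace F
  have := isUniformAddGroup_of_addCommGroup (G := F)
  let : (Valued.v (R := F)).RankOne :=
  { hom' := IsRankLeOne.nonempty.some.emb (R := F).comp MonoidWithZeroHom.ValueGroup₀.embedding
    strictMono' := IsRankLeOne.nonempty.some.strictMono.comp
        MonoidWithZeroHom.ValueGroup₀.embedding_strictMono }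
  let : NontriviallyNormedField F := Valued.toNontriviallyNormedField F (ValueGroupWithZero F)
  have : IsUltrametricDist F := Valued.instIsUltrametricDist F (ValueGroupWithZero F)
  have : CompleteSpace F := inferInstance
  have hO : ∀ x : F, ‖x‖ ≤ 1 ↔ x ∈ 𝒪[F] := fun x => Valued.toNormedField.norm_le_one_iff
  have hm : ∀ p : 𝒪[F], p ∈ 𝓂[F] ↔ ‖(p : F)‖ < 1 := fun p => by
    rw [Valued.toNormedField.norm_lt_one_iff]
    have h1 : IsUnit p ↔ valuation F (p : F) = 1 :=
      (Valuation.integer.integers (valuation F)).isUnit_iff_valuation_eq_one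
    change ¬ IsUnit p ↔ valuation F (p : F) < 1
    rw [h1, lt_iff_le_and_ne]
    exact ⟨fun h => ⟨p.2, h⟩, fun h => h.2⟩
  have hext : ∀ p : 𝒪[F], spectralNorm F (AlgebraicClosure F)
      (algebraMap 𝒪[F] (AlgebraicClosure F) p) = ‖(p : F)‖ := fun p =>
    spectralNorm_extends (K := F) (L := AlgebraicClosure F) (p : F)
  refine ⟨spectralNorm F (AlgebraicClosure F), spectralAlgNorm_mul, isNonarchimedean_spectralNorm,
    fun x => ?_, spectralNorm_nonneg, spectralNorm_one, spectralNorm_zero, ?_, ?_⟩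
  · have hx : IsIntegral F x := Algebra.IsIntegral.isIntegral x
    constructor
    · intro h
      -- Spectral norm at most one means that the minimal polynomial has integral coefficients, so
      -- it lifts to a monic polynomial over `𝒪[F]`.
      have h1 := (spectralValue_le_one_iff (minpoly.monic hx)).1 h
      have h2 : minpoly F x ∈ Polynomial.lifts (algebraMap 𝒪[F] F) :=
        (Polynomial.lifts_iff_coeff_lifts _).2 fun n => ⟨⟨_, (hO _).1 (h1 n)⟩, rfl⟩
      obtain ⟨q, hq, -, hqm⟩ := Polynomial.lifts_and_natDegree_eq_and_monic h2 (minpoly.monic hx)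
      refine ⟨q, hqm, ?_⟩
      have h3 := minpoly.aeval F x
      rw [← hq, Polynomial.aeval_map_algebraMap] at h3
      exact h3
    · intro h
      refine (spectralValue_le_one_iff (minpoly.monic hx)).2 fun n => ?_
      rw [minpoly.isIntegrallyClosed_eq_field_fractions' F h, Polynomial.coeff_map]
      exact (hO _).2 ((minpoly 𝒪[F] x).coeff n).2
  · obtain ⟨p, hp⟩ := IsDiscreteValuationRing.exists_irreducible 𝒪[F]
    refine ⟨p, hp.maximalIdeal_eq ▸ Ideal.mem_span_singleton_self p, ?_⟩
    rw [hext, norm_pos_iff]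
    exact fun h => hp.ne_zero (Subtype.ext h)
  · intro p hp
    rw [hext]
    exact (hm p).1 hp

variable (F) in
-- The ideal is the open unit ball of the multiplicative `v`, whence primality. That the ball lies
-- in the radical follows because `x ^ n` is divisible, among integers, by a nonzero `p` of the
-- maximal ideal of `F` as soon as `v (x ^ n) < v p`.
theorem isPrime_maxBar : (maxBar F).IsPrime := by
  obtain ⟨v, hmul, hadd, hint, hnn, h1, h0, ⟨p, hp, hp0⟩, hlt⟩ :=
    exists_absoluteValue_algebraicClosure (F := F)
  have hpow : ∀ x n, v (x ^ n) = v x ^ n := by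
    intro x n
    induction n with
    | zero => simp [h1]
    | succ n ih => rw [pow_succ, hmul, ih, pow_succ]
  have hideal : ∀ x ∈ (𝓂[F]).map (algebraMap 𝒪[F] (IntBar F)), v (x : AlgebraicClosure F) < 1 := by
    intro x hx
    refine Submodule.span_induction ?_ ?_ ?_ ?_ hx
    · rintro _ ⟨a, ha, rfl⟩
      exact hlt a ha
    · simp [h0]
    · intro a b _ _ ha hb
      exact (hadd _ _).trans_lt (max_lt ha hb)
    · intro a b _ hb
      change v ((a : AlgebraicClosure F) * b) < 1
      rw [hmul]
      exact mul_lt_one_of_nonneg_of_lt_one_right ((hint _).2 a.2) (hnn _) hb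
  have key : ∀ x : IntBar F, x ∈ maxBar F ↔ v (x : AlgebraicClosure F) < 1 := by
    intro x
    constructor
    · rintro ⟨n, hn⟩
      have := hideal _ hn
      by_contra hx
      rw [SubmonoidClass.coe_pow, hpow] at this
      exact absurd this (not_lt.2 (one_le_pow₀ (not_lt.1 hx)))
    · intro hx
      obtain ⟨n, hn⟩ := exists_pow_lt_of_lt_one hp0 hx
      refine ⟨n, ?_⟩
      have hp1 : algebraMap 𝒪[F] (AlgebraicClosure F) p ≠ 0 := by
        intro h
        rw [h, h0] at hp0
        exact lt_irrefl _ hp0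
      have hy : IsIntegral 𝒪[F] ((x : AlgebraicClosure F) ^ n *
          (algebraMap 𝒪[F] (AlgebraicClosure F) p)⁻¹) := by
        rw [← hint]
        have h2 : v ((x : AlgebraicClosure F) ^ n * (algebraMap 𝒪[F] (AlgebraicClosure F) p)⁻¹) *
            v (algebraMap 𝒪[F] (AlgebraicClosure F) p) = v (x : AlgebraicClosure F) ^ n := by
          rw [← hmul, mul_assoc, inv_mul_cancel₀ hp1, mul_one, hpow]
        by_contra h
        push Not at h
        have := lt_mul_of_one_lt_left hp0 h
        rw [h2] at this
        exact lt_asymm hn this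
      have e : x ^ n = ⟨_, hy⟩ * algebraMap 𝒪[F] (IntBar F) p := by
        refine Subtype.ext ?_
        change (x : AlgebraicClosure F) ^ n = _ * algebraMap 𝒪[F] (AlgebraicClosure F) p
        rw [mul_assoc, inv_mul_cancel₀ hp1, mul_one]
      rw [e]
      exact Ideal.mul_mem_left _ _ (Ideal.mem_map_of_mem _ hp)
  refine ⟨maxBar_ne_top, fun {x y} hxy => ?_⟩
  rw [key] at hxy ⊢
  rw [key]
  by_contra! h
  rw [MulMemClass.coe_mul, hmul] at hxy
  exact absurd hxy (not_lt.2 (one_le_mul_of_one_le_of_one_le h.1 h.2))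

end Galois

/-! ### Action on the residue field, and a Weil element outside `W_E`. -/

section Galois

variable {F : Type*} [Field F] [ValuativeRel F] [TopologicalSpace F] [IsNonarchimedeanLocalField F]

/-- The action of a Galois automorphism on the integers, as a ring homomorphism. -/
def intHom (σ : AlgebraicClosure F ≃ₐ[F] AlgebraicClosure F) : IntBar F →+* IntBar F where
  toFun := intAct σ
  map_one' := Subtype.ext (map_one σ)
  map_mul' _ _ := Subtype.ext (map_mul σ _ _)
  map_zero' := Subtype.ext (map_zero σ)
  map_add' _ _ := Subtype.ext (map_add σ _ _)

theorem intAct_mem_maxBar (σ : AlgebraicClosure F ≃ₐ[F] AlgebraicClosure F) {x : IntBar F}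
    (hx : x ∈ maxBar F) : intAct σ x ∈ maxBar F := by
  obtain ⟨n, hn⟩ := hx
  refine ⟨n, ?_⟩
  have h1 : intHom σ (x ^ n) ∈ ((𝓂[F]).map (algebraMap 𝒪[F] (IntBar F))).map (intHom σ) :=
    Ideal.mem_map_of_mem _ hn
  have h2 : (intHom σ).comp (algebraMap 𝒪[F] (IntBar F)) = algebraMap 𝒪[F] (IntBar F) :=
    RingHom.ext fun r => Subtype.ext (σ.commutes (r : F))
  rw [Ideal.map_map, h2, map_pow] at h1
  exact h1

/-- The action of a group of Galois automorphisms on the integers of the algebraic closure. -/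
@[reducible] def intAction (G : Subgroup (AlgebraicClosure F ≃ₐ[F] AlgebraicClosure F)) :
    MulSemiringAction G (IntBar F) where
  smul σ x := intAct σ.1 x
  one_smul x := rfl
  mul_smul σ τ x := rfl
  smul_zero σ := Subtype.ext (map_zero σ.1)
  smul_add σ x y := Subtype.ext (map_add σ.1 _ _)
  smul_one σ := Subtype.ext (map_one σ.1)
  smul_mul σ x y := Subtype.ext (map_mul σ.1 _ _)

variable (F) in
/-- The residue field of the algebraic closure. -/
def ResBar : Type _ := IntBar F ⧸ maxBar F

instance : CommRing (ResBar F) := inferInstanceAs (CommRing (IntBar F ⧸ maxBar F))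

instance : IsDomain (ResBar F) :=
  have := isPrime_maxBar F
  inferInstanceAs (IsDomain (IntBar F ⧸ maxBar F))

/-- The reduction map. -/
def resBar : IntBar F →+* ResBar F := Ideal.Quotient.mk (maxBar F)

theorem resBar_surjective : Function.Surjective (resBar (F := F)) := Ideal.Quotient.mk_surjective

theorem resBar_eq_zero {x : IntBar F} : resBar x = 0 ↔ x ∈ maxBar F :=
  Ideal.Quotient.eq_zero_iff_mem

theorem resBar_eq {x y : IntBar F} : resBar x = resBar y ↔ x - y ∈ maxBar F :=
  Ideal.Quotient.eq

/-- The inclusion of the residue field of `F`. -/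
def resIncl : 𝓀[F] →+* ResBar F := Ideal.Quotient.lift 𝓂[F]
  (resBar.comp (algebraMap 𝒪[F] (IntBar F))) fun _ ha =>
    resBar_eq_zero.2 (Ideal.le_radical (Ideal.mem_map_of_mem _ ha))

theorem resIncl_residue (a : 𝒪[F]) :
    resIncl (IsLocalRing.residue 𝒪[F] a) = resBar (algebraMap 𝒪[F] (IntBar F) a) := rfl

/-- The action of a Galois automorphism on the residue field of the algebraic closure. -/
def resAct (σ : AlgebraicClosure F ≃ₐ[F] AlgebraicClosure F) : ResBar F →+* ResBar F :=
  Ideal.quotientMap (maxBar F) (intHom σ) fun _ hx => intAct_mem_maxBar σ hx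

theorem resAct_resBar (σ : AlgebraicClosure F ≃ₐ[F] AlgebraicClosure F) (x : IntBar F) :
    resAct σ (resBar x) = resBar (intAct σ x) := rfl

/-- Automorphisms of `B ⧸ Q` that fix the residues of the invariants of a profinite group `Γ`
acting on `B` lift to `Γ`. -/
theorem exists_lift_quotient {Γ : Type*} [Group Γ] [TopologicalSpace Γ] [IsTopologicalGroup Γ]
    [CompactSpace Γ] [TotallyDisconnectedSpace Γ] {B : Type*} [CommRing B] [MulSemiringAction Γ B]
    (hst : ∀ x : B, IsOpen (MulAction.stabilizer Γ x : Set Γ)) (Q : Ideal B) [Q.IsPrime]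
    (f : (B ⧸ Q) ≃+* (B ⧸ Q))
    (hf : ∀ x : B, (∀ σ : Γ, σ • x = x) → f (Ideal.Quotient.mk Q x) = Ideal.Quotient.mk Q x) :
    ∃ σ : Γ, ∀ x, Ideal.Quotient.mk Q (σ • x) = f (Ideal.Quotient.mk Q x) := by
  let A := FixedPoints.subring B Γ
  let : TopologicalSpace B := ⊥
  have : DiscreteTopology B := ⟨rfl⟩
  have : ContinuousSMul Γ B := continuousSMul_iff_stabilizer_isOpen.2 hst
  have : Algebra.IsInvariant A B Γ := ⟨fun b hb => ⟨⟨b, hb⟩, rfl⟩⟩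
  let P := Q.under A
  let f' : (B ⧸ Q) ≃ₐ[A ⧸ P] (B ⧸ Q) := AlgEquiv.ofRingEquiv (f := f) (by
    rintro ⟨a⟩
    exact hf a.1 a.2)
  obtain ⟨σ, hσ⟩ := Ideal.Quotient.stabilizerHom_surjective_of_profinite (G := Γ) P Q f'
  exact ⟨σ.1, fun x => DFunLike.congr_fun hσ (Ideal.Quotient.mk Q x)⟩

/-- A closed subgroup of the Galois group is profinite and stabilisers of algebraic elements are
open, so `exists_lift_quotient` applies to it. -/
theorem exists_lift_residue [CharZero F] {G : Subgroup (AlgebraicClosure F ≃ₐ[F] AlgebraicClosure F)}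
    (hG : IsClosed (G : Set (AlgebraicClosure F ≃ₐ[F] AlgebraicClosure F)))
    (f : ResBar F ≃+* ResBar F)
    (hf : ∀ x : IntBar F, (∀ σ ∈ G, intAct σ x = x) → f (resBar x) = resBar x) :
    ∃ σ ∈ G, ∀ x, resBar (intAct σ x) = f (resBar x) := by
  have : IsGalois F (AlgebraicClosure F) := {}
  have : CompactSpace G := isCompact_iff_compactSpace.1 hG.isCompact
  have := isPrime_maxBar F
  obtain ⟨σ, hσ⟩ := @exists_lift_quotient G _ _ _ _ _ (IntBar F) _ (intAction G) (fun x => by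
    have h := (stabilizer_isOpen_of_isIntegral (K := F) (x : AlgebraicClosure F)).preimage
      (continuous_subtype_val : Continuous (Subtype.val : G → _))
    convert h using 1
    ext σ
    exact Subtype.ext_iff) (maxBar F) _ f fun x hx => hf x fun σ hσ => hx ⟨σ, hσ⟩
  exact ⟨σ.1, σ.2, hσ⟩

theorem pow_resCard_residue (a : 𝒪[F]) :
    resBar (algebraMap 𝒪[F] (IntBar F) a) ^ resCard F = resBar (algebraMap 𝒪[F] (IntBar F) a) := by
  have := Fintype.ofFinite 𝓀[F]
  rw [← resIncl_residue, ← map_pow, resCard, Nat.card_eq_fintype_card, FiniteField.pow_card]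

/-- Over the residue field of `F`, `X ^ q - X` is the product of `X - a` over all `a`, and `x` is a
root in a domain. -/
theorem exists_residue_of_pow_eq {x : ResBar F} (hx : x ^ resCard F = x) :
    ∃ a : 𝒪[F], x = resBar (algebraMap 𝒪[F] (IntBar F) a) := by
  have := Fintype.ofFinite 𝓀[F]
  have hprod : (∏ a : 𝓀[F], (Polynomial.X - Polynomial.C a)) =
      Polynomial.X ^ Fintype.card 𝓀[F] - Polynomial.X := by
    have h := Polynomial.prod_multiset_X_sub_C_of_monic_of_roots_card_eq
      (p := (Polynomial.X ^ Fintype.card 𝓀[F] - Polynomial.X : Polynomial 𝓀[F]))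
      (Polynomial.monic_X_pow_sub (by
        rw [Polynomial.degree_X]
        exact_mod_cast Fintype.one_lt_card))
      (by
        rw [FiniteField.roots_X_pow_card_sub_X,
          FiniteField.X_pow_card_sub_X_natDegree_eq _ Fintype.one_lt_card]
        rfl)
    rwa [FiniteField.roots_X_pow_card_sub_X] at h
  have h1 := congrArg (Polynomial.eval₂ resIncl x) hprod
  rw [Polynomial.eval₂_finsetProd, Polynomial.eval₂_sub, Polynomial.eval₂_X_pow,
    Polynomial.eval₂_X, ← Nat.card_eq_fintype_card] at h1
  rw [show Nat.card 𝓀[F] = resCard F from rfl, hx, sub_self, Finset.prod_eq_zero_iff] at h1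
  obtain ⟨a, -, ha⟩ := h1
  obtain ⟨a, rfl⟩ := IsLocalRing.residue_surjective a
  rw [Polynomial.eval₂_sub, Polynomial.eval₂_X, Polynomial.eval₂_C, sub_eq_zero] at ha
  exact ⟨a, ha⟩

variable (F) in
/-- The Frobenius automorphism of the residue field of the algebraic closure. -/
theorem exists_frobenius : ∃ f : ResBar F ≃+* ResBar F,
    ∀ x, f x = x ^ resCard F := by
  have := Fintype.ofFinite 𝓀[F]
  obtain ⟨p, hp⟩ := CharP.exists 𝓀[F]
  obtain ⟨r, hpp, hcard⟩ := FiniteField.card 𝓀[F] p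
  have hcp : CharP (ResBar F) p := charP_of_injective_ringHom resIncl.injective p
  have : Fact p.Prime := ⟨hpp⟩
  have hq : resCard F = p ^ (r : ℕ) := by rw [resCard, Nat.card_eq_fintype_card, hcard]
  have hq0 : 0 < resCard F := zero_lt_one.trans (one_lt_resCard (F := F))
  have hF : ∀ x : ResBar F, iterateFrobenius (ResBar F) p r x = x ^ resCard F := fun x => by
    rw [hq, iterateFrobenius_def]
  refine ⟨RingEquiv.ofBijective (iterateFrobenius (ResBar F) p r)
    ⟨iterateFrobenius_inj _ _ _, fun x => ?_⟩, hF⟩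
  obtain ⟨x, rfl⟩ := resBar_surjective x
  -- A `q`-th root of an integral element is integral; this gives surjectivity.
  obtain ⟨y, hy⟩ := IsAlgClosed.exists_pow_nat_eq (x : AlgebraicClosure F) hq0
  have hyi : IsIntegral 𝒪[F] y := IsIntegral.of_pow hq0 (hy ▸ x.2)
  refine ⟨resBar ⟨y, hyi⟩, ?_⟩
  rw [hF, ← map_pow]
  exact congrArg _ (Subtype.ext hy)

/-- Some Galois element `τ` moves the square root, but it need not lie in the Weil group. It is
multiplied by an element `u` of the stabiliser `G` of the root chosen so that `τ * u` acts as
Frobenius on residues. Such a `u` exists because `τ` already acts as Frobenius on the residues of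
the `G`-invariants, the integers of `E`, whether or not `E` is ramified. -/
theorem exists_quadChar_eq_neg_one [CharZero F] (ε : F) (hε : ¬ IsSquare ε) :
    ∃ s : WeilGroup F, quadChar ε hε s = -1 := by
  have hgal : IsGalois F (AlgebraicClosure F) := {}
  have := isPrime_maxBar F
  obtain ⟨τ, hτ⟩ : ∃ τ : AlgebraicClosure F ≃ₐ[F] AlgebraicClosure F,
      τ (sqrtBar ε) ≠ sqrtBar ε := by
    by_contra! h
    obtain ⟨a, ha⟩ := IntermediateField.mem_bot.1
      ((InfiniteGalois.mem_bot_iff_fixed (k := F) (sqrtBar ε)).2 h)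
    refine hε ⟨a, (algebraMap F (AlgebraicClosure F)).injective ?_⟩
    rw [← sqrtBar_sq, ← ha, map_mul, sq]
  have hneg : ∀ g : AlgebraicClosure F ≃ₐ[F] AlgebraicClosure F,
      g (sqrtBar ε) ≠ sqrtBar ε → g (sqrtBar ε) = -sqrtBar ε :=
    fun g hg => (gal_sqrtBar g ε).resolve_left hg
  let G := MulAction.stabilizer (AlgebraicClosure F ≃ₐ[F] AlgebraicClosure F) (sqrtBar ε)
  have hG : IsClosed (G : Set (AlgebraicClosure F ≃ₐ[F] AlgebraicClosure F)) :=
    G.isClosed_of_isOpen (stabilizer_isOpen_of_isIntegral _)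
  have hcoset : ∀ g : AlgebraicClosure F ≃ₐ[F] AlgebraicClosure F, g ∉ G → τ⁻¹ * g ∈ G := by
    intro g hg
    change τ.symm (g (sqrtBar ε)) = sqrtBar ε
    rw [hneg g hg, ← hneg τ hτ, AlgEquiv.symm_apply_apply]
  have hinv : ∀ x : IntBar F, (∀ σ ∈ G, intAct σ x = x) →
      resBar (intAct τ x) = resBar x ^ resCard F := by
    intro x hx
    have hτx : ∀ g, g ∉ G → intAct g x = intAct τ x := by
      intro g hg
      have := hx _ (hcoset g hg)
      conv_rhs => rw [← this]
      exact Subtype.ext (τ.apply_symm_apply _).symm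
    have hmem : ∀ y : IntBar F, (∀ g : AlgebraicClosure F ≃ₐ[F] AlgebraicClosure F,
        intAct g y = y) → ∃ a : 𝒪[F], algebraMap 𝒪[F] (IntBar F) a = y := by
      intro y hy
      obtain ⟨a, ha⟩ := IntermediateField.mem_bot.1 ((InfiniteGalois.mem_bot_iff_fixed (k := F)
        (y : AlgebraicClosure F)).2 fun g => congrArg Subtype.val (hy g))
      have hai : IsIntegral 𝒪[F] a := by
        rw [← isIntegral_algebraMap_iff (algebraMap F (AlgebraicClosure F)).injective, ha]
        exact y.2
      obtain ⟨b, rfl⟩ := IsIntegrallyClosed.algebraMap_eq_of_integral hai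
      exact ⟨b, Subtype.ext ha⟩
    have hττ : intAct τ (intAct τ x) = x := by
      have h2 : τ * τ ∈ G := by
        change τ (τ (sqrtBar ε)) = sqrtBar ε
        rw [hneg τ hτ, map_neg, hneg τ hτ, neg_neg]
      exact hx _ h2
    have hG2 : ∀ g : AlgebraicClosure F ≃ₐ[F] AlgebraicClosure F,
        (intAct g x = x ∧ intAct g (intAct τ x) = intAct τ x) ∨
          (intAct g x = intAct τ x ∧ intAct g (intAct τ x) = x) := by
      intro g
      by_cases hg : g ∈ G
      · refine Or.inl ⟨hx g hg, hτx (g * τ) fun h => hτ ?_⟩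
        have h2 := G.mul_mem (G.inv_mem hg) h
        rw [inv_mul_cancel_left] at h2
        exact h2
      · refine Or.inr ⟨hτx g hg, ?_⟩
        refine hx (g * τ) ?_
        change g (τ (sqrtBar ε)) = sqrtBar ε
        rw [hneg τ hτ, map_neg, hneg g hg, neg_neg]
    obtain ⟨a, ha⟩ := hmem (x + intAct τ x) fun g => by
      have e : intAct g (x + intAct τ x) = intAct g x + intAct g (intAct τ x) :=
        Subtype.ext (map_add g _ _)
      rcases hG2 g with ⟨h1, h2⟩ | ⟨h1, h2⟩
      · rw [e, h1, h2]
      · rw [e, h1, h2, add_comm]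
    obtain ⟨b, hb⟩ := hmem (x * intAct τ x) fun g => by
      have e : intAct g (x * intAct τ x) = intAct g x * intAct g (intAct τ x) :=
        Subtype.ext (map_mul g _ _)
      rcases hG2 g with ⟨h1, h2⟩ | ⟨h1, h2⟩
      · rw [e, h1, h2]
      · rw [e, h1, h2, mul_comm]
    obtain ⟨f, hf⟩ := exists_frobenius F
    set X := resBar x
    set Y := resBar (intAct τ x)
    have ha1 : f X + f Y = X + Y := by
      rw [← map_add, ← map_add, ← ha, hf, pow_resCard_residue]
    have hb1 : f X * f Y = X * Y := by
      rw [← map_mul, ← map_mul, ← hb, hf, pow_resCard_residue]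
    -- The sum and product of `x` and its conjugate lie in `𝒪[F]`, so Frobenius fixes those of `X`
    -- and `Y` and sends `X` to `X` or `Y`. If it fixes `X`, then `X` is the residue of an element
    -- of `𝒪[F]`, which `τ` fixes, so `Y = X` as well.
    have hprod : (f X - X) * (f X - Y) = 0 := by
      linear_combination f X * ha1 - hb1
    rw [← hf]
    rcases mul_eq_zero.1 hprod with h | h
    · rw [sub_eq_zero] at h
      obtain ⟨c, hc⟩ := exists_residue_of_pow_eq (x := X) (by rw [← hf, h])
      rw [h, hc]
      have h1 := intAct_mem_maxBar τ (resBar_eq.1 hc)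
      have e : intAct τ (x - algebraMap 𝒪[F] (IntBar F) c) =
          intAct τ x - algebraMap 𝒪[F] (IntBar F) c := Subtype.ext (by
        change τ ((x : AlgebraicClosure F) - algebraMap F (AlgebraicClosure F) c) =
          τ (x : AlgebraicClosure F) - algebraMap F (AlgebraicClosure F) c
        rw [map_sub, AlgEquiv.commutes])
      rw [e] at h1
      exact resBar_eq.2 h1
    · exact (sub_eq_zero.1 h).symm
  obtain ⟨f, hf⟩ := exists_frobenius F
  let e : ResBar F ≃+* ResBar F :=
    RingEquiv.ofRingHom (resAct τ.symm) (resAct τ)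
      (RingHom.ext (fun x => by
        obtain ⟨x, rfl⟩ := resBar_surjective x
        exact congrArg _ (Subtype.ext (τ.symm_apply_apply _))))
      (RingHom.ext (fun x => by
        obtain ⟨x, rfl⟩ := resBar_surjective x
        exact congrArg _ (Subtype.ext (τ.apply_symm_apply _))))
  have he : ∀ x, e (resBar x) = resBar (intAct τ.symm x) :=
    fun x => rfl
  -- On residues, `u` is Frobenius followed by the inverse of `τ`.
  obtain ⟨u, hu, hux⟩ := exists_lift_residue hG (f.trans e) (by
    intro x hx
    rw [RingEquiv.trans_apply, hf, ← hinv x hx, he]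
    exact congrArg _ (Subtype.ext (τ.symm_apply_apply _)))
  have hacts : ActsAs (τ * u) 1 0 := by
    intro x
    have h1 : resAct τ (resBar (intAct u x)) = resBar x ^ resCard F := by
      rw [hux, RingEquiv.trans_apply, hf]
      exact e.symm_apply_apply (resBar x ^ resCard F)
    rw [resAct_resBar, ← map_pow] at h1
    rw [pow_zero, pow_one, pow_one]
    exact resBar_eq.1 h1
  refine ⟨⟨τ * u, 1, 0, hacts⟩, ?_⟩
  refine if_neg fun h => hτ ?_
  have hu' : u (sqrtBar ε) = sqrtBar ε := hu
  change τ (u (sqrtBar ε)) = sqrtBar ε at h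
  rwa [hu'] at h

end Galois

/-! ### No small subgroups: an open subgroup on which a parameter is trivial. -/

theorem eq_one_of_norm_pow_sub_one_le {A : Type*} [NormedRing A] [NormedSpace ℝ A] {x : A}
    (h : ∀ n : ℕ, ‖x ^ n - 1‖ ≤ 1 / 2) : x = 1 := by
  -- With `y = x ^ n`, `2 (y - 1) = (y ^ 2 - 1) - (y - 1) ^ 2`. While `‖y - 1‖ ≤ 1 / 2`, squaring
  -- therefore multiplies the distance to one by at least `3 / 2`, which cannot go on forever unless
  -- the distance is zero.
  have hstep : ∀ n : ℕ, 3 / 2 * ‖x ^ n - 1‖ ≤ ‖x ^ (2 * n) - 1‖ := by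
    intro n
    have e : (2 : ℝ) • (x ^ n - 1) = (x ^ (2 * n) - 1) - (x ^ n - 1) * (x ^ n - 1) := by
      rw [two_mul, pow_add, two_smul]
      noncomm_ring
    have h1 : 2 * ‖x ^ n - 1‖ ≤ ‖x ^ (2 * n) - 1‖ + ‖x ^ n - 1‖ * ‖x ^ n - 1‖ := by
      have h2 := norm_sub_le (x ^ (2 * n) - 1) ((x ^ n - 1) * (x ^ n - 1))
      rw [← e, norm_smul, Real.norm_ofNat] at h2
      exact h2.trans (add_le_add_right (norm_mul_le _ _) _)
    nlinarith [h n, norm_nonneg (x ^ n - 1)]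
  have hpow : ∀ k : ℕ, (3 / 2 : ℝ) ^ k * ‖x - 1‖ ≤ 1 / 2 := by
    have : ∀ k : ℕ, (3 / 2 : ℝ) ^ k * ‖x - 1‖ ≤ ‖x ^ (2 ^ k) - 1‖ := by
      intro k
      induction k with
      | zero => simp
      | succ k ih =>
        rw [pow_succ', pow_succ' 2, mul_assoc]
        exact (mul_le_mul_of_nonneg_left ih (by norm_num)).trans (hstep _)
    exact fun k => (this k).trans (h _)
  by_contra hx
  have hpos : 0 < ‖x - 1‖ := norm_pos_iff.2 (sub_ne_zero.2 hx)
  obtain ⟨k, hk⟩ := pow_unbounded_of_one_lt (1 / 2 / ‖x - 1‖) (by norm_num : (1 : ℝ) < 3 / 2)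
  rw [div_lt_iff₀ hpos] at hk
  exact absurd (hpow k) (not_le.2 hk)

section

attribute [local instance] Matrix.linftyOpNormedRing Matrix.linftyOpNormedSpace

/-- The entrywise bound makes each row sum at most `1 / 2`, as needed for the operator norm. -/
theorem matrix_eq_one_of_pow {N : ℕ} {x : Matrix (Fin N) (Fin N) ℂ}
    (h : ∀ (n : ℕ) i j, ‖(x ^ n - 1) i j‖ ≤ 1 / (2 * N)) : x = 1 := by
  refine eq_one_of_norm_pow_sub_one_le fun n => ?_
  rw [Matrix.linfty_opNorm_def]
  have : (Finset.univ.sup fun i : Fin N => ∑ j, ‖(x ^ n - 1) i j‖₊) ≤ 1 / 2 := by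
    refine Finset.sup_le fun i _ => ?_
    have hN : (N : NNReal) ≠ 0 := by
      have := i.pos
      positivity
    refine (Finset.sum_le_card_nsmul _ _ (1 / (2 * (N : NNReal))) fun j _ => ?_).trans ?_
    · exact_mod_cast h n i j
    · rw [Finset.card_univ, Fintype.card_fin, nsmul_eq_mul]
      apply le_of_eq
      field_simp
  exact_mod_cast this

end

section

variable {F : Type*} [Field F] [ValuativeRel F] [TopologicalSpace F] [IsNonarchimedeanLocalField F]
  [CharZero F]

/-- Take the elements of degree zero inside an open normal subgroup of the Galois group; by
compactness that subgroup has finite index. -/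
theorem exists_open_subgroup (H : Subgroup (WeilGroup F)) {N : Set (WeilGroup F)}
    (hN : N ∈ nhds (1 : WeilGroup F)) : ∃ I : Subgroup H, IsOpen (I : Set H) ∧
      (∀ i ∈ I, (i : WeilGroup F) ∈ N) ∧ I ≤ (degOn H).ker ∧ I.relIndex (degOn H).ker ≠ 0 := by
  have hgal : IsGalois F (AlgebraicClosure F) := {}
  have hind : Topology.IsInducing
      (fun w : WeilGroup F => (WeilGroup.toGal F w, WeilGroup.deg w)) := ⟨rfl⟩
  rw [hind.nhds_eq_comap, Filter.mem_comap] at hN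
  obtain ⟨S, hS, hSN⟩ := hN
  rw [map_one, map_one, nhds_prod_eq, Filter.mem_prod_iff] at hS
  obtain ⟨A, hA, B, hB, hAB⟩ := hS
  obtain ⟨A', hA', hA'o, hA'1⟩ := mem_nhds_iff.1 hA
  obtain ⟨U, hU⟩ := ProfiniteGrp.exist_openNormalSubgroup_sub_open_nhds_of_one hA'o hA'1
  have hUo : IsOpen (U.toOpenSubgroup.toSubgroup : Set (AlgebraicClosure F ≃ₐ[F] AlgebraicClosure F)) :=
    U.toOpenSubgroup.isOpen
  let f : H →* (AlgebraicClosure F ≃ₐ[F] AlgebraicClosure F) := (WeilGroup.toGal F).comp H.subtype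
  have hcont : Continuous fun h : H => (WeilGroup.toGal F h.1, WeilGroup.deg h.1) :=
    hind.continuous.comp continuous_subtype_val
  have : U.toOpenSubgroup.toSubgroup.FiniteIndex :=
    have := Subgroup.quotient_finite_of_isOpen _ hUo
    Subgroup.finiteIndex_of_finite_quotient
  refine ⟨U.toOpenSubgroup.toSubgroup.comap f ⊓ (degOn H).ker, ?_, ?_, inf_le_right, ?_⟩
  · have h1 := (hUo.prod (isOpen_discrete ({1} : Set (Multiplicative ℤ)))).preimage hcont
    convert h1 using 1
    ext h
    rfl
  · intro i hi
    refine hSN (hAB ⟨hA' (hU hi.1), ?_⟩)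
    have h1 : (i : WeilGroup F).deg = 1 := hi.2
    change (i : WeilGroup F).deg ∈ B
    rw [h1]
    exact mem_of_mem_nhds hB
  · rw [Subgroup.inf_relIndex_right]
    rw [Subgroup.relIndex_comap]
    exact fun h => this.index_ne_zero (Subgroup.index_eq_zero_of_relIndex_eq_zero h)

theorem quad_eq_one_mem_nhds (T : Family F) : {w : WeilGroup F | T.quad w = 1} ∈ nhds 1 := by
  have key : ∀ (ε : F) (hε : ¬ IsSquare ε), {w : WeilGroup F | quadChar ε hε w = 1} ∈ nhds 1 := by
    intro ε hε
    have hcont : Continuous fun h : WeilGroup F => WeilGroup.toGal F h :=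
      continuous_fst.comp (continuous_induced_dom :
        Continuous fun h : WeilGroup F => (WeilGroup.toGal F h, WeilGroup.deg h))
    have h1 := (stabilizer_isOpen_of_isIntegral (K := F) (sqrtBar ε)).preimage hcont
    refine Filter.mem_of_superset (h1.mem_nhds (by simp)) ?_
    intro w hw
    exact if_pos hw
  cases T with
  | quasiEvenOrth ε hε => exact key ε hε
  | oddUnit ε hε => exact key ε hε
  | evenUnit ε hε => exact key ε hε
  | _ => exact Filter.univ_mem' fun w => rfl

theorem LHom.rep_apply {T : Family F} {n : ℕ} (ψ : LHom T n) (x : T.baseWeil × SL(2, ℂ)) :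
    ψ.rep x = Matrix.toLin' (ψ.mat (x.1.1, x.2) * (T.twist n x.1.1).val) := by
  have h : (ψ.toHom (x.1.1, x.2)).right = x.1.1 := ψ.right_eq _
  change Matrix.toLin' (ψ.mat (x.1.1, x.2) * (T.twist n (ψ.toHom (x.1.1, x.2)).right).val) = _
  rw [h]

/-- On a subgroup contained in a small neighbourhood of the identity all powers of a matrix stay
close to one. The neighbourhood also lies in the kernel of the quadratic character, so that the
twist plays no role. -/
theorem exists_open_subgroup_rep_eq_one {T : Family F} {n : ℕ} (ψ : AdmissibleHom T n) :
    ∃ I : Subgroup T.baseWeil, IsOpen (I : Set T.baseWeil) ∧ I ≤ (degOn T.baseWeil).ker ∧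
      I.relIndex (degOn T.baseWeil).ker ≠ 0 ∧ ∀ i ∈ I, ψ.1.rep (i, 1) = 1 := by
  have hmat1 : ψ.1.mat (1, 1) = 1 := by
    change ((ψ.1.toHom 1).left : GL (Fin (T.dim n)) ℂ).val = 1
    rw [map_one]
    rfl
  have hN : {w : WeilGroup F | T.quad w = 1 ∧ ∀ i j,
      ‖(ψ.1.mat (w, 1) - 1) i j‖ ≤ 1 / (2 * T.dim n)} ∈ nhds 1 := by
    refine Filter.inter_mem (quad_eq_one_mem_nhds T) ?_
    refine Filter.eventually_all.2 fun i => Filter.eventually_all.2 fun j => ?_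
    have hc : Continuous fun w => ‖(ψ.1.mat (w, 1) - 1) i j‖ :=
      ((ψ.2.continuous.sub continuous_const).matrix_elem i j).norm
    have h0 : ‖(ψ.1.mat (1, 1) - 1) i j‖ < 1 / (2 * T.dim n) := by
      rw [hmat1, sub_self, Matrix.zero_apply, norm_zero]
      have : (0 : ℝ) < T.dim n := by exact_mod_cast i.pos
      positivity
    filter_upwards [hc.continuousAt.eventually_lt continuousAt_const h0] with w hw using hw.le
  obtain ⟨I, hIo, hIN, hId, hI⟩ := exists_open_subgroup T.baseWeil hN
  refine ⟨I, hIo, hId, hI, fun i hi => ?_⟩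
  have htw : ∀ i ∈ I, ψ.1.rep (i, 1) = Matrix.toLin' (ψ.1.mat (i.1, 1)) := by
    intro i hi
    rw [LHom.rep_apply, Family.twist, MonoidHom.comp_apply, (hIN i hi).1, map_one, Units.val_one,
      mul_one]
  have hx : ψ.1.mat (i.1, 1) = 1 := by
    refine matrix_eq_one_of_pow fun n => ?_
    have h1 : ψ.1.mat (i.1, 1) ^ n = ψ.1.mat ((i ^ n).1, 1) := by
      apply Matrix.toLin'.injective
      rw [Matrix.toLin'_pow, ← htw i hi, ← htw _ (I.pow_mem hi n), ← map_pow, Prod.pow_mk, one_pow]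
    rw [h1]
    exact (hIN _ (I.pow_mem hi n)).2
  rw [htw i hi, hx, Matrix.toLin'_one]
  rfl

end

/-! ### Square roots of matrices and congruence of complex bilinear forms. -/

theorem exists_polynomial_sq {N : ℕ} {A : Matrix (Fin N) (Fin N) ℂ} (hA : IsUnit A) :
    ∃ p : Polynomial ℂ, Polynomial.aeval A p * Polynomial.aeval A p = A := by
  classical
  have hint : IsIntegral ℂ A := Algebra.IsIntegral.isIntegral A
  let m := minpoly ℂ A
  choose r hr using fun z : ℂ => IsAlgClosed.exists_pow_nat_eq z two_pos
  -- Interpolating square roots at the eigenvalues gives a square root of `A` modulo nilpotents in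
  -- the algebra generated by `A`.
  let p₀ := Lagrange.interpolate m.roots.toFinset id r
  have hp₀ : ∀ z ∈ m.roots, p₀.eval z = r z := fun z hz =>
    Lagrange.eval_interpolate_at_node r (v := id) (Set.injOn_id _) (Multiset.mem_toFinset.2 hz)
  let R := Algebra.adjoin ℂ {A}
  let a : R := ⟨A, Algebra.self_mem_adjoin_singleton ℂ A⟩
  have hval : ∀ p : Polynomial ℂ, ((Polynomial.aeval a p : R) : Matrix (Fin N) (Fin N) ℂ) =
      Polynomial.aeval A p := fun p => (Polynomial.aeval_algHom_apply R.val a p).symm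
  let x : R := Polynomial.aeval a p₀
  have hnil : IsNilpotent (x ^ 2 - a) := by
    have hdvd : m ∣ (p₀ ^ 2 - Polynomial.X) ^ Multiset.card m.roots := by
      have h1 : (m.roots.map fun z => Polynomial.X - Polynomial.C z).prod ∣
          (m.roots.map fun _ => p₀ ^ 2 - Polynomial.X).prod := by
        refine Multiset.prod_dvd_prod_of_dvd _ _ fun z hz => Polynomial.dvd_iff_isRoot.2 ?_
        rw [Polynomial.IsRoot, Polynomial.eval_sub, Polynomial.eval_pow, hp₀ z hz, hr,
          Polynomial.eval_X, sub_self]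
      rwa [Multiset.map_const', Multiset.prod_replicate,
        ← (IsAlgClosed.splits m).eq_prod_roots_of_monic (minpoly.monic hint)] at h1
    obtain ⟨q, hk⟩ := hdvd
    refine ⟨Multiset.card m.roots, Subtype.ext ?_⟩
    have h1 : (x ^ 2 - a) ^ Multiset.card m.roots =
        Polynomial.aeval a ((p₀ ^ 2 - Polynomial.X) ^ Multiset.card m.roots) := by
      simp [x]
    rw [h1, hval, hk, map_mul, minpoly.aeval, zero_mul]
    rfl
  have : IsArtinianRing R := IsArtinianRing.of_finite ℂ R
  have hunit : IsUnit a := by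
    refine IsArtinianRing.isUnit_of_mem_nonZeroDivisors (mem_nonZeroDivisors_iff_right.2 fun y hy => ?_)
    refine Subtype.ext (hA.mul_right_cancel ?_)
    rw [ZeroMemClass.coe_zero, zero_mul]
    exact congrArg Subtype.val hy
  have hx : IsUnit x := by
    have h1 : IsUnit (x ^ 2) := by
      have := hnil.isUnit_add_left_of_commute hunit (Commute.all _ _)
      rwa [add_sub_cancel] at this
    exact (isUnit_pow_iff two_ne_zero).1 h1
  let P : Polynomial R := Polynomial.X ^ 2 - Polynomial.C a
  -- Newton's method corrects `x` to an exact root: the derivative `2 * x` is a unit because `A` is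
  -- invertible. The root stays in the algebra generated by `A`, so it is a polynomial in `A`.
  obtain ⟨y, ⟨-, hy⟩, -⟩ := Polynomial.existsUnique_nilpotent_sub_and_aeval_eq_zero (P := P) (x := x)
    (by simpa [P] using hnil) (by
      have h2 : IsUnit (2 : R) := by
        have h3 : (algebraMap ℂ R 2) = 2 := map_ofNat _ 2
        exact h3 ▸ (IsUnit.mk0 (2 : ℂ) two_ne_zero).map (algebraMap ℂ R)
      have h4 : Polynomial.aeval x (Polynomial.derivative P) = 2 * x := by
        simp [P, one_add_one_eq_two]
      rw [h4]
      exact h2.mul hx)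
  have hya : y * y = a := by
    have h1 : y ^ 2 - a = 0 := by simpa [P] using hy
    rw [← sq, sub_eq_zero.1 h1]
  have hyR : (y : Matrix (Fin N) (Fin N) ℂ) ∈ Algebra.adjoin ℂ {A} := y.2
  rw [Algebra.adjoin_singleton_eq_range_aeval] at hyR
  obtain ⟨p, hp⟩ := hyR
  exact ⟨p, by rw [show Polynomial.aeval A p = y from hp]; exact congrArg Subtype.val hya⟩

/-- The matrix `A = S⁻¹ S'` is self-adjoint for `S`, that is `Aᵀ S = S A`, and so is every
polynomial in it. For a polynomial square root `P` of `A` this gives `Pᵀ S P = S P ^ 2 = S'`. -/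
theorem exists_congruent {N : ℕ} {S S' : Matrix (Fin N) (Fin N) ℂ} {c : ℂ} (hS : IsUnit S)
    (hS' : IsUnit S') (h : S.transpose = c • S) (h' : S'.transpose = c • S') (hc : c * c = 1) :
    ∃ P : Matrix (Fin N) (Fin N) ℂ, IsUnit P ∧ P.transpose * S * P = S' := by
  obtain ⟨s, rfl⟩ := hS
  have hA : IsUnit (s⁻¹.val * S') := (s⁻¹).isUnit.mul hS'
  obtain ⟨p, hp⟩ := exists_polynomial_sq hA
  set A := s⁻¹.val * S' with hAdef
  have hsA : s.val * A = S' := by rw [hAdef, ← mul_assoc, Units.mul_inv, one_mul]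
  have hAt : A.transpose * s.val = s.val * A := by
    have h1 : (s.val * A).transpose = c • (s.val * A) := by rw [hsA, h']
    rw [Matrix.transpose_mul, h, Matrix.mul_smul] at h1
    have h2 := congrArg (fun M => c • M) h1
    simpa only [smul_smul, hc, one_smul] using h2
  have hpow : ∀ q : Polynomial ℂ, (Polynomial.aeval A q).transpose * s.val =
      s.val * Polynomial.aeval A q := by
    intro q
    induction q using Polynomial.induction_on' with
    | add p q hp hq => rw [map_add, Matrix.transpose_add, add_mul, mul_add, hp, hq]
    | monomial k z =>
      rw [Polynomial.aeval_monomial, Algebra.algebraMap_eq_smul_one, smul_mul_assoc, one_mul,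
        Matrix.transpose_smul, Matrix.transpose_pow, smul_mul_assoc, mul_smul_comm]
      congr 1
      induction k with
      | zero => simp
      | succ k ih => rw [pow_succ, mul_assoc, hAt, ← mul_assoc, ih, mul_assoc, ← pow_succ]
  refine ⟨Polynomial.aeval A p, ?_, ?_⟩
  · rw [← hp] at hA
    exact (Matrix.isUnit_iff_isUnit_det _).2 (isUnit_of_mul_isUnit_left
      (by rw [← Matrix.det_mul]; exact (Matrix.isUnit_iff_isUnit_det _).1 hA))
  · rw [hpow, mul_assoc, hp, hsA]

/-! ### Unitary and special orthogonal families treated uniformly. -/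

namespace Family

variable {F : Type*} [Field F]

/-- The families of unitary groups. -/
def IsUnitary : Family F → Prop
  | oddUnit _ _ => True
  | evenUnit _ _ => True
  | _ => False

theorem IsUnitary.dualGroup_eq_top {T : Family F} (hT : T.IsUnitary) (n : ℕ) :
    T.dualGroup n = ⊤ := by
  cases T with
  | oddUnit ε hε => rfl
  | evenUnit ε hε => rfl
  | _ => exact hT.elim

theorem dualGroup_le {T : Family F} (hT : ¬ T.IsUnitary) (n : ℕ) :
    T.dualGroup n ≤ isometryGroup (T.form n).val := by
  cases T with
  | oddUnit ε hε => exact (hT trivial).elim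
  | evenUnit ε hε => exact (hT trivial).elim
  | oddOrth => exact le_rfl
  | _ => exact inf_le_left

/-- The families whose dual groups are special orthogonal groups. -/
def IsSpecial : Family F → Prop
  | sympl => True
  | evenOrth => True
  | quasiEvenOrth _ _ => True
  | _ => False

theorem IsSpecial.not_isUnitary {T : Family F} (hT : T.IsSpecial) : ¬ T.IsUnitary := by
  cases T <;> simp_all [IsSpecial, IsUnitary]

theorem mem_dualGroup {T : Family F} (hT : ¬ T.IsUnitary) {n : ℕ} {g : GL (Fin (T.dim n)) ℂ}
    (hg : g ∈ isometryGroup (T.form n).val) (hdet : T.IsSpecial → g.val.det = 1) :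
    g ∈ T.dualGroup n := by
  cases T with
  | oddUnit ε hε => exact (hT trivial).elim
  | evenUnit ε hε => exact (hT trivial).elim
  | oddOrth => exact hg
  | _ => exact ⟨hg, Units.ext (hdet trivial)⟩

theorem IsSpecial.det_eq_one {T : Family F} (hT : T.IsSpecial) {n : ℕ} {g : GL (Fin (T.dim n)) ℂ}
    (hg : g ∈ T.dualGroup n) : g.val.det = 1 := by
  cases T with
  | sympl => exact congrArg Units.val hg.2
  | evenOrth => exact congrArg Units.val hg.2
  | quasiEvenOrth ε hε => exact congrArg Units.val hg.2
  | _ => exact hT.elim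

end Family

variable {F : Type*} [Field F] [ValuativeRel F] [TopologicalSpace F] [IsNonarchimedeanLocalField F]
  [CharZero F]

namespace Family

theorem IsUnitary.mem_baseWeil {T : Family F} (hT : T.IsUnitary) {w : WeilGroup F} :
    w ∈ T.baseWeil ↔ T.quad w = 1 := by
  cases T with
  | oddUnit ε hε => rfl
  | evenUnit ε hε => rfl
  | _ => exact hT.elim

theorem IsUnitary.isGaloisLift_iff {T : Family F} (hT : T.IsUnitary) {s : WeilGroup F} :
    IsGaloisLift T s ↔ T.quad s = -1 := by
  cases T with
  | oddUnit ε hε => rfl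
  | evenUnit ε hε => rfl
  | _ => exact hT.elim

theorem baseWeil_eq_top {T : Family F} (hT : ¬ T.IsUnitary) : T.baseWeil = ⊤ := by
  cases T with
  | oddUnit ε hε => exact (hT trivial).elim
  | evenUnit ε hε => exact (hT trivial).elim
  | _ => rfl

theorem isGaloisLift_iff_eq_one {T : Family F} (hT : ¬ T.IsUnitary) {s : WeilGroup F} :
    IsGaloisLift T s ↔ s = 1 := by
  cases T with
  | oddUnit ε hε => exact (hT trivial).elim
  | evenUnit ε hε => exact (hT trivial).elim
  | _ => rfl

theorem exists_isGaloisLift (T : Family F) : ∃ s, IsGaloisLift T s := by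
  cases T with
  | oddUnit ε hε => exact exists_quadChar_eq_neg_one ε hε
  | evenUnit ε hε => exact exists_quadChar_eq_neg_one ε hε
  | _ => exact ⟨1, rfl⟩

theorem mul_self_mem_baseWeil {T : Family F} {s : WeilGroup F} (hs : IsGaloisLift T s) :
    s * s ∈ T.baseWeil := by
  by_cases hT : T.IsUnitary
  · rw [hT.mem_baseWeil, map_mul, hT.isGaloisLift_iff.1 hs]
    rfl
  · rw [baseWeil_eq_top hT]
    trivial

theorem act_eq_one {T : Family F} (n : ℕ) {w : WeilGroup F} (hw : T.quad w = 1) :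
    T.act n w = 1 := by
  rw [act, MonoidHom.comp_apply, hw, map_one]

theorem twist_eq_one {T : Family F} (n : ℕ) {w : WeilGroup F} (hw : T.quad w = 1) :
    T.twist n w = 1 := by
  rw [twist, MonoidHom.comp_apply, hw, map_one]

theorem IsUnitary.act_apply {T : Family F} (hT : T.IsUnitary) (n : ℕ) {w : WeilGroup F}
    (hw : T.quad w = -1) (g : T.dualGroup n) :
    ((T.act n w g : T.dualGroup n) : GL (Fin (T.dim n)) ℂ) =
      (T.form n)⁻¹ * transposeInv _ g * T.form n := by
  have h1 : T.act n w = T.dualAut n := by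
    rw [act, MonoidHom.comp_apply, hw, signHom_neg_one]
  rw [h1]
  have key : ∀ J : GL (Fin (T.dim n)) ℂ, (MulAut.conj J⁻¹ * transposeInv _ : MulAut _) g.1 =
      J⁻¹ * transposeInv _ g.1 * J := fun J => by
    rw [MulAut.mul_apply, MulAut.conj_apply, inv_inv]
  cases T with
  | oddUnit ε hε => exact key _
  | evenUnit ε hε => exact key _
  | _ => exact hT.elim

theorem twist_mem (T : Family F) (n : ℕ) (w : WeilGroup F) :
    T.twist n w ∈ isometryGroup (T.form n).val := by
  rw [twist, MonoidHom.comp_apply]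
  rcases Int.units_eq_one_or (T.quad w) with h | h
  · rw [h, map_one]
    exact one_mem _
  · rw [h, signHom_neg_one]
    exact T.outerElt_mem n

/-- A transposition has determinant `-1`; hence the standard representation of a non-split even
orthogonal parameter has the quadratic character as determinant. -/
theorem det_twist (T : Family F) (n : ℕ) (w : WeilGroup F) (hT : ¬ T.IsUnitary) :
    (T.twist n w).val.det = ((T.quad w : ℤ) : ℂ) := by
  rw [twist, MonoidHom.comp_apply]
  rcases Int.units_eq_one_or (T.quad w) with h | h
  · rw [h, map_one]
    simp
  · rw [h, signHom_neg_one]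
    cases T with
    | oddUnit ε hε => exact (hT trivial).elim
    | evenUnit ε hε => exact (hT trivial).elim
    | quasiEvenOrth ε hε =>
      change ((Equiv.swap (⟨n, by omega⟩ : Fin (2 * n + 2)) ⟨n + 1, by omega⟩).permMatrix ℂ).det = _
      rw [Matrix.det_permutation, Equiv.Perm.sign_swap (by simp [Fin.ext_iff])]
    | _ =>
      exact absurd (show (1 : ℤˣ) = -1 from h) (by decide)

end Family

/-! ### Invariant pairings attached to an `L`-homomorphism. -/

/-- A nondegenerate pairing of `ρ` with its conjugate under `s`, with the symmetry of the family. -/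
structure IsPairing (T : Family F) (s : WeilGroup F) {V : Type*} [AddCommGroup V] [Module ℂ V]
    (ρ : Representation ℂ (T.baseWeil × SL(2, ℂ)) V) (B : V →ₗ[ℂ] V →ₗ[ℂ] ℂ) : Prop where
  inv : ∀ h g x y, B (ρ (h, g) x) (ρ (MulAut.conjNormal s h, g) y) = B x y
  symm : ∀ s₂ : T.baseWeil, (s₂ : WeilGroup F) = s * s →
    ∀ x y, B x (ρ (s₂, 1) y) = T.formSign * B y x
  nondeg : ∀ y, (∀ x, B x y = 0) → y = 0

/-- The condition on the determinant for the special orthogonal dual groups. -/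
def HasDet (T : Family F) {V : Type*} [AddCommGroup V] [Module ℂ V]
    (ρ : Representation ℂ (T.baseWeil × SL(2, ℂ)) V) : Prop :=
  T.IsSpecial → ∀ x, LinearMap.det (ρ x) = ((T.quad x.1 : ℤ) : ℂ)

namespace LHom

variable {T : Family F} {n : ℕ} (ψ : LHom T n)

/-- The component in the dual group. -/
def elt (x : WeilGroup F × SL(2, ℂ)) : GL (Fin (T.dim n)) ℂ := (ψ.toHom x).left

theorem elt_mul (x y : WeilGroup F × SL(2, ℂ)) :
    ψ.elt (x * y) = ψ.elt x * (T.act n x.1 (ψ.toHom y).left : T.dualGroup n) := by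
  rw [elt, map_mul, SemidirectProduct.mul_left, ψ.right_eq, Subgroup.coe_mul]
  rfl

theorem std_apply (x : T.baseWeil × SL(2, ℂ)) :
    ψ.std x = ψ.elt (x.1.1, x.2) * T.twist n x.1.1 := by
  have h : (ψ.toHom (x.1.1, x.2)).right = x.1.1 := ψ.right_eq _
  change ψ.elt (x.1.1, x.2) * T.twist n (ψ.toHom (x.1.1, x.2)).right = _
  rw [h]

theorem rep_eq_std (x : T.baseWeil × SL(2, ℂ)) : ψ.rep x = Matrix.toLin' (ψ.std x).val := rfl

theorem hasDet_rep : HasDet T ψ.rep := by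
  intro hT x
  rw [rep_eq_std, LinearMap.det_toLin', std_apply, Units.val_mul, Matrix.det_mul,
    T.det_twist n _ hT.not_isUnitary,
    hT.det_eq_one (g := ψ.elt (x.1.1, x.2)) (SetLike.coe_mem _), one_mul]

/-- For the unitary families, with `A = ψ.elt (s, 1)`, the form is `J * A⁻¹`: the twisted product
rule at `s * h * s⁻¹` gives its invariance, and the rule at `s * s` its symmetry. For the others the
form is `J` itself, as the dual group and the twist both preserve it. -/
theorem exists_form {s : WeilGroup F} (hs : IsGaloisLift T s) :
    ∃ S : GL (Fin (T.dim n)) ℂ,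
      (∀ h g, (ψ.std (h, g)).val.transpose * S.val * (ψ.std (MulAut.conjNormal s h, g)).val =
        S.val) ∧
      ∀ s₂ : T.baseWeil, (s₂ : WeilGroup F) = s * s →
        S.val * (ψ.std (s₂, 1)).val = T.formSign • S.val.transpose := by
  by_cases hT : T.IsUnitary
  · have hs1 := hT.isGaloisLift_iff.1 hs
    have hstd : ∀ x : T.baseWeil × SL(2, ℂ), ψ.std x = ψ.elt (x.1.1, x.2) := fun x => by
      have hx : T.quad x.1.1 = 1 := hT.mem_baseWeil.1 x.1.2
      rw [std_apply, Family.twist_eq_one n hx, mul_one]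
    let t := transposeInv (T.dim n)
    let J := T.form n
    have ht : ∀ g : GL (Fin (T.dim n)) ℂ, g.val.transpose * (t g).val = 1 := fun g => by
      change g.val.transpose * (g⁻¹).val.transpose = 1
      rw [← Matrix.transpose_mul, Units.inv_mul, Matrix.transpose_one]
    have hmul : ∀ y, ψ.elt ((s, 1) * y) = ψ.elt (s, 1) * (J⁻¹ * t (ψ.elt y) * J) := fun y => by
      rw [elt_mul, hT.act_apply n hs1]
      rfl
    refine ⟨J * (ψ.elt (s, 1))⁻¹, fun h g => ?_, fun s₂ hs₂ => ?_⟩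
    · have h1 : ψ.elt (s * h.1 * s⁻¹, g) * ψ.elt (s, 1) =
          ψ.elt (s, 1) * (J⁻¹ * t (ψ.elt (h.1, g)) * J) := by
        rw [← hmul, Prod.mk_mul_mk, one_mul]
        have h2 := ψ.elt_mul (s * h.1 * s⁻¹, g) (s, 1)
        have h3 : T.quad (s * h.1 * s⁻¹) = 1 :=
          hT.mem_baseWeil.1 (MulAut.conjNormal s h).2
        rw [Family.act_eq_one n h3, Prod.mk_mul_mk, mul_one, inv_mul_cancel_right] at h2
        exact h2.symm
      have h2 : J * (ψ.elt (s, 1))⁻¹ * ψ.elt (s * h.1 * s⁻¹, g) =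
          t (ψ.elt (h.1, g)) * (J * (ψ.elt (s, 1))⁻¹) := by
        rw [eq_mul_inv_of_mul_eq h1]
        group
      rw [hstd, hstd, mul_assoc, ← Units.val_mul]
      change _ * (J * (ψ.elt (s, 1))⁻¹ * ψ.elt (s * h.1 * s⁻¹, g)).val = _
      rw [h2, Units.val_mul, ← mul_assoc, ht, one_mul]
    · rw [hstd, ← Units.val_mul]
      have h1 : J * (ψ.elt (s, 1))⁻¹ * ψ.elt (s₂.1, 1) = t (ψ.elt (s, 1)) * J := by
        rw [hs₂]
        have h2 := hmul (s, 1)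
        rw [Prod.mk_mul_mk, one_mul] at h2
        rw [h2]
        group
      rw [h1, Units.val_mul, Units.val_mul, Matrix.transpose_mul, T.form_transpose,
        Matrix.mul_smul, smul_smul, T.formSign_mul_self, one_smul]
      rfl
  · have hs1 := (Family.isGaloisLift_iff_eq_one hT).1 hs
    have hmem : ∀ x, ψ.std x ∈ isometryGroup (T.form n).val := fun x => by
      rw [std_apply]
      exact mul_mem (Family.dualGroup_le hT n (SetLike.coe_mem _)) (T.twist_mem n _)
    refine ⟨T.form n, fun h g => ?_, fun s₂ hs₂ => ?_⟩
    · rw [hs1, map_one, MulAut.one_apply]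
      exact hmem _
    · have h1 : s₂ = 1 := Subtype.ext (by rw [hs₂, hs1, one_mul]; rfl)
      rw [h1, Prod.mk_one_one, map_one, Units.val_one, mul_one, T.form_transpose, smul_smul,
        T.formSign_mul_self, one_smul]

theorem exists_isPairing {s : WeilGroup F} (hs : IsGaloisLift T s) :
    ∃ B, IsPairing T s ψ.rep B := by
  obtain ⟨S, h1, h2⟩ := ψ.exists_form hs
  refine ⟨Matrix.toLinearMap₂' ℂ S.val, fun h g x y => ?_, fun s₂ hs₂ x y => ?_, fun y hy => ?_⟩
  · rw [Matrix.toLinearMap₂'_apply', Matrix.toLinearMap₂'_apply', rep_eq_std, rep_eq_std,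
      Matrix.toLin'_apply, Matrix.toLin'_apply, Matrix.mulVec_mulVec, ← Matrix.vecMul_transpose,
      ← Matrix.dotProduct_mulVec, Matrix.mulVec_mulVec, ← mul_assoc, h1]
  · rw [Matrix.toLinearMap₂'_apply', Matrix.toLinearMap₂'_apply', rep_eq_std,
      Matrix.toLin'_apply, Matrix.mulVec_mulVec, h2 s₂ hs₂, Matrix.smul_mulVec, dotProduct_smul,
      Matrix.mulVec_transpose, dotProduct_comm, ← Matrix.dotProduct_mulVec, smul_eq_mul]
  · have h3 : S.val.mulVec y = 0 := by
      refine dotProduct_eq_zero _ fun x => ?_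
      rw [dotProduct_comm, ← Matrix.toLinearMap₂'_apply']
      exact hy x
    have h4 := congrArg (S⁻¹.val.mulVec) h3
    rwa [Matrix.mulVec_mulVec, Units.inv_mul, Matrix.one_mulVec, Matrix.mulVec_zero] at h4

end LHom

/-! ### Recovering an `L`-homomorphism from an invariant pairing. -/

variable {F : Type*} [Field F] [ValuativeRel F] [TopologicalSpace F] [IsNonarchimedeanLocalField F]
  [CharZero F] {T : Family F} {n : ℕ}

/-- The matrices of a representation in a basis. -/
def matrixHom {G V ι : Type*} [Group G] [AddCommGroup V] [Module ℂ V] [Fintype ι] [DecidableEq ι]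
    (b : Module.Basis ι ℂ V) (ρ : Representation ℂ G V) : G →* GL ι ℂ :=
  MonoidHom.toHomUnits ((LinearMap.toMatrixAlgEquiv b : _ →* Matrix ι ι ℂ).comp ρ)

theorem matrixHom_val {G V ι : Type*} [Group G] [AddCommGroup V] [Module ℂ V] [Fintype ι]
    [DecidableEq ι] (b : Module.Basis ι ℂ V) (ρ : Representation ℂ G V) (g : G) :
    (matrixHom b ρ g).val = LinearMap.toMatrix b b (ρ g) := rfl

theorem LHom.nonempty_equiv_rep {V : Type*} [AddCommGroup V] [Module ℂ V]
    {ρ : Representation ℂ (T.baseWeil × SL(2, ℂ)) V} (b : Module.Basis (Fin (T.dim n)) ℂ V)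
    {P : GL (Fin (T.dim n)) ℂ} {ψ : LHom T n} (h : ∀ x, ψ.std x = P⁻¹ * matrixHom b ρ x * P) :
    Nonempty (ρ.Equiv ψ.rep) := by
  have hbij : Function.Bijective (Matrix.toLin' P⁻¹.val) :=
    Function.bijective_iff_has_inverse.2 ⟨Matrix.toLin' P.val, fun v => by
      rw [← Matrix.toLin'_mul_apply, Units.mul_inv, Matrix.toLin'_one, LinearMap.id_apply],
      fun v => by
      rw [← Matrix.toLin'_mul_apply, Units.inv_mul, Matrix.toLin'_one, LinearMap.id_apply]⟩
  refine nonempty_equiv_of_bijective (Matrix.toLin' P⁻¹.val ∘ₗ b.equivFun.toLinearMap)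
    (fun x v => ?_) (hbij.comp b.equivFun.bijective)
  rw [LHom.rep_eq_std, h]
  change P⁻¹.val.mulVec (b.repr (ρ x v)) =
    ((P⁻¹.val * (matrixHom b ρ x).val) * P.val).mulVec (P⁻¹.val.mulVec (b.repr v))
  rw [Matrix.mulVec_mulVec, mul_assoc _ P.val, Units.mul_inv, mul_one, ← Matrix.mulVec_mulVec,
    matrixHom_val, LinearMap.toMatrix_mulVec_repr]

theorem IsPairing.matrix {s : WeilGroup F} {V : Type*} [AddCommGroup V] [Module ℂ V]
    {ρ : Representation ℂ (T.baseWeil × SL(2, ℂ)) V} {B : V →ₗ[ℂ] V →ₗ[ℂ] ℂ} {ι : Type*} [Fintype ι]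
    [DecidableEq ι] (hB : IsPairing T s ρ B) (b : Module.Basis ι ℂ V) :
    ∃ S : GL ι ℂ, (∀ h g, (matrixHom b ρ (h, g)).val.transpose * S.val *
        (matrixHom b ρ (MulAut.conjNormal s h, g)).val = S.val) ∧
      ∀ s₂ : T.baseWeil, (s₂ : WeilGroup F) = s * s →
        S.val * (matrixHom b ρ (s₂, 1)).val = T.formSign • S.val.transpose := by
  have hunit : IsUnit (LinearMap.toMatrix₂ b b B) := by
    rw [Matrix.isUnit_iff_isUnit_det, isUnit_iff_ne_zero]
    intro h
    obtain ⟨v, hv0, hv⟩ := Matrix.exists_mulVec_eq_zero_iff.2 h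
    refine hv0 ?_
    have h1 := hB.nondeg (b.equivFun.symm v) fun x => by
      have h2 := apply_eq_dotProduct_toMatrix₂_mulVec b b B x (b.equivFun.symm v)
      have h3 : ((RingHom.id ℂ : ℂ → ℂ) ∘ b.repr (b.equivFun.symm v)) = v :=
        b.equivFun.apply_symm_apply v
      rw [h2, h3, hv, dotProduct_zero]
    exact b.equivFun.symm.map_eq_zero_iff.1 h1
  obtain ⟨S, hS⟩ := hunit
  refine ⟨S, fun h g => ?_, fun s₂ hs₂ => ?_⟩
  · rw [hS, matrixHom_val, matrixHom_val, ← LinearMap.toMatrix₂_compl₁₂]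
    congr 1
    ext x y
    exact hB.inv h g x y
  · rw [hS, matrixHom_val, ← LinearMap.toMatrix₂_compl₂]
    ext i j
    rw [LinearMap.toMatrix₂_apply, Matrix.smul_apply, Matrix.transpose_apply,
      LinearMap.toMatrix₂_apply, smul_eq_mul]
    exact hB.symm s₂ hs₂ _ _

/-- The `L`-homomorphism with given components in the dual group. -/
def LHom.ofElt (A : WeilGroup F × SL(2, ℂ) → T.dualGroup n)
    (hA : ∀ x y, A (x * y) = A x * T.act n x.1 (A y)) : LHom T n where
  toHom := MonoidHom.mk' (fun x => ⟨A x, x.1⟩) fun x y => by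
    ext1
    · exact hA x y
    · rfl
  right_eq _ := rfl

theorem LHom.std_ofElt (A : WeilGroup F × SL(2, ℂ) → T.dualGroup n)
    (hA : ∀ x y, A (x * y) = A x * T.act n x.1 (A y)) (x : T.baseWeil × SL(2, ℂ)) :
    (LHom.ofElt A hA).std x = A (x.1.1, x.2) * T.twist n x.1.1 :=
  LHom.std_apply _ x

/-- A change of basis carries the form to `J`, so that the representation becomes isometric.
Removing the twist leaves the component in the dual group. -/
theorem exists_lhom_of_pairing_classical (hT : ¬ T.IsUnitary) {V : Type*} [AddCommGroup V]
    [Module ℂ V] {ρ : Representation ℂ (T.baseWeil × SL(2, ℂ)) V}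
    (b : Module.Basis (Fin (T.dim n)) ℂ V) {B : V →ₗ[ℂ] V →ₗ[ℂ] ℂ} (hB : IsPairing T 1 ρ B)
    (hdet : HasDet T ρ) : ∃ ψ : LHom T n, Nonempty (ρ.Equiv ψ.rep) := by
  obtain ⟨S, h1, h2⟩ := hB.matrix b
  have hsymm := h2 1 (one_mul 1).symm
  rw [Prod.mk_one_one, map_one, Units.val_one, mul_one] at hsymm
  obtain ⟨Q, ⟨P, rfl⟩, hP⟩ := exists_congruent S.isUnit (T.form n).isUnit (c := T.formSign)
    (by
      conv_rhs => rw [hsymm]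
      rw [smul_smul, T.formSign_mul_self, one_smul]) (T.form_transpose n) T.formSign_mul_self
  have hmem : ∀ w : WeilGroup F, w ∈ T.baseWeil := fun w => by
    rw [Family.baseWeil_eq_top hT]
    trivial
  let R : WeilGroup F × SL(2, ℂ) →* GL (Fin (T.dim n)) ℂ :=
    { toFun := fun x => P⁻¹ * matrixHom b ρ (⟨x.1, hmem x.1⟩, x.2) * P
      map_one' := by
        have : ((⟨(1 : WeilGroup F × SL(2, ℂ)).1, hmem _⟩, (1 : WeilGroup F × SL(2, ℂ)).2) :
          T.baseWeil × SL(2, ℂ)) = 1 := rfl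
        rw [this, map_one]
        group
      map_mul' := fun x y => by
        have : ((⟨(x * y).1, hmem _⟩, (x * y).2) : T.baseWeil × SL(2, ℂ)) =
          (⟨x.1, hmem _⟩, x.2) * (⟨y.1, hmem _⟩, y.2) := rfl
        rw [this, map_mul]
        group }
  have hR : ∀ x, R x ∈ isometryGroup (T.form n).val := by
    intro x
    change ((P⁻¹ * matrixHom b ρ (⟨x.1, hmem x.1⟩, x.2) * P).val).transpose * (T.form n).val *
      (P⁻¹ * matrixHom b ρ (⟨x.1, hmem x.1⟩, x.2) * P).val = (T.form n).val
    have h3 := h1 ⟨x.1, hmem x.1⟩ x.2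
    rw [map_one, MulAut.one_apply] at h3
    have h4 : P.val * P⁻¹.val = 1 := P.mul_inv
    have h5 : P⁻¹.val.transpose * P.val.transpose = 1 := by
      rw [← Matrix.transpose_mul, h4, Matrix.transpose_one]
    rw [← hP]
    simp only [Units.val_mul, Matrix.transpose_mul]
    set X := (matrixHom b ρ (⟨x.1, hmem x.1⟩, x.2)).val
    calc _ = P.val.transpose * (X.transpose * ((P⁻¹.val.transpose * P.val.transpose) *
          S.val * (P.val * P⁻¹.val)) * X) * P.val := by simp only [mul_assoc]
      _ = _ := by rw [h4, h5, one_mul, mul_one, h3]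
  -- The determinants of `R x` and of the twist are both the quadratic character when the dual group
  -- is special orthogonal, and cancel.
  have hA : ∀ x, R x * (T.twist n x.1)⁻¹ ∈ T.dualGroup n := by
    intro x
    refine Family.mem_dualGroup hT (mul_mem (hR x) (inv_mem (T.twist_mem n _))) fun hS => ?_
    have h3 : (R x).val.det = (T.twist n x.1).val.det := by
      rw [T.det_twist n _ hT]
      change (P⁻¹.val * (matrixHom b ρ (⟨x.1, hmem x.1⟩, x.2)).val * P.val).det = _
      rw [Matrix.det_mul_right_comm, Units.inv_mul, one_mul, matrixHom_val, LinearMap.det_toMatrix]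
      exact hdet hS _
    rw [Units.val_mul, Matrix.det_mul, h3, ← Matrix.det_mul, Units.mul_inv, Matrix.det_one]
  refine ⟨LHom.ofElt (fun x => ⟨R x * (T.twist n x.1)⁻¹, hA x⟩) fun x y => Subtype.ext ?_,
    LHom.nonempty_equiv_rep (P := P) b fun x => ?_⟩
  · rw [Subgroup.coe_mul, T.act_eq n (hmem _)]
    change R (x * y) * (T.twist n (x.1 * y.1))⁻¹ = R x * (T.twist n x.1)⁻¹ *
      (T.twist n x.1 * (R y * (T.twist n y.1)⁻¹) * (T.twist n x.1)⁻¹)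
    rw [map_mul, map_mul]
    group
  · rw [LHom.std_ofElt]
    change R (x.1.1, x.2) * (T.twist n x.1.1)⁻¹ * T.twist n x.1.1 = _
    rw [inv_mul_cancel_right]
    rfl

/-- On `W_E` the homomorphism is `R`, and at `s` it has to be `S⁻¹ * J`, inverting the formula of
`LHom.exists_form`; this determines it on the other coset. In checking products, invariance of the
pairing moves `R` past `S⁻¹`, and its symmetry supplies the value at `s * s`. -/
theorem exists_lhom_of_pairing_unitary (hT : T.IsUnitary) {V : Type*} [AddCommGroup V]
    [Module ℂ V] {ρ : Representation ℂ (T.baseWeil × SL(2, ℂ)) V} {s : WeilGroup F}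
    (hs : T.quad s = -1)
    (b : Module.Basis (Fin (T.dim n)) ℂ V) {B : V →ₗ[ℂ] V →ₗ[ℂ] ℂ} (hB : IsPairing T s ρ B) :
    ∃ ψ : LHom T n, Nonempty (ρ.Equiv ψ.rep) := by
  classical
  obtain ⟨S, h1, h2⟩ := hB.matrix b
  let t := transposeInv (T.dim n)
  let J := T.form n
  let R := matrixHom b ρ
  have ht : ∀ g : GL (Fin (T.dim n)) ℂ, (t g).val * g.val.transpose = 1 := fun g => by
    change (g⁻¹).val.transpose * g.val.transpose = 1
    rw [← Matrix.transpose_mul, Units.mul_inv, Matrix.transpose_one]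
  have hR1 : ∀ h g, S * R (MulAut.conjNormal s h, g) = t (R (h, g)) * S := fun h g => by
    refine Units.ext ?_
    calc S.val * (R (MulAut.conjNormal s h, g)).val = (t (R (h, g))).val *
          ((R (h, g)).val.transpose * S.val * (R (MulAut.conjNormal s h, g)).val) := by
          rw [← mul_assoc, ← mul_assoc, ht, one_mul]
      _ = (t (R (h, g))).val * S.val := by rw [h1]
  have htJ : (t J).val * J.val = T.formSign • 1 := by
    have h3 := ht J
    rw [T.form_transpose, Matrix.mul_smul] at h3
    rw [← h3, smul_smul, T.formSign_mul_self, one_smul]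
  have hR2 : ∀ s₂ : T.baseWeil, (s₂ : WeilGroup F) = s * s →
      S * R (s₂, 1) = t S⁻¹ * t J * J := fun s₂ hs₂ => by
    refine Units.ext ?_
    rw [mul_assoc, Units.val_mul, Units.val_mul, Units.val_mul, h2 s₂ hs₂, htJ, Matrix.mul_smul,
      mul_one]
    rfl
  have hsign : ∀ w, T.quad w = 1 ∨ T.quad w = -1 := fun w => Int.units_eq_one_or _
  have hne : (-1 : ℤˣ) ≠ 1 := by decide
  let A : WeilGroup F × SL(2, ℂ) → GL (Fin (T.dim n)) ℂ := fun x =>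
    if h : T.quad x.1 = 1 then R (⟨x.1, hT.mem_baseWeil.2 h⟩, x.2)
    else R (⟨x.1 * s⁻¹, hT.mem_baseWeil.2 (by
      rw [map_mul, map_inv, hs, (hsign x.1).resolve_left h]; rfl)⟩, x.2) * S⁻¹ * J
  have hA1 : ∀ x (h : T.quad x.1 = 1), A x = R (⟨x.1, hT.mem_baseWeil.2 h⟩, x.2) :=
    fun x h => dif_pos h
  have hA2 : ∀ (x : T.baseWeil) (g : SL(2, ℂ)), A (x.1 * s, g) = R (x, g) * S⁻¹ * J := by
    intro x g
    have h3 : T.quad x.1 = 1 := hT.mem_baseWeil.1 x.2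
    have h4 : ¬ T.quad (x.1 * s) = 1 := by rw [map_mul, h3, hs]; exact hne
    refine (dif_neg h4).trans ?_
    congr 4
    exact Subtype.ext (mul_inv_cancel_right _ _)
  have hA1' : ∀ (x : T.baseWeil) (g : SL(2, ℂ)), A (x.1, g) = R (x, g) :=
    fun x g => hA1 _ (hT.mem_baseWeil.1 x.2)
  have hcases : ∀ x : WeilGroup F × SL(2, ℂ), (∃ a : T.baseWeil, ∃ g, x = (a.1, g)) ∨
      ∃ a : T.baseWeil, ∃ g, x = (a.1 * s, g) := by
    intro x
    rcases hsign x.1 with h | h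
    · exact Or.inl ⟨⟨x.1, hT.mem_baseWeil.2 h⟩, x.2, rfl⟩
    · refine Or.inr ⟨⟨x.1 * s⁻¹, hT.mem_baseWeil.2 ?_⟩, x.2, ?_⟩
      · rw [map_mul, map_inv, hs, h]
        rfl
      · rw [inv_mul_cancel_right]
  have hquad : ∀ a : T.baseWeil, T.quad a.1 = 1 := fun a => hT.mem_baseWeil.1 a.2
  have hquad' : ∀ a : T.baseWeil, T.quad (a.1 * s) = -1 := fun a => by
    rw [map_mul, hquad, hs, one_mul]
  have hS : ∀ h g, S⁻¹ * t (R (h, g)) = R (MulAut.conjNormal s h, g) * S⁻¹ := fun h g => by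
    rw [inv_mul_eq_iff_eq_mul, ← mul_assoc, hR1, mul_inv_cancel_right]
  have hmem : ∀ g, g ∈ T.dualGroup n := fun g => by
    rw [hT.dualGroup_eq_top]
    trivial
  refine ⟨LHom.ofElt (fun x => ⟨A x, hmem _⟩)
    fun x y => Subtype.ext ?_, LHom.nonempty_equiv_rep (P := 1) b fun x => ?_⟩
  · rcases hcases x with ⟨a, g, rfl⟩ | ⟨a, g, rfl⟩ <;>
      rcases hcases y with ⟨a', g', rfl⟩ | ⟨a', g', rfl⟩
    · rw [Family.act_eq_one n (hquad a)]
      change A ((a * a' : T.baseWeil).1, g * g') = A _ * A _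
      rw [hA1', hA1', hA1', ← map_mul]
      rfl
    · rw [Family.act_eq_one n (hquad a)]
      change A (a.1 * (a'.1 * s), g * g') = A _ * A _
      rw [← mul_assoc]
      change A ((a * a' : T.baseWeil).1 * s, g * g') = A _ * A _
      rw [hA1', hA2, hA2, ← mul_assoc, ← mul_assoc, ← map_mul]
      rfl
    · rw [Subgroup.coe_mul, hT.act_apply n (hquad' a)]
      have e : a.1 * s * a'.1 = (a * MulAut.conjNormal s a' : T.baseWeil).1 * s := by
        rw [Subgroup.coe_mul, MulAut.conjNormal_apply]
        group
      change A (a.1 * s * a'.1, g * g') = A _ * (J⁻¹ * t (A _) * J)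
      rw [e, hA2, hA2, hA1']
      have h3 : R (a * MulAut.conjNormal s a', g * g') = R (a, g) * R (MulAut.conjNormal s a', g') := by
        rw [← map_mul]
        rfl
      rw [h3]
      have h4 := hS a' g'
      calc _ = R (a, g) * (R (MulAut.conjNormal s a', g') * S⁻¹) * J := by group
        _ = _ := by
          rw [← h4]
          group
    · rw [Subgroup.coe_mul, hT.act_apply n (hquad' a)]
      let s₂ : T.baseWeil := ⟨s * s, hT.mem_baseWeil.2 (by rw [map_mul, hs]; rfl)⟩
      have e : a.1 * s * (a'.1 * s) = (a * MulAut.conjNormal s a' * s₂ : T.baseWeil).1 := by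
        rw [Subgroup.coe_mul, Subgroup.coe_mul, MulAut.conjNormal_apply]
        change _ = _ * (s * s)
        group
      change A (a.1 * s * (a'.1 * s), g * g') = A _ * (J⁻¹ * t (A _) * J)
      rw [e, hA1', hA2, hA2, map_mul, map_mul]
      have h3 : R (a * MulAut.conjNormal s a' * s₂, g * g') =
          R (a, g) * R (MulAut.conjNormal s a', g') * R (s₂, 1) := by
        rw [← map_mul, ← map_mul, Prod.mk_mul_mk, Prod.mk_mul_mk, mul_one]
      rw [h3]
      have h4 := hS a' g'
      have h5 := hR2 s₂ rfl
      calc _ = R (a, g) * (R (MulAut.conjNormal s a', g') * S⁻¹) * (S * R (s₂, 1)) := by group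
        _ = _ := by
          rw [← h4, h5]
          group
  · have hx := hT.mem_baseWeil.1 x.1.2
    rw [LHom.std_ofElt, Family.twist_eq_one n hx, mul_one, inv_one, one_mul, mul_one]
    exact hA1 _ hx

/-! ### Admissibility, boundedness and conjugacy seen on the standard representation. -/

variable {F : Type*} [Field F] [ValuativeRel F] [TopologicalSpace F] [IsNonarchimedeanLocalField F]
  [CharZero F] {T : Family F} {n : ℕ}

open SLTwo

theorem exists_lhom_of_pairing {s : WeilGroup F} (hs : IsGaloisLift T s) {V : Type*}
    [AddCommGroup V] [Module ℂ V] [FiniteDimensional ℂ V]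
    {ρ : Representation ℂ (T.baseWeil × SL(2, ℂ)) V} (hdim : Module.finrank ℂ V = T.dim n)
    {B : V →ₗ[ℂ] V →ₗ[ℂ] ℂ} (hB : IsPairing T s ρ B) (hdet : HasDet T ρ) :
    ∃ ψ : LHom T n, Nonempty (ρ.Equiv ψ.rep) := by
  have b := Module.finBasisOfFinrankEq ℂ V hdim
  by_cases hT : T.IsUnitary
  · exact exists_lhom_of_pairing_unitary hT (hT.isGaloisLift_iff.1 hs) b hB
  · rw [Family.isGaloisLift_iff_eq_one hT] at hs
    subst hs
    exact exists_lhom_of_pairing_classical hT b hB hdet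

theorem isOpen_baseWeil (T : Family F) : IsOpen (T.baseWeil : Set (WeilGroup F)) := by
  refine Subgroup.isOpen_of_mem_nhds _ (g := 1) ?_
  by_cases hT : T.IsUnitary
  · filter_upwards [quad_eq_one_mem_nhds T] with w hw using hT.mem_baseWeil.2 hw
  · rw [Family.baseWeil_eq_top hT]
    exact Filter.univ_mem

namespace LHom

theorem mat_eq (ψ : LHom T n) (x : WeilGroup F × SL(2, ℂ)) : ψ.mat x = (ψ.elt x).val := rfl

theorem std_eq_one_of_rep {ψ : LHom T n} {x : T.baseWeil × SL(2, ℂ)} (h : ψ.rep x = 1) :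
    ψ.std x = 1 := by
  refine Units.ext (Matrix.toLin'.injective ?_)
  rw [Units.val_one, Matrix.toLin'_one]
  exact h

/-- `W_K` is open in `W_F` and the twist is trivial near the identity, so `ψ` is trivial in the dual
group near the identity, and translation makes it locally constant. -/
theorem continuous_mat {ψ : LHom T n} {I : Subgroup T.baseWeil} (hIo : IsOpen (I : Set T.baseWeil))
    (hI : ∀ i ∈ I, ψ.rep (i, 1) = 1) : Continuous fun w : WeilGroup F => ψ.mat (w, 1) := by
  have hN : {w : WeilGroup F | ψ.elt (w, 1) = 1} ∈ nhds 1 := by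
    have h1 : (Subtype.val '' (I : Set T.baseWeil) : Set (WeilGroup F)) ∈ nhds 1 :=
      ((isOpen_baseWeil T).isOpenMap_subtype_val _ hIo).mem_nhds ⟨1, I.one_mem, rfl⟩
    filter_upwards [h1, quad_eq_one_mem_nhds T] with w hw hq
    obtain ⟨i, hi, rfl⟩ := hw
    have h2 := std_eq_one_of_rep (hI i hi)
    rwa [std_apply, Family.twist_eq_one n hq, mul_one] at h2
  refine continuous_iff_continuousAt.2 fun w => ?_
  refine ContinuousAt.congr (f := fun _ => ψ.mat (w, 1)) continuousAt_const ?_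
  have hmem : (fun x => w⁻¹ * x) ⁻¹' {w : WeilGroup F | ψ.elt (w, 1) = 1} ∈ nhds w :=
    (continuous_const_mul w⁻¹).continuousAt.preimage_mem_nhds (by rwa [inv_mul_cancel])
  filter_upwards [hmem] with x hx
  have e : (x, (1 : SL(2, ℂ))) = (w, 1) * (w⁻¹ * x, 1) := by
    rw [Prod.mk_mul_mk, mul_one, mul_inv_cancel_left]
  have hx' : (ψ.toHom (w⁻¹ * x, 1)).left = 1 := Subtype.ext hx
  rw [mat_eq, mat_eq, e, elt_mul, hx', map_one, OneMemClass.coe_one, mul_one]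

theorem mat_one_eq (ψ : LHom T n) (g : SL(2, ℂ)) : ψ.mat (1, g) = LinearMap.toMatrix' (ψ.rep (1, g)) := by
  rw [rep_eq_std, LinearMap.toMatrix'_toLin', std_apply]
  simp [mat_eq]

theorem exists_mvPolynomial {ψ : LHom T n} (h : IsPolyFun fun g => ψ.rep (1, g)) :
    ∃ P : Fin (T.dim n) → Fin (T.dim n) → MvPolynomial (Fin 2 × Fin 2) ℂ,
      ∀ (g : SL(2, ℂ)) (i j : Fin (T.dim n)),
        ψ.mat (1, g) i j = MvPolynomial.eval (fun p => g.val p.1 p.2) (P i j) := by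
  have h1 : ∀ i j, ∃ P : MvPolynomial (Fin 2 × Fin 2) ℂ, ∀ g : SL(2, ℂ),
      ψ.mat (1, g) i j = MvPolynomial.eval (fun p => g.val p.1 p.2) P := fun i j => by
    obtain ⟨P, hP⟩ := h ((Matrix.entryLinearMap ℂ ℂ i j) ∘ₗ LinearMap.toMatrix'.toLinearMap)
    exact ⟨P, fun g => by rw [← hP, mat_one_eq]; rfl⟩
  choose P hP using h1
  exact ⟨P, fun g i j => hP i j g⟩

theorem IsAdmissible.isPolyFun {ψ : LHom T n} (h : ψ.IsAdmissible) :
    IsPolyFun fun g => ψ.rep (1, g) := by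
  obtain ⟨P, hP⟩ := h.algebraic
  intro f
  refine ⟨∑ i, ∑ j, MvPolynomial.C (f (Matrix.toLin' (Matrix.single i j 1))) * P i j, fun g => ?_⟩
  have h1 : ψ.rep (1, g) = ∑ i, ∑ j, ψ.mat (1, g) i j • Matrix.toLin' (Matrix.single i j 1) := by
    have h2 : Matrix.toLin' (ψ.mat (1, g)) = ψ.rep (1, g) := by rw [mat_one_eq, Matrix.toLin'_toMatrix']
    rw [← h2]
    conv_lhs => rw [Matrix.matrix_eq_sum_single (ψ.mat (1, g))]
    simp only [map_sum, ← map_smul, Matrix.smul_single, smul_eq_mul, mul_one]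
  change f (ψ.rep (1, g)) = _
  rw [h1]
  simp only [map_sum, map_smul, map_mul, MvPolynomial.eval_C, ← hP, smul_eq_mul, mul_comm]

/-- Passing from `std` to `mat` costs at most right multiplication by one fixed matrix: the value at
a representative of the other coset of `W_E` for the unitary families, the inverse of the outer
element otherwise. -/
theorem isBounded_of_rep {ψ : LHom T n}
    (h : ∃ C : ℝ, ∀ (w : T.baseWeil) i j, ‖(ψ.std (w, 1)).val i j‖ ≤ C) : ψ.IsBounded := by
  obtain ⟨C, hC⟩ := h
  have key : ∀ g : GL (Fin (T.dim n)) ℂ, ∃ D : ℝ, ∀ (w : T.baseWeil) i j,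
      ‖((ψ.std (w, 1)).val * g.val) i j‖ ≤ D := by
    intro g
    refine ⟨∑ i : Fin (T.dim n), ∑ j : Fin (T.dim n), C * ‖g.val i j‖, fun w i j => ?_⟩
    have hC0 : 0 ≤ C := (norm_nonneg _).trans (hC w i j)
    rw [Matrix.mul_apply]
    refine (norm_sum_le _ _).trans ?_
    refine Finset.sum_le_sum fun k _ => ?_
    rw [norm_mul]
    refine (mul_le_mul_of_nonneg_right (hC w i k) (norm_nonneg _)).trans ?_
    exact Finset.single_le_sum (f := fun j => C * ‖g.val k j‖) (fun j _ => by positivity)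
      (Finset.mem_univ j)
  by_cases hT : T.IsUnitary
  · obtain ⟨s, hs⟩ := T.exists_isGaloisLift
    have hs1 := hT.isGaloisLift_iff.1 hs
    obtain ⟨D, hD⟩ := key (ψ.elt (s, 1))
    have hstd : ∀ w : T.baseWeil, ψ.std (w, 1) = ψ.elt (w.1, 1) := fun w => by
      rw [std_apply, Family.twist_eq_one n (hT.mem_baseWeil.1 w.2), mul_one]
    refine ⟨max C D, fun w i j => ?_⟩
    rcases Int.units_eq_one_or (T.quad w) with h | h
    · have h1 := hC ⟨w, hT.mem_baseWeil.2 h⟩ i j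
      rw [hstd] at h1
      exact h1.trans (le_max_left _ _)
    · have hw : T.quad (w * s⁻¹) = 1 := by
        rw [map_mul, map_inv, h, hs1]
        rfl
      have h1 := hD ⟨w * s⁻¹, hT.mem_baseWeil.2 hw⟩ i j
      rw [hstd, ← Units.val_mul] at h1
      have h2 := ψ.elt_mul (w * s⁻¹, 1) (s, 1)
      rw [Prod.mk_mul_mk, mul_one, inv_mul_cancel_right, Family.act_eq_one n hw] at h2
      rw [mat_eq, h2]
      exact h1.trans (le_max_right _ _)
  · have hmem : ∀ w : WeilGroup F, w ∈ T.baseWeil := fun w => by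
      rw [Family.baseWeil_eq_top hT]
      trivial
    obtain ⟨D, hD⟩ := key (T.outerElt n)⁻¹
    refine ⟨max C D, fun w i j => ?_⟩
    have h0 : ψ.elt (w, 1) = ψ.std (⟨w, hmem w⟩, 1) * (T.twist n w)⁻¹ := by
      rw [std_apply, mul_inv_cancel_right]
    rw [mat_eq, h0]
    rcases Int.units_eq_one_or (T.quad w) with h | h
    · rw [Family.twist_eq_one n h, inv_one, mul_one]
      exact (hC _ i j).trans (le_max_left _ _)
    · rw [Family.twist, MonoidHom.comp_apply, h, signHom_neg_one, Units.val_mul]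
      exact (hD _ i j).trans (le_max_right _ _)

end LHom

/-- The conjugating element `g` may lie over some `w` outside `W_K`. As both homomorphisms lie over
`W_F`, `w` is central there, so `g` times the inverse of the value of `ψ` at `w` still conjugates
`ψ` to `ψ'` and now lies in the dual group. -/
theorem nonempty_equiv_of_conj {ψ ψ' : AdmissibleHom T n} (h : ψ ≈ ψ') :
    Nonempty (ψ'.1.rep.Equiv ψ.1.rep) := by
  obtain ⟨g, hg⟩ := h
  have hcent : ∀ w : WeilGroup F, g.right * w * g.right⁻¹ = w := fun w => by
    have h1 := congrArg SemidirectProduct.right (hg (w, 1))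
    rw [SemidirectProduct.mul_right, SemidirectProduct.mul_right, SemidirectProduct.inv_right,
      ψ.1.right_eq, ψ'.1.right_eq] at h1
    exact h1.symm
  let k := g * (ψ.1.toHom (g.right, 1))⁻¹
  have hk1 : k.right = 1 := by
    rw [SemidirectProduct.mul_right, SemidirectProduct.inv_right, ψ.1.right_eq, mul_inv_cancel]
  have hk : ∀ x, ψ'.1.toHom x = k * ψ.1.toHom x * k⁻¹ := by
    intro x
    have h1 : ψ'.1.toHom x = g * ψ.1.toHom ((g.right, 1)⁻¹ * x * (g.right, 1)) * g⁻¹ := by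
      rw [← hg]
      congr 1
      refine Prod.ext ?_ ?_
      · change x.1 = g.right⁻¹ * x.1 * g.right
        have := hcent x.1
        rw [mul_inv_eq_iff_eq_mul] at this
        rw [mul_assoc, ← this, inv_mul_cancel_left]
      · change x.2 = 1⁻¹ * x.2 * 1
        rw [inv_one, one_mul, mul_one]
    rw [h1, map_mul, map_mul, map_inv]
    simp only [k]
    group
  let K : T.baseWeil.comap (SemidirectProduct.rightHom : T.LGroup n →* WeilGroup F) :=
    ⟨k, by
      change k.right ∈ T.baseWeil
      rw [hk1]
      exact one_mem _⟩
  have hstd : ∀ x, ψ'.1.std x = T.stdHom n K * ψ.1.std x * (T.stdHom n K)⁻¹ := by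
    intro x
    change T.stdHom n _ = T.stdHom n K * T.stdHom n _ * _
    rw [← map_inv, ← map_mul, ← map_mul]
    congr 1
    exact Subtype.ext (hk _)
  refine LHom.nonempty_equiv_rep (P := T.stdHom n K) (Pi.basisFun ℂ _) fun x => ?_
  have h1 : matrixHom (Pi.basisFun ℂ _) ψ'.1.rep x = ψ'.1.std x := Units.ext (by
    rw [matrixHom_val, LinearMap.toMatrix_eq_toMatrix', LHom.rep_eq_std, LinearMap.toMatrix'_toLin'])
  rw [h1, hstd]
  group

/-! ### Pairings on graded spaces, and the splitting by the sign of the degree. -/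

section GradedPairing

variable {ι : Type*} {W : ι → Type*} [∀ i, AddCommGroup (W i)] [∀ i, Module ℂ (W i)]

/-- Restriction of a family to the indices with property `p`. -/
def restrictPi (p : ι → Prop) : (∀ i, W i) →ₗ[ℂ] ∀ i : {i // p i}, W i :=
  LinearMap.pi fun i => LinearMap.proj i.1

open Classical in
/-- Extension by zero of a family given on the indices with property `p`. -/
def extendPi (p : ι → Prop) : (∀ i : {i // p i}, W i) →ₗ[ℂ] ∀ i, W i :=
  LinearMap.pi fun i => if h : p i then LinearMap.proj (⟨i, h⟩ : {i // p i}) else 0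

variable {p : ι → Prop}

theorem restrictPi_apply (x : ∀ i, W i) (i : {i // p i}) : restrictPi p x i = x i := rfl

theorem extendPi_apply (x : ∀ i : {i // p i}, W i) {i : ι} (h : p i) :
    extendPi p x i = x ⟨i, h⟩ := by
  simp [extendPi, h]

theorem extendPi_apply_of_not (x : ∀ i : {i // p i}, W i) {i : ι} (h : ¬ p i) :
    extendPi p x i = 0 := by
  simp [extendPi, h]

theorem restrictPi_extendPi (x : ∀ i : {i // p i}, W i) : restrictPi p (extendPi p x) = x :=
  funext fun i => extendPi_apply x i.2

theorem piRep_extendPi {G : Type*} [Group G] (ρ : ∀ i, Representation ℂ G (W i)) (g : G)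
    (x : ∀ i : {i // p i}, W i) :
    piRep ρ g (extendPi p x) = extendPi p (piRep (fun i : {i // p i} => ρ i) g x) := by
  funext i
  rw [piRep_apply]
  by_cases h : p i
  · rw [extendPi_apply x h, extendPi_apply _ h, piRep_apply]
  · rw [extendPi_apply_of_not x h, extendPi_apply_of_not _ h, map_zero]

variable [Fintype ι]

theorem finrank_restrict [∀ i, FiniteDimensional ℂ (W i)] [DecidablePred p] :
    Module.finrank ℂ (∀ i : {i // p i}, W i) =
      ∑ i, if p i then Module.finrank ℂ (W i) else 0 := by
  rw [Module.finrank_pi_fintype, ← Finset.sum_filter]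
  exact (Finset.sum_subtype _ (fun i => by simp) fun i => Module.finrank ℂ (W i)).symm

variable [DecidableEq ι] {B : (∀ i, W i) →ₗ[ℂ] (∀ i, W i) →ₗ[ℂ] ℂ} {t : ι → ℝ}

theorem pairing_eq_zero_of_support
    (hB : ∀ i j, t i + t j ≠ 0 → ∀ a b, B (Pi.single i a) (Pi.single j b) = 0) {x y : ∀ i, W i}
    (h : ∀ i j, t i + t j = 0 → x i = 0 ∨ y j = 0) : B x y = 0 := by
  rw [← Finset.univ_sum_single x, ← Finset.univ_sum_single y, map_sum]
  refine Finset.sum_eq_zero fun j _ => ?_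
  rw [map_sum, LinearMap.sum_apply]
  refine Finset.sum_eq_zero fun i _ => ?_
  by_cases hij : t i + t j = 0
  · rcases h i j hij with h | h <;> simp [h]
  · exact hB i j hij _ _

/-- The components of degree zero and of positive degree, together with the pairing against the
vectors of positive degree. -/
def splitMap (t : ι → ℝ) (B : (∀ i, W i) →ₗ[ℂ] (∀ i, W i) →ₗ[ℂ] ℂ) :
    (∀ i, W i) →ₗ[ℂ] (∀ i : {i // t i = 0}, W i) ×
      (∀ i : {i // 0 < t i}, W i) × Module.Dual ℂ (∀ i : {i // 0 < t i}, W i) :=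
  (restrictPi _).prod ((restrictPi _).prod (B.compl₂ (extendPi fun i => 0 < t i)))

/-- A vector of the kernel has only components of negative degree, which pair nontrivially only with
positive degree; that pairing vanishes too. -/
theorem splitMap_injective
    (hB : ∀ i j, t i + t j ≠ 0 → ∀ a b, B (Pi.single i a) (Pi.single j b) = 0)
    (hnd : ∀ x, (∀ y, B x y = 0) → x = 0) : Function.Injective (splitMap t B) := by
  rw [← LinearMap.ker_eq_bot, LinearMap.ker_eq_bot']
  intro x hx
  have h1 : restrictPi (fun i => t i = 0) x = 0 := congrArg Prod.fst hx
  have h2 : restrictPi (fun i => 0 < t i) x = 0 := congrArg (fun z => z.2.1) hx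
  have h3 : ∀ y, B x (extendPi (fun i => 0 < t i) y) = 0 := fun y =>
    LinearMap.congr_fun (congrArg (fun z => z.2.2) hx) y
  refine hnd x fun y => ?_
  have h4 : B x (y - extendPi (fun i => 0 < t i) (restrictPi _ y)) = 0 := by
    refine pairing_eq_zero_of_support hB fun i j hij => ?_
    by_cases hj : 0 < t j
    · right
      rw [Pi.sub_apply, extendPi_apply (p := fun i => 0 < t i) _ hj, restrictPi_apply, sub_self]
    · left
      rcases (show 0 ≤ t i by linarith).eq_or_lt with h | h
      · exact congrFun h1 ⟨i, h.symm⟩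
      · exact congrFun h2 ⟨i, h⟩
  rw [map_sub, h3, sub_zero] at h4
  exact h4

/-- Injectivity bounds the negative part by the positive part in dimension. Injectivity for the
opposite grading `-t` gives the reverse bound, so source and target have equal dimension. -/
theorem splitMap_bijective [∀ i, FiniteDimensional ℂ (W i)]
    (hB : ∀ i j, t i + t j ≠ 0 → ∀ a b, B (Pi.single i a) (Pi.single j b) = 0)
    (hnd : ∀ x, (∀ y, B x y = 0) → x = 0) : Function.Bijective (splitMap t B) := by
  classical
  have hi := splitMap_injective hB hnd
  have hi' := splitMap_injective (t := fun i => -t i) (B := B)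
    (fun i j hij => hB i j fun h => hij (by linarith)) hnd
  have h1 := LinearMap.finrank_le_finrank_of_injective hi
  have h2 := LinearMap.finrank_le_finrank_of_injective hi'
  have h0 : Module.finrank ℂ (∀ i, W i) = (∑ i, if t i = 0 then Module.finrank ℂ (W i) else 0) +
      ((∑ i, if 0 < t i then Module.finrank ℂ (W i) else 0) +
        ∑ i, if 0 < -t i then Module.finrank ℂ (W i) else 0) := by
    rw [Module.finrank_pi_fintype, ← Finset.sum_add_distrib, ← Finset.sum_add_distrib]
    refine Finset.sum_congr rfl fun i _ => ?_
    rcases lt_trichotomy (t i) 0 with h | h | h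
    · simp [h, h.ne, h.le]
    · simp [h]
    · simp [h, h.ne', h.le]
  refine ⟨hi, (LinearMap.injective_iff_surjective_of_finrank_eq_finrank ?_).1 hi⟩
  simp only [Module.finrank_prod, Subspace.dual_finrank_eq, finrank_restrict, h0, neg_eq_zero] at h1 h2 ⊢
  omega

theorem finrank_eq_of_pairing [∀ i, FiniteDimensional ℂ (W i)]
    (hB : ∀ i j, t i + t j ≠ 0 → ∀ a b, B (Pi.single i a) (Pi.single j b) = 0)
    (hnd : ∀ x, (∀ y, B x y = 0) → x = 0) : Module.finrank ℂ (∀ i, W i) =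
      Module.finrank ℂ (∀ i : {i // t i = 0}, W i) +
        2 * Module.finrank ℂ (∀ i : {i // 0 < t i}, W i) := by
  rw [(LinearEquiv.ofBijective _ (splitMap_bijective hB hnd)).finrank_eq, Module.finrank_prod,
    Module.finrank_prod, Subspace.dual_finrank_eq, two_mul]

/-- If all degrees were nonpositive, a component of negative degree would be orthogonal to
everything. -/
theorem exists_pos_of_pairing
    (hB : ∀ i j, t i + t j ≠ 0 → ∀ a b, B (Pi.single i a) (Pi.single j b) = 0)
    (hnd : ∀ x, (∀ y, B x y = 0) → x = 0) {i : ι} [Nontrivial (W i)] (hi : t i ≠ 0) :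
    ∃ j, 0 < t j := by
  by_contra! hneg
  obtain ⟨a, ha⟩ := exists_ne (0 : W i)
  have h1 : (Pi.single i a : ∀ i, W i) = 0 := by
    refine hnd _ fun y => pairing_eq_zero_of_support hB fun k j hkj => Or.inl ?_
    refine Pi.single_eq_of_ne ?_ a
    rintro rfl
    have := (hneg k).lt_of_ne hi
    have := hneg j
    linarith
  exact ha (by simpa using congrFun h1 i)

end GradedPairing

/-- The restriction of an invariant pairing to the part of degree zero. -/
theorem IsPairing.restrict {F : Type*} [Field F] [ValuativeRel F] [TopologicalSpace F]
    [IsNonarchimedeanLocalField F] [CharZero F] {T : Family F} {s : WeilGroup F} {ι : Type*}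
    [Fintype ι] [DecidableEq ι] {W : ι → Type*} [∀ i, AddCommGroup (W i)] [∀ i, Module ℂ (W i)]
    {ρ : ∀ i, Representation ℂ (T.baseWeil × SL(2, ℂ)) (W i)}
    {B : (∀ i, W i) →ₗ[ℂ] (∀ i, W i) →ₗ[ℂ] ℂ} (h : IsPairing T s (piRep ρ) B) {t : ι → ℝ}
    (hB : ∀ i j, t i + t j ≠ 0 → ∀ a b, B (Pi.single i a) (Pi.single j b) = 0) :
    IsPairing T s (piRep fun i : {i // t i = 0} => ρ i)
      (B.compl₁₂ (extendPi fun i => t i = 0) (extendPi fun i => t i = 0)) where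
  inv h' g x y := by
    simp only [LinearMap.compl₁₂_apply, ← piRep_extendPi, h.inv]
  symm s₂ hs₂ x y := by
    simp only [LinearMap.compl₁₂_apply, ← piRep_extendPi, h.symm s₂ hs₂]
  nondeg y hy := by
    have h1 : extendPi (fun i => t i = 0) y = 0 := by
      refine h.nondeg _ fun x => ?_
      have h2 : B (x - extendPi (fun i => t i = 0) (restrictPi _ x)) (extendPi _ y) = 0 := by
        refine pairing_eq_zero_of_support hB fun i j hij => ?_
        by_cases hj : t j = 0
        · left
          have hi : t i = 0 := by linarith
          rw [Pi.sub_apply, extendPi_apply (p := fun i => t i = 0) _ hi, restrictPi_apply, sub_self]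
        · exact Or.inr (extendPi_apply_of_not _ hj)
      rw [map_sub, LinearMap.sub_apply, sub_eq_zero] at h2
      exact h2.trans (hy _)
    rw [← restrictPi_extendPi y, h1, map_zero]

/-! ### Bounded vector-valued functions and growth. -/

section Bounded

variable {α V : Type*} [AddCommGroup V] [Module ℂ V]

/-- A function to a complex vector space all of whose coefficients are bounded. -/
def IsBoundedFun (u : α → V) : Prop := ∀ f : Module.Dual ℂ V, ∃ C : ℝ, ∀ x, ‖f (u x)‖ ≤ C

namespace IsBoundedFun

variable {u : α → V} {W : Type*} [AddCommGroup W] [Module ℂ W]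

theorem map (hu : IsBoundedFun u) (L : V →ₗ[ℂ] W) : IsBoundedFun fun x => L (u x) :=
  fun f => hu (f ∘ₗ L)

theorem comp (hu : IsBoundedFun u) {β : Type*} (g : β → α) : IsBoundedFun fun x => u (g x) :=
  fun f => (hu f).imp fun _ hC x => hC (g x)

theorem add {u' : α → V} (hu : IsBoundedFun u) (hu' : IsBoundedFun u') :
    IsBoundedFun fun x => u x + u' x := fun f => by
  obtain ⟨C, hC⟩ := hu f
  obtain ⟨D, hD⟩ := hu' f
  exact ⟨C + D, fun x => by
    rw [map_add]
    exact (norm_add_le _ _).trans (add_le_add (hC x) (hD x))⟩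

theorem sum {ι : Type*} (s : Finset ι) {u : ι → α → V} (h : ∀ i, IsBoundedFun (u i)) :
    IsBoundedFun fun x => ∑ i ∈ s, u i x := by
  classical
  induction s using Finset.induction_on with
  | empty => exact fun f => ⟨0, fun x => by simp⟩
  | insert a s ha ih =>
    simp only [Finset.sum_insert ha]
    exact (h a).add ih

theorem exists_bilin_le [FiniteDimensional ℂ W] (hu : IsBoundedFun u) {v : α → W}
    (hv : IsBoundedFun v) (B : V →ₗ[ℂ] W →ₗ[ℂ] ℂ) : ∃ C : ℝ, ∀ x, ‖B (u x) (v x)‖ ≤ C := by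
  let b := Module.finBasis ℂ W
  choose C hC using fun i => hu (B.flip (b i))
  choose D hD using fun i => hv (b.coord i)
  refine ⟨∑ i, D i * C i, fun x => ?_⟩
  have h1 : B (u x) (v x) = ∑ i, b.coord i (v x) * B (u x) (b i) := by
    conv_lhs => rw [← b.sum_repr (v x)]
    simp only [map_sum, map_smul, smul_eq_mul, Module.Basis.coord_apply]
  rw [h1]
  refine (norm_sum_le _ _).trans (Finset.sum_le_sum fun i _ => ?_)
  rw [norm_mul]
  exact mul_le_mul (hD i x) (hC i x) (norm_nonneg _) ((norm_nonneg _).trans (hD i x))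

end IsBoundedFun

end Bounded

/-- Let `m` tend to plus or minus infinity according to whether `r < 1` or `r > 1`. -/
theorem eq_zero_of_norm_le_mul_zpow {c : ℂ} {C r : ℝ} (hr : 0 < r) (hr1 : r ≠ 1)
    (h : ∀ m : ℤ, ‖c‖ ≤ C * r ^ m) : c = 0 := by
  by_contra hc
  have hc' : 0 < ‖c‖ := norm_pos_iff.2 hc
  have hC : 0 < C := by
    have := h 0
    rw [zpow_zero, mul_one] at this
    linarith
  have key : ∀ x : ℝ, 0 < x → x < 1 → (∀ n : ℕ, ‖c‖ ≤ C * x ^ n) → False := by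
    intro x hx hx1 hx2
    obtain ⟨n, hn⟩ := exists_pow_lt_of_lt_one (div_pos hc' hC) hx1
    rw [lt_div_iff₀ hC] at hn
    linarith [hx2 n]
  rcases lt_or_gt_of_ne hr1 with h1 | h1
  · exact key r hr h1 fun n => by simpa using h n
  · exact key r⁻¹ (inv_pos.2 hr) (inv_lt_one_of_one_lt₀ h1) fun n => by simpa using h (-n)

/-! ### Twists of bounded constituents and their contragredients. -/

section Twist

open SLTwo

variable {F : Type*} [Field F] [ValuativeRel F] [TopologicalSpace F] [IsNonarchimedeanLocalField F]
  {H : Subgroup (WeilGroup F)}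

theorem tensorSym_absTwist {V : Type*} [AddCommGroup V] [Module ℂ V] (t : ℝ)
    (φ : Representation ℂ H V) (k : ℕ) (x : H × SL(2, ℂ)) (y : V ⊗[ℂ] SymSpace k) :
    tensorSym (absTwist t φ) k x y = WeilGroup.absPow t x.1.1 • tensorSym φ k x y := by
  induction y using TensorProduct.induction_on with
  | zero => simp
  | add y z hy hz => rw [map_add, map_add, hy, hz, smul_add]
  | tmul v p => rw [tensorSym_tmul, tensorSym_tmul, absTwist_apply, LinearMap.smul_apply,
      TensorProduct.smul_tmul']

theorem IsIrredBounded.isBoundedFun {d : ℕ} {φ : Representation ℂ H (Fin d → ℂ)}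
    (hφ : IsIrredBounded φ) (v : Fin d → ℂ) : IsBoundedFun fun h => φ h v := by
  obtain ⟨C, hC⟩ := hφ.bounded
  intro f
  refine ⟨∑ i, ∑ j, C * ‖v j‖ * ‖f (Pi.single i 1)‖, fun h => ?_⟩
  have h1 : f (φ h v) = ∑ i, ∑ j, LinearMap.toMatrix' (φ h) i j * v j * f (Pi.single i 1) := by
    have h2 : φ h v = ∑ i, (LinearMap.toMatrix' (φ h)).mulVec v i • Pi.single i (1 : ℂ) := by
      rw [← Matrix.toLin'_apply, Matrix.toLin'_toMatrix']
      exact pi_eq_sum_univ' _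
    rw [h2, map_sum]
    refine Finset.sum_congr rfl fun i _ => ?_
    rw [map_smul, smul_eq_mul, Matrix.mulVec, dotProduct, Finset.sum_mul]
  rw [h1]
  refine (norm_sum_le _ _).trans (Finset.sum_le_sum fun i _ => ?_)
  refine (norm_sum_le _ _).trans (Finset.sum_le_sum fun j _ => ?_)
  rw [norm_mul, norm_mul]
  gcongr
  exact hC h i j

theorem isBoundedFun_tensorSym {d : ℕ} {φ : Representation ℂ H (Fin d → ℂ)}
    (hφ : IsIrredBounded φ) (k : ℕ) (y : (Fin d → ℂ) ⊗[ℂ] SymSpace k) :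
    IsBoundedFun fun h : H => tensorSym φ k (h, 1) y := by
  induction y using TensorProduct.induction_on with
  | zero => exact fun f => ⟨0, fun x => by simp⟩
  | add y z hy hz => simpa only [map_add] using hy.add hz
  | tmul v p =>
    simp only [tensorSym_tmul, map_one, Module.End.one_apply]
    exact (hφ.isBoundedFun v).map ((TensorProduct.mk ℂ _ (SymSpace k)).flip p)

theorem deg_conj (s w : WeilGroup F) : WeilGroup.deg (s * w * s⁻¹) = WeilGroup.deg w := by
  rw [map_mul, map_mul, map_inv, mul_comm s.deg, mul_inv_cancel_right]

theorem absPow_conj (t : ℝ) (s w : WeilGroup F) :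
    WeilGroup.absPow t (s * w * s⁻¹) = WeilGroup.absPow t w := by
  rw [absPow_apply, absPow_apply, deg_conj]

theorem absPow_inv (t : ℝ) (w : WeilGroup F) :
    WeilGroup.absPow t w⁻¹ = WeilGroup.absPow (-t) w := by
  rw [absPow_apply, absPow_apply, map_inv, toAdd_inv]
  push_cast
  rw [mul_neg, neg_mul]

variable [H.Normal]

/-- The contragredient of a twisted tensor product. -/
theorem exists_dual_tensorSym {V : Type*} [AddCommGroup V] [Module ℂ V] [FiniteDimensional ℂ V]
    (φ : Representation ℂ H V) (t : ℝ) (k : ℕ) (s : WeilGroup F) :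
    ∃ E : Module.Dual ℂ V ⊗[ℂ] SymSpace k ≃ₗ[ℂ] Module.Dual ℂ (V ⊗[ℂ] SymSpace k),
      ∀ h g y z, E (tensorSym (absTwist (-t) (conjDual s φ)) k (h, g) y) z =
        E y (tensorSym (absTwist t φ) k (MulAut.conjNormal s h, g)⁻¹ z) := by
  obtain ⟨e, he⟩ := exists_symDual k
  -- The contragredient distributes over the tensor product and `Sym^k` is self-dual. Conjugation by
  -- `s` does not affect the absolute value, while inversion changes the sign of the exponent.
  refine ⟨(TensorProduct.congr (LinearEquiv.refl ℂ _) e).trans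
    (TensorProduct.dualDistribEquiv ℂ V (SymSpace k)), fun h g y z => ?_⟩
  have happ : ∀ (f : Module.Dual ℂ V) (p : SymSpace k) (v : V) (q : SymSpace k),
      ((TensorProduct.congr (LinearEquiv.refl ℂ _) e).trans
        (TensorProduct.dualDistribEquiv ℂ V (SymSpace k))) (f ⊗ₜ p) (v ⊗ₜ q) = f v * e p q :=
    fun f p v q => rfl
  have hpow : WeilGroup.absPow t ((MulAut.conjNormal s h)⁻¹ : H).1 =
      WeilGroup.absPow (-t) h.1 := by
    rw [Subgroup.coe_inv, MulAut.conjNormal_apply, absPow_inv, absPow_conj]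
  rw [tensorSym_absTwist, tensorSym_absTwist, map_smul, map_smul, LinearMap.smul_apply]
  change _ = WeilGroup.absPow t ((MulAut.conjNormal s h)⁻¹ : H).1 • _
  rw [hpow]
  congr 1
  induction y using TensorProduct.induction_on with
  | zero => simp
  | add y y' hy hy' => simp only [map_add, LinearMap.add_apply, hy, hy']
  | tmul f p =>
    induction z using TensorProduct.induction_on with
    | zero => simp
    | add z z' hz hz' => simp only [map_add, hz, hz']
    | tmul v q =>
      rw [tensorSym_tmul, tensorSym_tmul, happ, happ, he]
      rfl

end Twist

/-! ### Orthogonality of constituents by growth. -/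

section Growth

variable {F : Type*} [Field F] [ValuativeRel F] [TopologicalSpace F] [IsNonarchimedeanLocalField F]
  [CharZero F] {T : Family F} {s : WeilGroup F}

theorem piRep_single {G : Type*} [Group G] {ι : Type*} [DecidableEq ι] {W : ι → Type*}
    [∀ i, AddCommGroup (W i)] [∀ i, Module ℂ (W i)] (ρ : ∀ i, Representation ℂ G (W i)) (g : G)
    (i : ι) (a : W i) : piRep ρ g (Pi.single i a) = Pi.single i (ρ i g a) := by
  funext j
  rw [piRep_apply]
  by_cases h : j = i
  · subst h
    rw [Pi.single_eq_same, Pi.single_eq_same]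
  · rw [Pi.single_eq_of_ne h, Pi.single_eq_of_ne h, map_zero]

/-- Constituents whose exponents do not add up to zero are orthogonal. -/
theorem IsPairing.single_eq_zero {ι : Type*} [Fintype ι] [DecidableEq ι] {d : ι → ℕ}
    {φ : ∀ i, Representation ℂ T.baseWeil (Fin (d i) → ℂ)} {t : ι → ℝ} {k : ι → ℕ}
    {B : (∀ i, (Fin (d i) → ℂ) ⊗[ℂ] SLTwo.SymSpace (k i)) →ₗ[ℂ]
      (∀ i, (Fin (d i) → ℂ) ⊗[ℂ] SLTwo.SymSpace (k i)) →ₗ[ℂ] ℂ}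
    (hB : IsPairing T s (piRep fun i => tensorSym (absTwist (t i) (φ i)) (k i)) B)
    (hφ : ∀ i, IsIrredBounded (φ i)) (ht : degOn T.baseWeil = 1 → ∀ i, t i = 0) (i j : ι)
    (hij : t i + t j ≠ 0) (a b) : B (Pi.single i a) (Pi.single j b) = 0 := by
  -- An element of nonzero degree exists, since otherwise `ht` would make both exponents zero.
  obtain ⟨h, hh⟩ : ∃ h, degOn T.baseWeil h ≠ 1 := by
    by_contra! hc
    exact hij (by rw [ht (MonoidHom.ext hc), ht (MonoidHom.ext hc), add_zero])
  obtain ⟨C, hC⟩ := (((isBoundedFun_tensorSym (hφ i) (k i) a).map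
    (LinearMap.single ℂ (fun i => (Fin (d i) → ℂ) ⊗[ℂ] SLTwo.SymSpace (k i)) i))).exists_bilin_le
      (((isBoundedFun_tensorSym (hφ j) (k j) b).map
        (LinearMap.single ℂ (fun i => (Fin (d i) → ℂ) ⊗[ℂ] SLTwo.SymSpace (k i)) j)).comp
        (MulAut.conjNormal s : MulAut T.baseWeil)) B
  set D : ℤ := Multiplicative.toAdd (WeilGroup.deg h.1) with hD
  have hD0 : (D : ℝ) ≠ 0 := by
    intro h0
    exact hh (Int.cast_eq_zero.1 h0)
  have hq1 : (1 : ℝ) < resCard F := by exact_mod_cast one_lt_resCard (F := F)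
  refine eq_zero_of_norm_le_mul_zpow (C := C) (r := (resCard F : ℝ) ^ ((t i + t j) * D))
    (Real.rpow_pos_of_pos resCard_pos _) (fun h1 => ?_) fun m => ?_
  · rw [← Real.rpow_zero (resCard F : ℝ), Real.rpow_right_inj resCard_pos hq1.ne'] at h1
    exact mul_ne_zero hij hD0 h1
  -- Conjugation by `s` preserves degrees, so invariance at `h ^ m` pulls out both twists together,
  -- as one factor with exponent `t i + t j`; the remaining pairing is bounded by `C` independently
  -- of `m`.
  · have h1 := hB.inv (h ^ m) 1 (Pi.single i a) (Pi.single j b)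
    rw [piRep_single, piRep_single, tensorSym_absTwist, tensorSym_absTwist, Pi.single_smul,
      Pi.single_smul, map_smul, map_smul, LinearMap.smul_apply, smul_smul] at h1
    have h2 : WeilGroup.absPow (t j) ((MulAut.conjNormal s (h ^ m) : T.baseWeil)).1 =
        WeilGroup.absPow (t j) (h ^ m : T.baseWeil).1 := by
      rw [MulAut.conjNormal_apply, absPow_conj]
    dsimp only at h1
    rw [h2, mul_comm, ← absPow_add] at h1
    rw [← h1, norm_smul, norm_absPow, mul_comm]
    have h3 : (resCard F : ℝ) ^ ((t i + t j) *
        ((Multiplicative.toAdd (h ^ m : T.baseWeil).1.deg : ℤ) : ℝ)) =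
        ((resCard F : ℝ) ^ ((t i + t j) * D)) ^ m := by
      rw [Subgroup.coe_zpow, map_zpow, toAdd_zpow, ← hD, ← Real.rpow_intCast, ← Real.rpow_mul
        resCard_pos.le]
      congr 1
      push_cast [smul_eq_mul]
      ring
    rw [h3]
    refine mul_le_mul_of_nonneg_right (hC (h ^ m)) (zpow_nonneg (Real.rpow_nonneg ?_ _) _)
    exact resCard_pos.le

end Growth

/-! ### Decomposition of a parameter and its splitting under the pairing. -/

open SLTwo

/-- The minimal polynomial of `b` is squarefree and also annihilates `a`. -/
theorem isSemisimple_of_injective {V W : Type*} [AddCommGroup V] [Module ℂ V] [AddCommGroup W]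
    [Module ℂ W] [FiniteDimensional ℂ W] {a : Module.End ℂ V} {b : Module.End ℂ W} {L : V →ₗ[ℂ] W}
    (hL : Function.Injective L) (h : ∀ v, L (a v) = b (L v)) (hb : b.IsSemisimple) :
    a.IsSemisimple := by
  refine Module.End.isSemisimple_of_squarefree_aeval_eq_zero hb.minpoly_squarefree ?_
  have key : ∀ (p : Polynomial ℂ) v, L (Polynomial.aeval a p v) = Polynomial.aeval b p (L v) := by
    intro p
    induction p using Polynomial.induction_on' with
    | add p q hp hq => intro v; simp only [map_add, LinearMap.add_apply, hp, hq]
    | monomial n c =>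
      intro v
      have hpow : ∀ n : ℕ, L ((a ^ n) v) = (b ^ n) (L v) := by
        intro n
        induction n with
        | zero => rfl
        | succ n ih => rw [pow_succ', pow_succ', Module.End.mul_apply, Module.End.mul_apply, h, ih]
      simp only [Polynomial.aeval_monomial, Module.End.mul_apply, Module.algebraMap_end_apply,
        map_smul, hpow]
  refine LinearMap.ext fun v => hL ?_
  rw [key, minpoly.aeval]
  simp

theorem nonempty_prod_equiv {G V V' W : Type*} [Group G] [AddCommGroup V] [Module ℂ V]
    [AddCommGroup V'] [Module ℂ V'] [AddCommGroup W] [Module ℂ W] {ρ : Representation ℂ G V}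
    {ρ' : Representation ℂ G V'} (e : ρ.Equiv ρ') (σ : Representation ℂ G W) :
    Nonempty ((ρ.prod σ).Equiv (ρ'.prod σ)) :=
  nonempty_equiv_of_linearEquiv (e.toLinearEquiv.prodCongr (LinearEquiv.refl ℂ W)) fun g v =>
    Prod.ext (equiv_apply_rep e g v.1) rfl

variable {F : Type*} [Field F] [ValuativeRel F] [TopologicalSpace F] [IsNonarchimedeanLocalField F]
  [CharZero F] {T : Family F} {s : WeilGroup F} {n : ℕ}

/-- Triviality on an open subgroup, polynomial matrix coefficients and semisimplicity all pass to a
subrepresentation. -/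
theorem LHom.isAdmissible_of_injective (ψ : AdmissibleHom T n) {m : ℕ} {ψ' : LHom T m}
    {L : (Fin (T.dim m) → ℂ) →ₗ[ℂ] (Fin (T.dim n) → ℂ)} (hL : Function.Injective L)
    (h : ∀ x v, L (ψ'.rep x v) = ψ.1.rep x (L v)) : ψ'.IsAdmissible where
  continuous := by
    obtain ⟨I, hIo, -, -, hI⟩ := exists_open_subgroup_rep_eq_one ψ
    refine LHom.continuous_mat hIo fun i hi => LinearMap.ext fun v => hL ?_
    rw [h, hI i hi]
    rfl
  algebraic := by
    refine LHom.exists_mvPolynomial (isPolyFun_of_apply (τ := ψ'.rep.comp (MonoidHom.inr _ _))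
      fun v => ?_)
    obtain ⟨L', hL'⟩ := L.exists_leftInverse_of_injective (LinearMap.ker_eq_bot.2 hL)
    have h1 := (ψ.2.isPolyFun.map (LinearMap.applyₗ (L v))).map L'
    refine cast (congrArg IsPolyFun (funext fun g => ?_)) h1
    change L' (ψ.1.rep (1, g) (L v)) = ψ'.rep (1, g) v
    rw [← h]
    exact LinearMap.congr_fun hL' _
  semisimple w := isSemisimple_of_injective hL (h (w, 1)) (ψ.2.semisimple w)

theorem LHom.isBounded_of_isBoundedFun {ψ : LHom T n}
    (h : ∀ v, IsBoundedFun fun w : T.baseWeil => ψ.rep (w, 1) v) : ψ.IsBounded := by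
  choose C hC using fun j => fun i => h (Pi.single j 1) (LinearMap.proj i)
  refine LHom.isBounded_of_rep ⟨∑ j, ∑ i, |C j i|, fun w i j => ?_⟩
  have h1 : ‖ψ.rep (w, 1) (Pi.single j 1) i‖ ≤ C j i := hC j i w
  rw [LHom.rep_eq_std, Matrix.toLin'_apply, Matrix.mulVec_single_one] at h1
  refine h1.trans ((le_abs_self _).trans ?_)
  refine le_trans ?_ (Finset.single_le_sum (f := fun j => ∑ i, |C j i|)
    (fun j _ => by positivity) (Finset.mem_univ j))
  exact Finset.single_le_sum (f := fun i => |C j i|) (fun i _ => abs_nonneg _) (Finset.mem_univ i)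

theorem LHom.isBounded_of_equiv {ι : Type*} [Fintype ι] {d k : ι → ℕ}
    {φ : ∀ i, Representation ℂ T.baseWeil (Fin (d i) → ℂ)} {t : ι → ℝ}
    (hφ : ∀ i, IsIrredBounded (φ i)) (ht : ∀ i, t i = 0) {ψ : LHom T n}
    (e : (piRep fun i => tensorSym (absTwist (t i) (φ i)) (k i)).Equiv ψ.rep) : ψ.IsBounded := by
  classical
  refine LHom.isBounded_of_isBoundedFun fun v => ?_
  obtain ⟨x, rfl⟩ := e.toLinearEquiv.surjective v
  have h1 : IsBoundedFun fun w : T.baseWeil =>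
      (piRep fun i => tensorSym (absTwist (t i) (φ i)) (k i)) (w, 1) x := by
    have h2 := IsBoundedFun.sum Finset.univ fun i => (isBoundedFun_tensorSym (hφ i) (k i) (x i)).map
      (LinearMap.single ℂ (fun i => (Fin (d i) → ℂ) ⊗[ℂ] SymSpace (k i)) i)
    refine cast (congrArg IsBoundedFun (funext fun w => ?_)) h2
    rw [← Finset.univ_sum_single ((piRep fun i => tensorSym (absTwist (t i) (φ i)) (k i)) (w, 1) x)]
    refine Finset.sum_congr rfl fun i _ => ?_
    rw [piRep_apply, ht, absTwist_zero]
    rfl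
  refine cast (congrArg IsBoundedFun (funext fun w => ?_)) (h1.map e.toLinearEquiv.toLinearMap)
  exact equiv_apply_rep e (w, 1) x

/-- The decomposition of a parameter into twists of bounded irreducible representations. -/
theorem exists_decomposition (ψ : AdmissibleHom T n) :
    ∃ (ι : Type) (_ : Fintype ι) (k d : ι → ℕ) (t : ι → ℝ)
      (φ : ∀ i, Representation ℂ T.baseWeil (Fin (d i) → ℂ)), (∀ i, IsIrredBounded (φ i)) ∧
      (degOn T.baseWeil = 1 → ∀ i, t i = 0) ∧
      Nonempty ((piRep fun i => tensorSym (absTwist (t i) (φ i)) (k i)).Equiv ψ.1.rep) := by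
  obtain ⟨I, hIo, hId, hI, hI1⟩ := exists_open_subgroup_rep_eq_one ψ
  obtain ⟨ι, hι, k, d, σ, hσ, he⟩ := exists_tensor_decomposition (ρ := ψ.1.rep) ψ.2.isPolyFun
    (P := fun {d} σ => ∃ (t : ℝ) (φ : Representation ℂ T.baseWeil (Fin d → ℂ)),
      IsIrredBounded φ ∧ σ = absTwist t φ)
    fun U hU => decomposesInto_irreducible (ρ := ψ.1.rep.comp (MonoidHom.inl _ _)) hI hI1
      ψ.2.semisimple (fun σ h1 h2 => exists_absTwist_bounded hIo hId hI h1 h2) U hU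
  choose t φ hφ hσφ using hσ
  obtain rfl : σ = fun i => absTwist (t i) (φ i) := funext hσφ
  -- If the degree were trivial, twisting would have no effect and every exponent may be taken to be
  -- zero.
  by_cases hd : degOn T.baseWeil = 1
  · refine ⟨ι, hι, k, d, fun _ => 0, φ, hφ, fun _ _ => rfl, ?_⟩
    have h1 : ∀ i, absTwist (t i) (φ i) = absTwist 0 (φ i) := fun i => by
      ext1 h
      have h1 : WeilGroup.deg h.1 = 1 := DFunLike.congr_fun hd h
      rw [absTwist_apply, absTwist_apply, absPow_of_deg_eq_one _ h1, absPow_zero]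
    simpa only [h1] using he
  · exact ⟨ι, hι, k, d, t, φ, hφ, fun h => absurd h hd, he⟩

theorem IsPairing.comap {V W : Type*} [AddCommGroup V] [Module ℂ V] [AddCommGroup W] [Module ℂ W]
    {ρ : Representation ℂ (T.baseWeil × SL(2, ℂ)) V} {σ : Representation ℂ (T.baseWeil × SL(2, ℂ)) W}
    {B : W →ₗ[ℂ] W →ₗ[ℂ] ℂ} (h : IsPairing T s σ B) (e : ρ.Equiv σ) :
    IsPairing T s ρ (B.compl₁₂ e.toLinearEquiv.toLinearMap e.toLinearEquiv.toLinearMap) where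
  inv h' g x y := by
    have h1 := h.inv h' g (e.toLinearEquiv x) (e.toLinearEquiv y)
    rw [← equiv_apply_rep, ← equiv_apply_rep] at h1
    exact h1
  symm s₂ hs₂ x y := by
    have h1 := h.symm s₂ hs₂ (e.toLinearEquiv x) (e.toLinearEquiv y)
    rw [← equiv_apply_rep] at h1
    exact h1
  nondeg y hy := by
    refine e.toLinearEquiv.map_eq_zero_iff.1 (h.nondeg _ fun x => ?_)
    obtain ⟨x, rfl⟩ := e.toLinearEquiv.surjective x
    exact hy x

theorem HasDet.comap {V W : Type*} [AddCommGroup V] [Module ℂ V] [AddCommGroup W] [Module ℂ W]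
    {ρ : Representation ℂ (T.baseWeil × SL(2, ℂ)) V} {σ : Representation ℂ (T.baseWeil × SL(2, ℂ)) W}
    (h : HasDet T σ) (e : ρ.Equiv σ) : HasDet T ρ := fun hT x => by
  rw [← h hT x, ← LinearMap.det_conj (ρ x) e.toLinearEquiv]
  congr 1
  refine LinearMap.ext fun w => ?_
  obtain ⟨v, rfl⟩ := e.toLinearEquiv.surjective w
  change e.toLinearEquiv (ρ x (e.toLinearEquiv.symm (e.toLinearEquiv v))) = _
  rw [LinearEquiv.symm_apply_apply, equiv_apply_rep]

/-- The symmetry condition exchanges the two arguments up to a sign and the action of `s * s`. -/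
theorem IsPairing.nondeg_left {V : Type*} [AddCommGroup V] [Module ℂ V]
    {ρ : Representation ℂ (T.baseWeil × SL(2, ℂ)) V} {B : V →ₗ[ℂ] V →ₗ[ℂ] ℂ}
    (h : IsPairing T s ρ B) (hs : IsGaloisLift T s) (x : V) (hx : ∀ y, B x y = 0) : x = 0 := by
  refine h.nondeg x fun y => ?_
  have h1 := h.symm ⟨s * s, Family.mul_self_mem_baseWeil hs⟩ rfl x y
  rw [hx] at h1
  have h2 := congrArg (T.formSign * ·) h1
  simp only [mul_zero, ← mul_assoc, T.formSign_mul_self, one_mul] at h2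
  exact h2.symm

section Split

variable {ι : Type*} [Fintype ι] [DecidableEq ι] {W : ι → Type*} [∀ i, AddCommGroup (W i)]
  [∀ i, Module ℂ (W i)] {ρ : ∀ i, Representation ℂ (T.baseWeil × SL(2, ℂ)) (W i)}
  {B : (∀ i, W i) →ₗ[ℂ] (∀ i, W i) →ₗ[ℂ] ℂ} {t : ι → ℝ}

/-- The negative part is recorded as functionals on the positive part; moving the group element
across the pairing makes it act through the conjugate contragredient. -/
theorem IsPairing.splitMap_apply (h : IsPairing T s (piRep ρ) B) (x : T.baseWeil × SL(2, ℂ))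
    (z : ∀ i, W i) : splitMap t B (piRep ρ x z) =
      (piRep (fun i : {i // t i = 0} => ρ i) x (splitMap t B z).1,
        piRep (fun i : {i // 0 < t i} => ρ i) x (splitMap t B z).2.1,
        (piRep (fun i : {i // 0 < t i} => ρ i) (MulAut.conjNormal s x.1, x.2)⁻¹).dualMap
          (splitMap t B z).2.2) := by
  refine Prod.ext rfl (Prod.ext rfl (LinearMap.ext fun y => ?_))
  change B (piRep ρ x z) (extendPi _ y) =
    B z (extendPi _ (piRep _ (MulAut.conjNormal s x.1, x.2)⁻¹ y))
  rw [← h.inv x.1 x.2 z, piRep_extendPi, ← Module.End.mul_apply, ← map_mul, mul_inv_cancel,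
    map_one]
  rfl

/-- Here `s = 1`, and the determinants on the positive part and on its dual are inverse to each
other. -/
theorem IsPairing.hasDet_restrict [∀ i, FiniteDimensional ℂ (W i)] (h : IsPairing T s (piRep ρ) B)
    (hs : IsGaloisLift T s)
    (hB : ∀ i j, t i + t j ≠ 0 → ∀ a b, B (Pi.single i a) (Pi.single j b) = 0)
    (hdet : HasDet T (piRep ρ)) : HasDet T (piRep fun i : {i // t i = 0} => ρ i) := by
  intro hT x
  rw [Family.isGaloisLift_iff_eq_one hT.not_isUnitary] at hs
  subst hs
  let e := LinearEquiv.ofBijective _ (splitMap_bijective hB (h.nondeg_left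
    ((Family.isGaloisLift_iff_eq_one hT.not_isUnitary).2 rfl)))
  let A := piRep (fun i : {i // 0 < t i} => ρ i)
  have h1 : e.toLinearMap ∘ₗ piRep ρ x ∘ₗ e.symm.toLinearMap =
      (piRep (fun i : {i // t i = 0} => ρ i) x).prodMap ((A x).prodMap (A x⁻¹).dualMap) := by
    refine LinearMap.ext fun w => ?_
    obtain ⟨z, rfl⟩ := e.surjective w
    have h2 := h.splitMap_apply (t := t) x z
    rw [map_one, MulAut.one_apply] at h2
    rw [LinearMap.comp_apply, LinearMap.comp_apply, LinearEquiv.coe_coe, LinearEquiv.coe_coe,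
      LinearEquiv.symm_apply_apply]
    exact h2
  have h3 : LinearMap.det (A x) * LinearMap.det (A x⁻¹) = 1 := by
    rw [← LinearMap.det_comp, ← Module.End.mul_eq_comp, ← map_mul, mul_inv_cancel, map_one, map_one]
  rw [← hdet hT x, ← LinearMap.det_conj (piRep ρ x) e, h1, LinearMap.det_prodMap,
    LinearMap.det_prodMap, LinearMap.det_dualMap, h3, mul_one]

end Split

/-! ### Assembly of the tempered and the non-tempered part. -/

open SLTwo

variable {F : Type*} [Field F] [ValuativeRel F] [TopologicalSpace F] [IsNonarchimedeanLocalField F]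
  [CharZero F] {T : Family F} {s : WeilGroup F} {n : ℕ}

theorem Family.dim_add (T : Family F) (m k : ℕ) : T.dim (m + k) = T.dim m + 2 * k := by
  cases T <;> simp only [Family.dim] <;> omega

/-- The dimension of a representation with the determinant of a classical group. -/
theorem HasDet.le_of_finrank {V : Type*} [AddCommGroup V] [Module ℂ V]
    {ρ : Representation ℂ (T.baseWeil × SL(2, ℂ)) V} (h : HasDet T ρ) {k : ℕ}
    (hk : Module.finrank ℂ V + 2 * k = T.dim n) : k ≤ n := by
  cases T with
  | quasiEvenOrth ε hε =>
    -- If `k > n`, then `V` would be zero, with determinant one, although the quadratic character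
    -- takes the value `-1`.
    by_contra hlt
    simp only [Family.dim] at hk
    obtain ⟨w, hw⟩ := exists_quadChar_eq_neg_one ε hε
    have h1 := h trivial (⟨w, trivial⟩, 1)
    rw [LinearMap.det_eq_one_of_finrank_eq_zero (by omega)] at h1
    change (1 : ℂ) = ((quadChar ε hε w : ℤ) : ℂ) at h1
    rw [hw] at h1
    norm_num at h1
  | _ =>
    simp only [Family.dim] at hk
    omega

theorem nontrivial_tensorSymSpace (V : Type*) [AddCommGroup V] [Module ℂ V] [FiniteDimensional ℂ V]
    [Nontrivial V] (k : ℕ) : Nontrivial (V ⊗[ℂ] SymSpace k) := by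
  have h1 : Nontrivial (SymSpace k) := ⟨topVec k, 0, fun h => by
    have h2 := congrArg (fun p : SymSpace k => MvPolynomial.eval ![1, 0]
      (p : MvPolynomial (Fin 2) ℂ)) h
    simp [topVec] at h2⟩
  refine Module.nontrivial_of_finrank_pos (R := ℂ) ?_
  rw [Module.finrank_tensorProduct]
  exact mul_pos Module.finrank_pos Module.finrank_pos

theorem exists_sorted {ι : Type*} [Fintype ι] (t : ι → ℝ) :
    ∃ (f : ℕ) (e : Fin f ≃ ι), ∀ i j, i ≤ j → t (e j) ≤ t (e i) := by
  let e₀ := (Fintype.equivFin ι).symm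
  refine ⟨_, (Tuple.sort fun i => -t (e₀ i)).trans e₀, fun i j hij => ?_⟩
  have h := Tuple.monotone_sort (fun i => -t (e₀ i)) hij
  simpa using h

variable {ι : Type*} [Fintype ι] {d k : ι → ℕ}
  {φ : ∀ i, Representation ℂ T.baseWeil (Fin (d i) → ℂ)} {t : ι → ℝ}

/-- A sum of representations together with its contragredient is a non-tempered part. -/
theorem exists_nonTempered_equiv (s : WeilGroup F) {f : ℕ} (e : Fin f ≃ ι) :
    ∃ L : ((∀ i, (Fin (d i) → ℂ) ⊗[ℂ] SymSpace (k i)) ×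
        Module.Dual ℂ (∀ i, (Fin (d i) → ℂ) ⊗[ℂ] SymSpace (k i))) →ₗ[ℂ]
        DirectSum (Fin f) fun i => ((Fin (d (e i)) → ℂ) ⊗[ℂ] SymSpace (k (e i))) ×
          (Module.Dual ℂ (Fin (d (e i)) → ℂ) ⊗[ℂ] SymSpace (k (e i))),
      Function.Bijective L ∧ ∀ (x : T.baseWeil × SL(2, ℂ)) z,
        L (piRep (fun i => tensorSym (absTwist (t i) (φ i)) (k i)) x z.1,
            (piRep (fun i => tensorSym (absTwist (t i) (φ i)) (k i))
              (MulAut.conjNormal s x.1, x.2)⁻¹).dualMap z.2) =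
          nonTemperedPart T s (fun i => k (e i)) (fun i => (k (e i) : ℝ) / 2 - t (e i))
            (fun i => φ (e i)) x (L z) := by
  classical
  choose E hE using fun i => exists_dual_tensorSym (φ i) (t i) (k i) s
  let ρ := fun i => tensorSym (absTwist (t i) (φ i)) (k i)
  let Γ : ((∀ i, (Fin (d i) → ℂ) ⊗[ℂ] SymSpace (k i)) ×
      Module.Dual ℂ (∀ i, (Fin (d i) → ℂ) ⊗[ℂ] SymSpace (k i))) →ₗ[ℂ]
      ∀ i : Fin f, ((Fin (d (e i)) → ℂ) ⊗[ℂ] SymSpace (k (e i))) ×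
        (Module.Dual ℂ (Fin (d (e i)) → ℂ) ⊗[ℂ] SymSpace (k (e i))) :=
    LinearMap.pi fun i => (LinearMap.proj (e i)).prodMap
      ((E (e i)).symm.toLinearMap ∘ₗ (LinearMap.single ℂ _ (e i)).dualMap)
  have hΓ : ∀ z i, Γ z i = (z.1 (e i), (E (e i)).symm ((LinearMap.single ℂ _ (e i)).dualMap z.2)) :=
    fun z i => rfl
  have hinj : Function.Injective Γ := by
    rw [← LinearMap.ker_eq_bot, LinearMap.ker_eq_bot']
    intro z hz
    have h1 : ∀ i, z.1 (e i) = 0 := fun i => congrArg Prod.fst (congrFun hz i)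
    have h2 : ∀ i, (LinearMap.single ℂ _ (e i)).dualMap z.2 = 0 := fun i =>
      (E (e i)).symm.map_eq_zero_iff.1 (congrArg Prod.snd (congrFun hz i))
    refine Prod.ext (funext fun j => ?_) (LinearMap.pi_ext' fun j => ?_)
    · obtain ⟨i, rfl⟩ := e.surjective j
      exact h1 i
    · obtain ⟨i, rfl⟩ := e.surjective j
      exact h2 i
  have hfin : Module.finrank ℂ ((∀ i, (Fin (d i) → ℂ) ⊗[ℂ] SymSpace (k i)) ×
      Module.Dual ℂ (∀ i, (Fin (d i) → ℂ) ⊗[ℂ] SymSpace (k i))) =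
      Module.finrank ℂ (∀ i : Fin f, ((Fin (d (e i)) → ℂ) ⊗[ℂ] SymSpace (k (e i))) ×
        (Module.Dual ℂ (Fin (d (e i)) → ℂ) ⊗[ℂ] SymSpace (k (e i)))) := by
    rw [Module.finrank_prod, Subspace.dual_finrank_eq, Module.finrank_pi_fintype,
      Module.finrank_pi_fintype, ← Finset.sum_add_distrib, ← e.sum_comp]
    refine Finset.sum_congr rfl fun i _ => ?_
    rw [Module.finrank_prod, (E (e i)).finrank_eq, Subspace.dual_finrank_eq]
  have hbij : Function.Bijective Γ :=
    ⟨hinj, (LinearMap.injective_iff_surjective_of_finrank_eq_finrank hfin).1 hinj⟩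
  let D := DirectSum.linearEquivFunOnFintype ℂ (Fin f) fun i =>
    ((Fin (d (e i)) → ℂ) ⊗[ℂ] SymSpace (k (e i))) ×
      (Module.Dual ℂ (Fin (d (e i)) → ℂ) ⊗[ℂ] SymSpace (k (e i)))
  have hDsymm : ∀ z i, (D.symm z) i = z i := fun z i => congrFun (D.apply_symm_apply z) i
  refine ⟨D.symm.toLinearMap ∘ₗ Γ, D.symm.bijective.comp hbij, fun x z => ?_⟩
  have hN : nonTemperedPart T s (fun i => k (e i)) (fun i => (k (e i) : ℝ) / 2 - t (e i))
      (fun i => φ (e i)) = Representation.directSum fun i : Fin f =>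
        (tensorSym (absTwist (t (e i)) (φ (e i))) (k (e i))).prod
          (tensorSym (absTwist (-t (e i)) (conjDual s (φ (e i)))) (k (e i))) := by
    -- For `q = k / 2 - t` the exponents `-q + k / 2` and `q - k / 2` are `t` and `-t`.
    have h1 : ∀ a b : ℝ, -(a / 2 - b) + a / 2 = b := fun a b => by ring
    have h2 : ∀ a b : ℝ, a / 2 - b - a / 2 = -b := fun a b => by ring
    simp only [nonTemperedPart, h1, h2]
  rw [hN]
  refine DFinsupp.ext fun i => ?_
  change D.symm (Γ _) i = ((tensorSym (absTwist (t (e i)) (φ (e i))) (k (e i))).prod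
    (tensorSym (absTwist (-t (e i)) (conjDual s (φ (e i)))) (k (e i)))) x (D.symm (Γ z) i)
  rw [hDsymm, hDsymm, hΓ, hΓ]
  refine Prod.ext rfl ((E (e i)).injective (LinearMap.ext fun y => ?_))
  change E (e i) ((E (e i)).symm _) y = E (e i) (tensorSym _ _ (x.1, x.2) _) y
  rw [hE, LinearEquiv.apply_symm_apply]
  change z.2 (piRep ρ (MulAut.conjNormal s x.1, x.2)⁻¹ (Pi.single (e i) y)) =
    E (e i) ((E (e i)).symm _) _
  rw [LinearEquiv.apply_symm_apply, piRep_single]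
  rfl

/-- A non-tempered parameter is the sum of a tempered one and a non-tempered part. -/
theorem isBounded_or_exists_nonTempered (hs : IsGaloisLift T s) (ψ : AdmissibleHom T n) :
    ψ.1.IsBounded ∨ ∃ m < n, ∃ ψt : AdmissibleHom T m, ψt.1.IsBounded ∧
      ∃ (f : ℕ) (w : Fin f → ℕ) (q : Fin f → ℝ) (d : Fin f → ℕ)
        (ρ : ∀ i, Representation ℂ T.baseWeil (Fin (d i) → ℂ)),
        0 < f ∧ (∀ i, IsIrredBounded (ρ i)) ∧
        (∀ i j, i ≤ j → (w j : ℝ) / 2 - q j ≤ (w i : ℝ) / 2 - q i) ∧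
        (∀ i, 0 < (w i : ℝ) / 2 - q i) ∧
        Nonempty (ψ.1.rep.Equiv (ψt.1.rep.prod (nonTemperedPart T s w q ρ))) := by
  classical
  obtain ⟨ι, _, k, d, t, φ, hφ, ht, ⟨e⟩⟩ := exists_decomposition ψ
  by_cases h0 : ∀ i, t i = 0
  · exact Or.inl (LHom.isBounded_of_equiv hφ h0 e)
  right
  push Not at h0
  obtain ⟨i₀, hi₀⟩ := h0
  obtain ⟨B₀, hB₀⟩ := ψ.1.exists_isPairing hs
  have hP := hB₀.comap e
  have hdet := ψ.1.hasDet_rep.comap e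
  set B := B₀.compl₁₂ e.toLinearEquiv.toLinearMap e.toLinearEquiv.toLinearMap with hBdef
  have hB := hP.single_eq_zero hφ ht
  have hnd := hP.nondeg_left hs
  have hnt : ∀ i, Nontrivial ((Fin (d i) → ℂ) ⊗[ℂ] SymSpace (k i)) := fun i =>
    have := nontrivial_of_isIrreducible (hφ i).irreducible
    nontrivial_tensorSymSpace _ _
  -- The nonzero exponent found may be negative; duality supplies a positive one, which gives `0 <
  -- f` and `m < n`.
  obtain ⟨j₀, hj₀⟩ := exists_pos_of_pairing hB hnd hi₀
  have hP0 := hP.restrict hB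
  have hdet0 := hP.hasDet_restrict hs hB hdet
  have hfin := finrank_eq_of_pairing hB hnd
  rw [e.toLinearEquiv.finrank_eq, Module.finrank_fin_fun] at hfin
  have hpos : 0 < Module.finrank ℂ (∀ i : {i // 0 < t i}, (Fin (d i) → ℂ) ⊗[ℂ] SymSpace (k i)) := by
    have : Nontrivial (∀ i : {i // 0 < t i}, (Fin (d i) → ℂ) ⊗[ℂ] SymSpace (k i)) :=
      have : ∀ i : {i // 0 < t i}, Nontrivial ((Fin (d i) → ℂ) ⊗[ℂ] SymSpace (k i)) := fun i => hnt i
      Pi.nontrivial_at (f := fun i : {i // 0 < t i} => (Fin (d i) → ℂ) ⊗[ℂ] SymSpace (k i)) ⟨j₀, hj₀⟩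
    exact Module.finrank_pos
  -- The rank drops by the dimension of the positive part, and this bound keeps the new rank `m` a
  -- natural number.
  have hle := hdet0.le_of_finrank hfin.symm
  obtain ⟨m, hm⟩ := Nat.exists_eq_add_of_le' hle
  have hdim : Module.finrank ℂ (∀ i : {i // t i = 0}, (Fin (d i) → ℂ) ⊗[ℂ] SymSpace (k i)) =
      T.dim m := by
    have h1 := T.dim_add m
      (Module.finrank ℂ (∀ i : {i // 0 < t i}, (Fin (d i) → ℂ) ⊗[ℂ] SymSpace (k i)))
    rw [← hm] at h1
    omega
  obtain ⟨ψt, ⟨et⟩⟩ := exists_lhom_of_pairing hs hdim hP0 hdet0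
  have hadm : ψt.IsAdmissible := by
    refine LHom.isAdmissible_of_injective ψ (L := e.toLinearEquiv.toLinearMap ∘ₗ
      extendPi (fun i => t i = 0) ∘ₗ et.toLinearEquiv.symm.toLinearMap) ?_ fun x v => ?_
    · have h1 : Function.Injective
          (extendPi (W := fun i => (Fin (d i) → ℂ) ⊗[ℂ] SymSpace (k i)) fun i => t i = 0) :=
        Function.LeftInverse.injective (g := restrictPi fun i => t i = 0) restrictPi_extendPi
      exact e.toLinearEquiv.injective.comp (h1.comp et.toLinearEquiv.symm.injective)
    · obtain ⟨v, rfl⟩ := et.toLinearEquiv.surjective v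
      change e.toLinearEquiv (extendPi _ (et.toLinearEquiv.symm (ψt.rep x (et.toLinearEquiv v)))) =
        ψ.1.rep x (e.toLinearEquiv (extendPi _ (et.toLinearEquiv.symm (et.toLinearEquiv v))))
      rw [← equiv_apply_rep, LinearEquiv.symm_apply_apply, LinearEquiv.symm_apply_apply,
        ← equiv_apply_rep, piRep_extendPi]
  have hbdd : ψt.IsBounded := LHom.isBounded_of_equiv (t := fun i : {i // t i = 0} => t i)
    (fun i => hφ i) (fun i => i.2) et
  obtain ⟨f, σ, hσ⟩ := exists_sorted fun i : {i // 0 < t i} => t i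
  obtain ⟨L, hL, hLe⟩ := exists_nonTempered_equiv (T := T) (d := fun i : {i // 0 < t i} => d i)
    (k := fun i : {i // 0 < t i} => k i) (φ := fun i : {i // 0 < t i} => φ i)
    (t := fun i : {i // 0 < t i} => t i) s σ
  -- With this choice of `q` the numbers `w i / 2 - q i` are the positive exponents in decreasing
  -- order.
  refine ⟨m, by omega, ⟨ψt, hadm⟩, hbdd, f, fun i => k (σ i), fun i => (k (σ i) : ℝ) / 2 - t (σ i),
    fun i => d (σ i), fun i => φ (σ i), (σ.symm ⟨j₀, hj₀⟩).pos, fun i => hφ _, fun i j hij => ?_,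
    fun i => ?_, ?_⟩
  · have := hσ i j hij
    dsimp only
    linarith
  · have := (σ i).2
    dsimp only
    linarith
  · obtain ⟨e₁⟩ : Nonempty ((piRep fun i => tensorSym (absTwist (t i) (φ i)) (k i)).Equiv
        ((piRep fun i : {i // t i = 0} => tensorSym (absTwist (t i) (φ i)) (k i)).prod
          (nonTemperedPart T s (fun i => k (σ i)) (fun i => (k (σ i) : ℝ) / 2 - t (σ i))
            fun i => φ (σ i)))) := by
      refine nonempty_equiv_of_bijective ((LinearMap.id.prodMap L) ∘ₗ splitMap t B) (fun x z => ?_)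
        ((Function.bijective_id.prodMap hL).comp (splitMap_bijective hB hnd))
      rw [LinearMap.comp_apply, LinearMap.comp_apply, hP.splitMap_apply]
      exact Prod.ext rfl (hLe x (splitMap t B z).2)
    obtain ⟨e₂⟩ := nonempty_prod_equiv et (nonTemperedPart T s (fun i => k (σ i))
      (fun i => (k (σ i) : ℝ) / 2 - t (σ i)) fun i => φ (σ i))
    exact ⟨e.symm.trans (e₁.trans e₂)⟩

end LanglandsParam

end

open LanglandsParam

theorem mainTheorem10 {F : Type*} [Field F] [ValuativeRel F] [TopologicalSpace F]
    [IsNonarchimedeanLocalField F] [CharZero F] (T : Family F) (n : ℕ) (φ : LParameter T n) :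
    φ ∈ tempered T n ∨
      ∃ m < n, ∃ φt ∈ tempered T m, ∃ (f : ℕ) (w : Fin f → ℕ) (q : Fin f → ℝ) (d : Fin f → ℕ)
        (ρ : ∀ i, Representation ℂ T.baseWeil (Fin (d i) → ℂ)) (s : WeilGroup F),
        0 < f ∧ (∀ i, IsIrredBounded (ρ i)) ∧
        (∀ i j, i ≤ j → (w j : ℝ) / 2 - q j ≤ (w i : ℝ) / 2 - q i) ∧
        (∀ i, 0 < (w i : ℝ) / 2 - q i) ∧
        IsGaloisLift T s ∧
        ∀ (ψ : AdmissibleHom T n) (ψt : AdmissibleHom T m),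
          Quotient.mk _ ψ = φ → Quotient.mk _ ψt = φt →
            Nonempty (ψ.1.rep.Equiv (ψt.1.rep.prod (nonTemperedPart T s w q ρ))) := by
  obtain ⟨ψ₀, rfl⟩ := Quotient.exists_rep φ
  obtain ⟨s, hs⟩ := T.exists_isGaloisLift
  rcases isBounded_or_exists_nonTempered hs ψ₀ with h |
    ⟨m, hm, ψt₀, hb, f, w, q, d, ρ, hf, hρ, hsort, hpos, ⟨e⟩⟩
  · exact Or.inl ⟨ψ₀, rfl, h⟩
  · refine Or.inr ⟨m, hm, _, ⟨ψt₀, rfl, hb⟩, f, w, q, d, ρ, s, hf, hρ, hsort, hpos, hs,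
      fun ψ ψt hψ hψt => ?_⟩
    -- The isomorphism was found for chosen representatives; conjugate ones have isomorphic standard
    -- representations.
    obtain ⟨e₁⟩ := nonempty_equiv_of_conj (Quotient.exact hψ.symm)
    obtain ⟨e₂⟩ := nonempty_equiv_of_conj (Quotient.exact hψt)
    obtain ⟨e₃⟩ := nonempty_prod_equiv e₂ (nonTemperedPart T s w q ρ)
    exact ⟨e₁.trans (e.trans e₃)⟩
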